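/- Setting. There are $n\ge 2$ workers; worker $i$ has a data distribution $\mathcal D_i$ and a loss $F_i(x;\xi)$, $f_i(x)=\mathbb E_{\xi\sim\mathcal D_i}F_i(x;\xi)$ and $f=\frac1n\sum_{i=1}^n f_i$. Models are real vectors divided into $n$ blocks of equal size. The RPS algorithm with step size $\gamma$ and packet drop rate $p\in[0,1)$ starts from $x_1^{(i)}=0$ for all $i$ and runs, for $t=1,\dots,T$: each worker samples $\xi_t^{(i)}\sim\mathcal D_i$ and computes $v_t^{(i)}=x_t^{(i)}-\gamma\nabla F_i(x_t^{(i)};\xi_t^{(i)})$; a uniformly random assignment (a permutation) gives each block $j$ a worker $b_t^{(j)}$ that averages it; every worker sends its $j$-th block of $v_t$ to $b_t^{(j)}$, which averages the blocks it receives (its own is always among them) and broadcasts the average to all workers; a worker that receives it (worker $b_t^{(j)}$ always does) uses it as $j$-th block of $x_{t+1}^{(i)}$, and otherwise keeps its own $j$-th block of $v_t^{(i)}$. Every packet is dropped with probability $p$; all drops, samples and assignments are independent. Thus the $j$-th blocks satisfy $X_{t+1}^{(j)}=V_t^{(j)}W_t^{(j)}$ for a random matrix $W_t^{(j)}\in\mathbb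 R^{n\times n}$. Let $\bar x_t=\frac1n\sum_i x_t^{(i)}$ and let $A_n$ be the $n\times n$ matrix with all entries $1/n$. Assumptions. Each $\nabla f_i$ is $L$-Lipschitz with $L>0$; $\mathbb E_{\xi\sim\mathcal D_i}\|\nabla F_i(x;\xi)-\nabla f_i(x)\|^2\le\sigma^2$ and $\frac1n\sum_i\|\nabla f_i(x)-\nabla f(x)\|^2\le\zeta^2$ for all $i$ and $x$, with $\sigma,\zeta\ge0$; $f^*=\inf f>-\infty$. Claim. There are unique constants $\alpha_1,\alpha_2$, depending only on $n$ and $p$, with $$\mathbb E\big[W_t^{(j)}(W_t^{(j)})^\top\big]=\alpha_1I_n+(1-\alpha_1)A_n,\qquad \mathbb E\big[W_t^{(j)}A_n(W_t^{(j)})^\top\big]=\alpha_2I_n+(1-\alpha_2)A_n$$ for all $j,t$; they satisfy $0\le\alpha_2\le\alpha_1<1$, and $0<\alpha_2<\alpha_1$ if $p>0$. Put $\beta=\alpha_1-\alpha_2$ and choose $$\gamma=\frac{1-\sqrt\beta}{6L+3(\sigma+\zeta)\sqrt{\alpha_2T}+\sigma\sqrt T/\sqrt n}.$$ Then there is a constant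 $C$ that depends only on $L$, $f(0)$ and $f^*$ such that, for all $T\ge1$, $$\frac1T\sum_{t=1}^T\mathbb E\|\nabla f(\bar x_t)\|^2\le C\left(\frac{(\sigma+\zeta)(1+\sqrt{n\alpha_2})}{(1-\sqrt\beta)\sqrt{nT}}+\frac1{(1-\sqrt\beta)T}+\frac{n(\sigma^2+\zeta^2)}{(1+n\alpha_2)\sigma^2T+n\alpha_2T\zeta^2}\right),$$ where the last fraction is read as $0$ if its denominator is $0$. For every $p_{\max}<1$ the same holds for all $p\le p_{\max}$ with $\frac1T$ in place of $\frac1{(1-\sqrt\beta)T}$, with a constant that depends only on $L$, $f(0)$, $f^*$ and $p_{\max}$. In particular, for fixed $p<1$, $L$, $f(0)$, $f^*$, $\sigma>0$ and $\zeta$, the left-hand side is at most $C'/\sqrt{nT}$ for all $n\ge2$ and $T\ge n^3$, with $C'$ independent of $n$ and $T$ (linear speedup in the number of workers). -/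

import Mathlib

open MeasureTheory ProbabilityTheory Matrix

noncomputable section

namespace RPS

/-! ### Models, losses and standing assumptions -/

/-- A model, divided into `n` equally sized blocks of `m` real coordinates; coordinate `(j, k)` is
the `k`-th coordinate of block `j`. The norm is the Euclidean norm. -/
abbrev Model (n m : ℕ) : Type := EuclideanSpace ℝ (Fin n × Fin m)

variable {n m : ℕ}

/-- The local expected loss `f_i(x) = E_{ξ ∼ D_i} F_i(x; ξ)`. -/
def localLoss {Ξ : Fin n → Type*} [∀ i, MeasurableSpace (Ξ i)] (D : ∀ i, Measure (Ξ i))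
    (F : ∀ i, Model n m → Ξ i → ℝ) (i : Fin n) (x : Model n m) : ℝ :=
  ∫ ξ, F i x ξ ∂(D i)

/-- The global loss `f(x) = (1/n) ∑ i, f_i(x)`. -/
def globalLoss {Ξ : Fin n → Type*} [∀ i, MeasurableSpace (Ξ i)] (D : ∀ i, Measure (Ξ i))
    (F : ∀ i, Model n m → Ξ i → ℝ) (x : Model n m) : ℝ :=
  (n : ℝ)⁻¹ * ∑ i, localLoss D F i x

/-- The stochastic gradient `∇ F_i(x; ξ)`, the gradient being taken in `x`. -/
def stochGrad {Ξ : Fin n → Type*} (F : ∀ i, Model n m → Ξ i → ℝ) (i : Fin n) (x : Model n m)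
    (ξ : Ξ i) : Model n m :=
  gradient (fun y => F i y ξ) x

/-- The assumptions on the optimization problem: the losses are well defined and differentiable,
the gradients of the local losses are `L`-Lipschitz, the variance of the stochastic gradients is at
most `σ²`, and the mean square deviation of the local gradients from the global one is at most
`ζ²`. -/
structure Assumptions {Ξ : Fin n → Type*} [∀ i, MeasurableSpace (Ξ i)] (D : ∀ i, Measure (Ξ i))
    (F : ∀ i, Model n m → Ξ i → ℝ) (L σ ζ : ℝ) : Prop where
  measurable_loss : ∀ i, Measurable (Function.uncurry (F i))
  integrable_loss : ∀ i x, Integrable (F i x) (D i)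
  differentiable_loss : ∀ i ξ, Differentiable ℝ (fun x => F i x ξ)
  differentiable_localLoss : ∀ i, Differentiable ℝ (localLoss D F i)
  lipschitz_gradient : ∀ i x y,
    ‖gradient (localLoss D F i) x - gradient (localLoss D F i) y‖ ≤ L * ‖x - y‖
  integrable_variance : ∀ i x,
    Integrable (fun ξ => ‖stochGrad F i x ξ - gradient (localLoss D F i) x‖ ^ 2) (D i)
  variance_le : ∀ i x,
    ∫ ξ, ‖stochGrad F i x ξ - gradient (localLoss D F i) x‖ ^ 2 ∂(D i) ≤ σ ^ 2
  dissimilarity_le : ∀ x,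
    (n : ℝ)⁻¹ * ∑ i, ‖gradient (localLoss D F i) x - gradient (globalLoss D F) x‖ ^ 2 ≤ ζ ^ 2

/-! ### The unreliable network -/

/-- Permutations of the workers carry the discrete σ-algebra. -/
instance instMeasurableSpacePerm (n : ℕ) : MeasurableSpace (Equiv.Perm (Fin n)) := ⊤

/-- What happens in the network in one iteration: `c.1 j` is the worker that averages block `j`
(workers are assigned to blocks without replacement); `c.2.1 i j` tells that the packet with block
`j` from worker `i` to worker `c.1 j` is dropped; `c.2.2 i j` tells that the packet with the
averaged block `j` from worker `c.1 j` to worker `i` is dropped. -/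
abbrev Comm (n : ℕ) : Type :=
  Equiv.Perm (Fin n) × (Fin n → Fin n → Bool) × (Fin n → Fin n → Bool)

/-- The probability of a network outcome: the assignment is uniform, and the packets are dropped
with probability `p`, independently of each other and of the assignment. -/
def commProb (p : ℝ) (c : Comm n) : ℝ :=
  (Fintype.card (Equiv.Perm (Fin n)) : ℝ)⁻¹ *
    (∏ i, ∏ j, if c.2.1 i j then p else 1 - p) * (∏ i, ∏ j, if c.2.2 i j then p else 1 - p)

/-- The law of the network outcome of one iteration. -/
def commLaw (n : ℕ) (p : ℝ) : Measure (Comm n) :=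
  ∑ c : Comm n, ENNReal.ofReal (commProb p c) • Measure.dirac c

/-- The workers whose block `j` reaches the worker that averages block `j`; this worker always has
its own block. -/
def senders (c : Comm n) (j : Fin n) : Finset (Fin n) :=
  Finset.univ.filter fun i => i = c.1 j ∨ c.2.1 i j = false

/-- The workers that obtain the averaged block `j`; the worker that averages it always does. -/
def receivers (c : Comm n) (j : Fin n) : Finset (Fin n) :=
  Finset.univ.filter fun i => i = c.1 j ∨ c.2.2 i j = false

/-- The coefficient matrix `W^{(j)}` of block `j`: column `i` holds the coefficients with which the
blocks `j` of all workers enter the new block `j` of worker `i`. -/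
def weight (c : Comm n) (j : Fin n) : Matrix (Fin n) (Fin n) ℝ :=
  Matrix.of fun k i =>
    if i ∈ receivers c j then (if k ∈ senders c j then ((senders c j).card : ℝ)⁻¹ else 0)
    else if k = i then 1 else 0

/-- The matrix `A_n` all of whose entries are `1/n`. -/
def avgMatrix (n : ℕ) : Matrix (Fin n) (Fin n) ℝ :=
  Matrix.of fun _ _ => (n : ℝ)⁻¹

/-- The equations that define `α₁` and `α₂` (for `n ≥ 2` each has at most one solution):
`E[W Wᵀ] = α₁ I + (1 - α₁) A_n` and `E[W A_n Wᵀ] = α₂ I + (1 - α₂) A_n` for every block. -/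
def IsMixing (n : ℕ) (p α₁ α₂ : ℝ) : Prop :=
  ∀ j : Fin n,
    ∑ c : Comm n, commProb p c • (weight c j * (weight c j)ᵀ) =
        α₁ • (1 : Matrix (Fin n) (Fin n) ℝ) + (1 - α₁) • avgMatrix n ∧
    ∑ c : Comm n, commProb p c • (weight c j * avgMatrix n * (weight c j)ᵀ) =
        α₂ • (1 : Matrix (Fin n) (Fin n) ℝ) + (1 - α₂) • avgMatrix n

/-! ### The algorithm -/

/-- The average of the local models of all workers. -/
def average (x : Fin n → Model n m) : Model n m :=
  (n : ℝ)⁻¹ • ∑ i, x i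

/-- One iteration: a local stochastic gradient step of every worker, which gives the intermediate
models `v`, followed by the exchange of blocks. A worker that obtains the averaged block `j` adopts
it, and keeps its own intermediate block `j` otherwise. -/
def step {Ξ : Fin n → Type*} (F : ∀ i, Model n m → Ξ i → ℝ) (γ : ℝ) (x : Fin n → Model n m)
    (o : (∀ i, Ξ i) × Comm n) : Fin n → Model n m :=
  let v : Fin n → Model n m := fun i => x i - γ • stochGrad F i (x i) (o.1 i)
  fun i => WithLp.toLp 2 fun jk =>
    if i ∈ receivers o.2 jk.1 then
      ((senders o.2 jk.1).card : ℝ)⁻¹ * ∑ k ∈ senders o.2 jk.1, v k jk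
    else v i jk

/-- The local models. All workers start from `0`; time is counted from `0`, so that
`iterates F γ o t` are the local models that iteration number `t + 1` starts from, and `o t` holds
the data samples and the network outcome of that iteration. -/
def iterates {Ξ : Fin n → Type*} (F : ∀ i, Model n m → Ξ i → ℝ) (γ : ℝ)
    (o : ℕ → (∀ i, Ξ i) × Comm n) : ℕ → Fin n → Model n m
  | 0 => 0
  | t + 1 => step F γ (iterates F γ o t) (o t)

/-- The randomness of the algorithm: the outcomes `o t` of the iterations are independent, and in
each iteration the data samples `ξ^{(i)} ∼ D_i` of the workers and the network outcome are
independent. -/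
structure IsRandomness {Ξ : Fin n → Type*} [∀ i, MeasurableSpace (Ξ i)] (D : ∀ i, Measure (Ξ i))
    (p : ℝ) {Ω : Type*} [MeasurableSpace Ω] (P : Measure Ω)
    (o : ℕ → Ω → (∀ i, Ξ i) × Comm n) : Prop where
  measurable : ∀ t, Measurable (o t)
  indep : iIndepFun o P
  law : ∀ t, P.map (o t) = (Measure.pi D).prod (commLaw n p)

/-- The step size `(1 - √β) / (6 L + 3 (σ + ζ) √(α₂ T) + σ √T / √n)`, where `β = α₁ - α₂`. -/
def stepSize (n T : ℕ) (α₁ α₂ L σ ζ : ℝ) : ℝ :=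
  (1 - √(α₁ - α₂)) / (6 * L + 3 * (σ + ζ) * √(α₂ * T) + σ * √T / √n)

/-- `(1/T) ∑_{t=1}^T E ‖∇ f(x̄_t)‖² ≤ R` (with all expectations finite) for all problems with `n`
workers that satisfy the assumptions and have `f(0) = f₀` and `inf f = fstar`, where `x̄_t` is the
average of the local models of the algorithm with step size `γ` and packet drop rate `p`. -/
def GuaranteedRate.{u, v} (n T : ℕ) (p γ L σ ζ f₀ fstar R : ℝ) : Prop :=
  ∀ (m : ℕ) (Ξ : Fin n → Type u) [∀ i, MeasurableSpace (Ξ i)] (D : ∀ i, Measure (Ξ i))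
    [∀ i, IsProbabilityMeasure (D i)] (F : ∀ i, Model n m → Ξ i → ℝ)
    (Ω : Type v) [MeasurableSpace Ω] (P : Measure Ω) [IsProbabilityMeasure P]
    (o : ℕ → Ω → (∀ i, Ξ i) × Comm n),
    Assumptions D F L σ ζ →
    globalLoss D F 0 = f₀ →
    IsGLB (Set.range (globalLoss D F)) fstar →
    IsRandomness D p P o →
    (∀ t < T, Integrable (fun ω =>
      ‖gradient (globalLoss D F) (average (iterates F γ (fun s => o s ω) t))‖ ^ 2) P) ∧
    (T : ℝ)⁻¹ * ∑ t ∈ Finset.range T, ∫ ω,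
      ‖gradient (globalLoss D F) (average (iterates F γ (fun s => o s ω) t))‖ ^ 2 ∂P ≤ R

end RPS

end

namespace RPS

/-! ### Expectations over network outcomes -/

/-! The network enters the analysis only through α₁ and α₂. Relabelling workers and blocks preserves
the law of the outcomes, so the two expected matrices are invariant under simultaneous row and
column permutations. Columns of W sum to 1, which fixes the sum of all entries, and double
transitivity of the permutations leaves only αI + (1 − α)A_n (`exists_expectation_eq`). Taking
traces (`IsMixing.trace_left`, `IsMixing.trace_right`) turns bounds on α₁, α₂ into expectations of
explicit functions of the sets of senders and receivers. This gives the signs, and the estimates β ≤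
1 − (1 − p)² (`IsMixing.sub_le`) and nα₂ = O(1/(1 − p)) (`IsMixing.mul_right_le`).

An exchange keeps the average in expectation but adds α₂/n times the spread to its mean square error
(`IsMixing.expectation_average_mix`), and it contracts the expected spread by β
(`IsMixing.expectation_spread_mix`). A local step multiplies the root mean spread by at most 1 + γL
and adds at most γ√n(σ + ζ). The summand 6L in the step size keeps the combined factor (1 + γL)√β
below 1, so the root mean spread of the intermediate models stays below some h of order γ√n(σ +
ζ)/(1 − √β) (`integral_spread_iterates_le`).

The quadratic upper bound for f along the averages gives the expected decrease in one iteration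
(`integral_globalLoss_step_le`). Telescoping leaves four error terms
(`mean_integral_gradient_sq_le`), which the summands of the denominator of the step size bound by
the stated rate (`rate_bound`).

Two points of probability support this. Unbiasedness of the stochastic gradients is not an
assumption: it follows by differentiating under the integral, with an L² bound in place of a
dominating function (`integral_inner_noise`). And the models at time t are independent of the
outcome of the next iteration, so bounds for fixed models may be integrated
(`integral_iterates_succ_le`). -/

theorem commProb_nonneg {n : ℕ} {p : ℝ} (hp : 0 ≤ p) (hp1 : p < 1) (c : Comm n) :
    0 ≤ commProb p c := by
  have h : ∀ b : Bool, 0 ≤ (if b then p else 1 - p) := fun b => by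
    split_ifs <;> linarith
  unfold commProb
  exact mul_nonneg (mul_nonneg (by positivity)
    (Finset.prod_nonneg fun _ _ => Finset.prod_nonneg fun _ _ => h _))
    (Finset.prod_nonneg fun _ _ => Finset.prod_nonneg fun _ _ => h _)

theorem commProb_pos {n : ℕ} {p : ℝ} (hp : 0 < p) (hp1 : p < 1) (c : Comm n) :
    0 < commProb p c := by
  have h : ∀ b : Bool, 0 < (if b then p else 1 - p) := fun b => by
    split_ifs <;> linarith
  unfold commProb
  have : 0 < (Fintype.card (Equiv.Perm (Fin n)) : ℝ) := by exact_mod_cast Fintype.card_pos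
  exact mul_pos (mul_pos (by positivity)
    (Finset.prod_pos fun _ _ => Finset.prod_pos fun _ _ => h _))
    (Finset.prod_pos fun _ _ => Finset.prod_pos fun _ _ => h _)

/-- The probability of a pattern `d` of dropped packets. -/
def dropProb {n : ℕ} (p : ℝ) (d : Fin n → Fin n → Bool) : ℝ :=
  ∏ i, ∏ j, if d i j then p else 1 - p

theorem commProb_eq {n : ℕ} (p : ℝ) (c : Comm n) :
    commProb p c =
      (Fintype.card (Equiv.Perm (Fin n)) : ℝ)⁻¹ * dropProb p c.2.1 * dropProb p c.2.2 := rfl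

theorem sum_dropProb {n : ℕ} (p : ℝ) :
    ∑ d : Fin n → Fin n → Bool, dropProb p d = 1 := by
  have h1 : ∀ i : Fin n,
      ∑ e : Fin n → Bool, ∏ j, (if e j then p else 1 - p) = 1 := fun i => by
    have := Finset.prod_univ_sum (fun _ : Fin n => (Finset.univ : Finset Bool))
      (fun _ b => if b then p else 1 - p)
    rw [Fintype.piFinset_univ] at this
    rw [← this]
    simp
  have := Finset.prod_univ_sum (fun _ : Fin n => (Finset.univ : Finset (Fin n → Bool)))
      (fun _ e => ∏ j, if e j then p else 1 - p)
  rw [Fintype.piFinset_univ] at this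
  refine this.symm.trans ?_
  exact Finset.prod_eq_one fun i _ => h1 i

theorem sum_commProb (n : ℕ) (p : ℝ) : ∑ c : Comm n, commProb p c = 1 := by
  have hk : (Fintype.card (Equiv.Perm (Fin n)) : ℝ) ≠ 0 := by
    exact_mod_cast Fintype.card_pos.ne'
  simp only [commProb_eq, Fintype.sum_prod_type, ← Finset.mul_sum, sum_dropProb, mul_one,
    Finset.sum_const, Finset.card_univ, nsmul_eq_mul]
  exact mul_inv_cancel₀ hk

/-- Relabelling of the workers by `π` and of the blocks by `ρ`. -/
def relabel {n : ℕ} (π ρ : Equiv.Perm (Fin n)) : Comm n ≃ Comm n where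
  toFun c := (ρ.symm.trans (c.1.trans π), fun i j => c.2.1 (π.symm i) (ρ.symm j),
    fun i j => c.2.2 (π.symm i) (ρ.symm j))
  invFun c := (ρ.trans (c.1.trans π.symm), fun i j => c.2.1 (π i) (ρ j),
    fun i j => c.2.2 (π i) (ρ j))
  left_inv c := by
    refine Prod.ext (Equiv.ext fun i => ?_) (Prod.ext ?_ ?_) <;> simp
  right_inv c := by
    refine Prod.ext (Equiv.ext fun i => ?_) (Prod.ext ?_ ?_) <;> simp

theorem commProb_relabel {n : ℕ} (p : ℝ) (π ρ : Equiv.Perm (Fin n)) (c : Comm n) :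
    commProb p (relabel π ρ c) = commProb p c := by
  have h : ∀ d : Fin n → Fin n → Bool,
      dropProb p (fun i j => d (π.symm i) (ρ.symm j)) = dropProb p d := fun d => by
    unfold dropProb
    rw [Equiv.prod_comp π.symm (fun i => ∏ j, if d i (ρ.symm j) then p else 1 - p)]
    exact Finset.prod_congr rfl fun i _ =>
      Equiv.prod_comp ρ.symm (fun j => if d i j then p else 1 - p)
  rw [commProb_eq, commProb_eq, ← h c.2.1, ← h c.2.2]
  rfl

theorem mem_senders {n : ℕ} {c : Comm n} {i j : Fin n} :
    i ∈ senders c j ↔ i = c.1 j ∨ c.2.1 i j = false := by simp [senders]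

theorem mem_receivers {n : ℕ} {c : Comm n} {i j : Fin n} :
    i ∈ receivers c j ↔ i = c.1 j ∨ c.2.2 i j = false := by simp [receivers]

theorem senders_relabel {n : ℕ} (π ρ : Equiv.Perm (Fin n)) (c : Comm n) (j : Fin n) :
    senders (relabel π ρ c) (ρ j) = (senders c j).map π.toEmbedding := by
  ext i
  simp [relabel, mem_senders, Finset.mem_map_equiv, Equiv.symm_apply_eq]

theorem receivers_relabel {n : ℕ} (π ρ : Equiv.Perm (Fin n)) (c : Comm n) (j : Fin n) :
    receivers (relabel π ρ c) (ρ j) = (receivers c j).map π.toEmbedding := by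
  ext i
  simp [relabel, mem_receivers, Finset.mem_map_equiv, Equiv.symm_apply_eq]

theorem weight_relabel {n : ℕ} (π ρ : Equiv.Perm (Fin n)) (c : Comm n) (j : Fin n) :
    (weight (relabel π ρ c) (ρ j)).submatrix π π = weight c j := by
  ext k i
  simp [weight, senders_relabel, receivers_relabel]

/-! ### Row sums, column sums and square sums of the coefficient matrix -/

theorem senders_nonempty {n : ℕ} (c : Comm n) (j : Fin n) : (senders c j).Nonempty :=
  ⟨c.1 j, mem_senders.2 (Or.inl rfl)⟩

theorem card_senders_pos {n : ℕ} (c : Comm n) (j : Fin n) : 0 < ((senders c j).card : ℝ) := by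
  exact_mod_cast (senders_nonempty c j).card_pos

theorem one_le_card_senders {n : ℕ} (c : Comm n) (j : Fin n) :
    1 ≤ ((senders c j).card : ℝ) := by
  exact_mod_cast (senders_nonempty c j).card_pos

theorem sum_weight_col {n : ℕ} (c : Comm n) (j i : Fin n) : ∑ k, weight c j k i = 1 := by
  have := (card_senders_pos c j).ne'
  simp only [weight, of_apply]
  split_ifs with h
  · rw [Finset.sum_ite_mem, Finset.univ_inter]
    simp [this]
  · simp

theorem sum_weight {n : ℕ} (c : Comm n) (j : Fin n) : ∑ k, ∑ i, weight c j k i = n :=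
  Finset.sum_comm.trans (by simp [sum_weight_col])

/-- The first summand is the share of worker k in the average, handed to every receiver; the second
is the copy that worker k keeps if the average does not reach it. Row sums need not be 1, which is
why an exchange can move the average of the models. -/
theorem sum_weight_row {n : ℕ} (c : Comm n) (j k : Fin n) :
    ∑ i, weight c j k i = (if k ∈ senders c j then
      ((receivers c j).card : ℝ) / (senders c j).card else 0) +
        if k ∈ receivers c j then 0 else 1 := by
  have h : ∀ i, weight c j k i = (if i ∈ receivers c j then
      (if k ∈ senders c j then ((senders c j).card : ℝ)⁻¹ else 0) else 0) +
        (if i = k then (if k ∈ receivers c j then 0 else 1) else 0) := fun i => by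
    simp only [weight, of_apply]
    by_cases hik : i = k
    · subst hik
      split_ifs <;> simp
    · have : ¬ k = i := fun h => hik h.symm
      simp [hik, this]
  simp_rw [h, Finset.sum_add_distrib, Finset.sum_ite_mem, Finset.univ_inter]
  simp only [Finset.sum_const, nsmul_eq_mul, Finset.sum_ite_eq', Finset.mem_univ, if_true]
  congr 1
  split_ifs <;> simp [div_eq_mul_inv]

theorem sum_weight_sq {n : ℕ} (c : Comm n) (j : Fin n) :
    ∑ k, ∑ i, weight c j k i ^ 2 =
      ((receivers c j).card : ℝ) / (senders c j).card + (n - (receivers c j).card) := by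
  have hs := (card_senders_pos c j).ne'
  have h : ∀ i, ∑ k, weight c j k i ^ 2 =
      if i ∈ receivers c j then ((senders c j).card : ℝ)⁻¹ else 1 := fun i => by
    simp only [weight, of_apply]
    split_ifs with h
    · simp only [ite_pow, ne_eq, OfNat.ofNat_ne_zero, not_false_eq_true, zero_pow]
      rw [Finset.sum_ite_mem, Finset.univ_inter]
      simp
      field_simp
    · simp
  rw [Finset.sum_comm]
  simp_rw [h]
  rw [Finset.sum_ite, Finset.sum_const, Finset.sum_const, Finset.filter_mem_eq_inter,
    Finset.univ_inter, Finset.filter_not, Finset.filter_mem_eq_inter, Finset.univ_inter,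
    Finset.card_sdiff_of_subset (Finset.subset_univ _), Finset.card_univ, Fintype.card_fin,
    nsmul_eq_mul, nsmul_eq_mul, mul_one, Nat.cast_sub (card_finset_fin_le _), div_eq_mul_inv]

/-- The cross term 2(r/s) of a squared row sum survives exactly at the workers that send but do not
receive. -/
theorem sum_weight_row_sq {n : ℕ} (c : Comm n) (j : Fin n) :
    ∑ k, (∑ i, weight c j k i) ^ 2 =
      ((receivers c j).card : ℝ) ^ 2 / (senders c j).card + (n - (receivers c j).card) +
        2 * (receivers c j).card * ((senders c j \ receivers c j).card / (senders c j).card) := by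
  have hs := (card_senders_pos c j).ne'
  set r : ℝ := ((receivers c j).card : ℝ) with hr
  set s : ℝ := ((senders c j).card : ℝ) with hs'
  have h : ∀ k, (∑ i, weight c j k i) ^ 2 = (if k ∈ senders c j then (r / s) ^ 2 else 0) +
      (1 - if k ∈ receivers c j then 1 else 0) +
      (if k ∈ senders c j \ receivers c j then 2 * (r / s) else 0) := fun k => by
    rw [sum_weight_row]
    by_cases h1 : k ∈ senders c j <;> by_cases h2 : k ∈ receivers c j <;>
      simp [h1, h2]
    rw [← hr, ← hs']
    ring
  simp_rw [h, Finset.sum_add_distrib, Finset.sum_sub_distrib, Finset.sum_ite_mem,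
    Finset.univ_inter]
  simp only [Finset.sum_const, nsmul_eq_mul, Finset.card_univ, Fintype.card_fin, mul_one, ← hr,
    ← hs']
  field_simp

/-- The trace of αI + (1 − α)A_n is α(n − 1) + 1, so α₁ can be estimated outcome by outcome from the
square sum of W. -/
theorem IsMixing.trace_left {n : ℕ} {p α₁ α₂ : ℝ} (h : IsMixing n p α₁ α₂) (j : Fin n) :
    ∑ c : Comm n, commProb p c * ∑ k, ∑ i, weight c j k i ^ 2 = α₁ * (n - 1) + 1 := by
  have hn : (n : ℝ) ≠ 0 := by
    have := j.pos
    positivity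
  have := congrArg Matrix.trace (h j).1
  simp only [Matrix.trace, Matrix.diag, Matrix.sum_apply, Matrix.smul_apply, Matrix.mul_apply,
    Matrix.transpose_apply, smul_eq_mul, Matrix.add_apply, Matrix.one_apply_eq, avgMatrix,
    of_apply, Finset.sum_const, Finset.card_univ, Fintype.card_fin, nsmul_eq_mul] at this
  rw [Finset.sum_comm] at this
  simp_rw [← Finset.mul_sum, ← pow_two] at this
  rw [this]
  field_simp
  ring

theorem mul_avgMatrix_mul_apply {n : ℕ} (M : Matrix (Fin n) (Fin n) ℝ) (k l : Fin n) :
    (M * avgMatrix n * Mᵀ) k l = (n : ℝ)⁻¹ * ((∑ i, M k i) * ∑ i, M l i) := by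
  simp only [Matrix.mul_apply, avgMatrix, of_apply, Matrix.transpose_apply]
  rw [Finset.sum_mul_sum, Finset.sum_comm, Finset.mul_sum]
  simp_rw [Finset.mul_sum, Finset.sum_mul]
  refine Finset.sum_congr rfl fun _ _ => Finset.sum_congr rfl fun _ _ => by ring

/-- The trace of W A_n Wᵀ is 1/n times the sum of the squared row sums, hence the factor n. -/
theorem IsMixing.trace_right {n : ℕ} {p α₁ α₂ : ℝ} (h : IsMixing n p α₁ α₂) (j : Fin n) :
    ∑ c : Comm n, commProb p c * ∑ k, (∑ i, weight c j k i) ^ 2 = n * (α₂ * (n - 1) + 1) := by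
  have hn : (n : ℝ) ≠ 0 := by
    have := j.pos
    positivity
  have := congrArg Matrix.trace (h j).2
  simp only [Matrix.trace, Matrix.diag, Matrix.sum_apply, Matrix.smul_apply,
    mul_avgMatrix_mul_apply, smul_eq_mul, Matrix.add_apply, Matrix.one_apply_eq] at this
  simp only [avgMatrix,
    of_apply, Finset.sum_const, Finset.card_univ, Fintype.card_fin, nsmul_eq_mul] at this
  rw [Finset.sum_comm] at this
  simp_rw [← Finset.mul_sum, ← pow_two, mul_left_comm _ ((n : ℝ)⁻¹), ← Finset.mul_sum] at this
  rw [inv_mul_eq_iff_eq_mul₀ hn] at this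
  rw [this]
  field_simp
  ring

/-! ### Symmetry and the existence of the mixing constants -/

theorem exists_perm_pair {n : ℕ} {a b k l : Fin n} (hab : a ≠ b) (hkl : k ≠ l) :
    ∃ π : Equiv.Perm (Fin n), π a = k ∧ π b = l := by
  -- The inner swap sends a to k; the outer one carries the image of b to l and fixes k, which is
  -- neither of the two.
  refine ⟨Equiv.swap (Equiv.swap a k b) l * Equiv.swap a k, ?_, by simp⟩
  have h : k ≠ Equiv.swap a k b := fun h => hab <| by
    have := congrArg (Equiv.swap a k) h
    simpa using this
  simp [Equiv.swap_apply_of_ne_of_ne h hkl]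

/-- A matrix that is invariant under relabelling and has the entry sum `n` is an affine
combination of the identity and the averaging matrix. -/
theorem exists_eq_of_invariant {n : ℕ} (hn : 2 ≤ n) (M : Matrix (Fin n) (Fin n) ℝ)
    (hM : ∀ π : Equiv.Perm (Fin n), M.submatrix π π = M) (hsum : ∑ k, ∑ l, M k l = n) :
    ∃ α : ℝ, M = α • (1 : Matrix (Fin n) (Fin n) ℝ) + (1 - α) • avgMatrix n := by
  have hn' : (n : ℝ) ≠ 0 := by positivity
  let a : Fin n := ⟨0, by omega⟩
  let b : Fin n := ⟨1, by omega⟩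
  have hab : a ≠ b := by simp [a, b]
  have hoff : ∀ k l, k ≠ l → M k l = M a b := fun k l hkl => by
    obtain ⟨π, rfl, rfl⟩ := exists_perm_pair hab hkl
    exact congrFun (congrFun (hM π) a) b
  have hdiag : ∀ k, M k k = M a a := fun k => by
    have := congrFun (congrFun (hM (Equiv.swap a k)) a) a
    simpa using this
  have hentry : ∀ k l, M k l = M a b + if l = k then M a a - M a b else 0 := fun k l => by
    split_ifs with h
    · rw [h, hdiag]; ring
    · rw [hoff k l (Ne.symm h)]; ring
  have hs : (n : ℝ) * (n * M a b) + n * (M a a - M a b) = n := by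
    refine Eq.trans ?_ hsum
    rw [Finset.sum_congr rfl fun k _ => Finset.sum_congr rfl fun l _ => hentry k l]
    simp [Finset.sum_add_distrib]
  have hs' : n * M a b + (M a a - M a b) = 1 := by
    apply mul_left_cancel₀ hn'
    linarith
  -- Off the diagonal the entry has to be (1 − α)/n, which forces α; the entry sum then settles the
  -- diagonal.
  refine ⟨1 - n * M a b, ?_⟩
  ext k l
  simp only [avgMatrix, Matrix.add_apply, Matrix.smul_apply, of_apply, smul_eq_mul,
    Matrix.one_apply]
  rw [hentry]
  by_cases h : k = l
  · subst h
    simp only [if_true]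
    field_simp
    linarith
  · rw [if_neg (Ne.symm h), if_neg h]
    field_simp
    ring

theorem sum_mul_transpose {n : ℕ} (c : Comm n) (j : Fin n) :
    ∑ k, ∑ l, (weight c j * (weight c j)ᵀ) k l = n := by
  simp only [Matrix.mul_apply, Matrix.transpose_apply]
  have : ∀ k, ∑ l, ∑ i, weight c j k i * weight c j l i = ∑ i, weight c j k i := fun k => by
    rw [Finset.sum_comm]
    simp_rw [← Finset.mul_sum, sum_weight_col, mul_one]
  simp_rw [this]
  exact sum_weight c j

theorem sum_mul_avgMatrix_mul_transpose {n : ℕ} (c : Comm n) (j : Fin n) :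
    ∑ k, ∑ l, (weight c j * avgMatrix n * (weight c j)ᵀ) k l = n := by
  have hn : (n : ℝ) ≠ 0 := by
    have := j.pos
    positivity
  simp_rw [mul_avgMatrix_mul_apply, ← Finset.mul_sum, ← Finset.sum_mul]
  rw [sum_weight]
  field_simp

/-- Relabelling workers makes the expectation permutation invariant, and relabelling blocks makes α
the same for every j. The map Φ stands for both M Mᵀ and M A_n Mᵀ. -/
theorem exists_expectation_eq {n : ℕ} (hn : 2 ≤ n) (p : ℝ)
    (Φ : Matrix (Fin n) (Fin n) ℝ → Matrix (Fin n) (Fin n) ℝ)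
    (hΦ : ∀ (π : Equiv.Perm (Fin n)) M, Φ (M.submatrix π π) = (Φ M).submatrix π π)
    (hsum : ∀ (c : Comm n) j, ∑ k, ∑ l, Φ (weight c j) k l = n) :
    ∃ α : ℝ, ∀ j : Fin n, ∑ c : Comm n, commProb p c • Φ (weight c j) =
      α • (1 : Matrix (Fin n) (Fin n) ℝ) + (1 - α) • avgMatrix n := by
  have hinv : ∀ (π ρ : Equiv.Perm (Fin n)) (j : Fin n),
      (∑ c : Comm n, commProb p c • Φ (weight c (ρ j))).submatrix π π =
        ∑ c : Comm n, commProb p c • Φ (weight c j) := fun π ρ j => by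
    rw [← Equiv.sum_comp (relabel π ρ)]
    ext k l
    simp only [Matrix.submatrix_apply, Matrix.sum_apply, Matrix.smul_apply, commProb_relabel]
    refine Finset.sum_congr rfl fun c _ => ?_
    rw [← weight_relabel π ρ c j, hΦ]
    rfl
  let a : Fin n := ⟨0, by omega⟩
  obtain ⟨α, hα⟩ := exists_eq_of_invariant hn (∑ c : Comm n, commProb p c • Φ (weight c a))
    (fun π => by simpa using hinv π 1 a) (by
      simp only [Matrix.sum_apply, Matrix.smul_apply, smul_eq_mul]
      have : ∀ k, ∑ l, ∑ c : Comm n, commProb p c * Φ (weight c a) k l =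
          ∑ c : Comm n, commProb p c * ∑ l, Φ (weight c a) k l := fun k => by
        rw [Finset.sum_comm]
        simp_rw [Finset.mul_sum]
      simp_rw [this]
      rw [Finset.sum_comm]
      simp_rw [← Finset.mul_sum, hsum, ← Finset.sum_mul, sum_commProb, one_mul])
  refine ⟨α, fun j => ?_⟩
  have := hinv 1 (Equiv.swap a j) a
  rw [← hα, ← this]
  simp

theorem exists_isMixing {n : ℕ} (hn : 2 ≤ n) (p : ℝ) : ∃ α₁ α₂, IsMixing n p α₁ α₂ := by
  obtain ⟨α₁, h₁⟩ := exists_expectation_eq hn p (fun M => M * Mᵀ)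
    (fun π M => by simp [Matrix.transpose_submatrix, Matrix.submatrix_mul_equiv])
    sum_mul_transpose
  obtain ⟨α₂, h₂⟩ := exists_expectation_eq hn p (fun M => M * avgMatrix n * Mᵀ)
    (fun π M => by
      have : avgMatrix n = (avgMatrix n).submatrix π π := rfl
      conv_lhs => rw [this]
      simp [Matrix.transpose_submatrix, Matrix.submatrix_mul_equiv])
    sum_mul_avgMatrix_mul_transpose
  exact ⟨α₁, α₂, fun j => ⟨h₁ j, h₂ j⟩⟩

/-- The expected coefficient matrix preserves the constant vectors. -/
theorem expectation_sum_weight_row {n : ℕ} (p : ℝ) (j k : Fin n) :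
    ∑ c : Comm n, commProb p c * ∑ i, weight c j k i = 1 := by
  have hn : (n : ℝ) ≠ 0 := by
    have := j.pos
    positivity
  -- By symmetry all expected row sums agree; since they add up to n, each of them is 1.
  have hinv : ∀ l, ∑ c : Comm n, commProb p c * ∑ i, weight c j l i =
      ∑ c : Comm n, commProb p c * ∑ i, weight c j k i := fun l => by
    rw [← Equiv.sum_comp (relabel (Equiv.swap k l) 1)]
    refine Finset.sum_congr rfl fun c _ => ?_
    rw [commProb_relabel, ← weight_relabel (Equiv.swap k l) 1 c j]
    simp only [Matrix.submatrix_apply, Equiv.swap_apply_left, Equiv.Perm.coe_one, id]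
    rw [Equiv.sum_comp (Equiv.swap k l) (fun i => weight (relabel (Equiv.swap k l) 1 c) j l i)]
  have hsum : ∑ l, ∑ c : Comm n, commProb p c * ∑ i, weight c j l i = n := by
    rw [Finset.sum_comm]
    simp_rw [← Finset.mul_sum]
    simp_rw [sum_weight, ← Finset.sum_mul, sum_commProb, one_mul]
  simp_rw [hinv] at hsum
  rw [Finset.sum_const, Finset.card_univ, Fintype.card_fin, nsmul_eq_mul] at hsum
  exact mul_left_cancel₀ hn (by linarith)

/-! ### Bounds on the mixing constants -/

theorem card_receivers_le {n : ℕ} (c : Comm n) (j : Fin n) :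
    ((receivers c j).card : ℝ) ≤ n := by
  exact_mod_cast card_finset_fin_le _

theorem one_le_card_receivers {n : ℕ} (c : Comm n) (j : Fin n) :
    1 ≤ ((receivers c j).card : ℝ) := by
  exact_mod_cast Finset.card_pos.2 ⟨c.1 j, mem_receivers.2 (Or.inl rfl)⟩

/-- Cauchy–Schwarz over the n row sums, whose total is n. -/
theorem le_sum_weight_row_sq {n : ℕ} (c : Comm n) (j : Fin n) :
    (n : ℝ) ≤ ∑ k, (∑ i, weight c j k i) ^ 2 := by
  have hn : (0 : ℝ) < n := by exact_mod_cast j.pos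
  have := sq_sum_le_card_mul_sum_sq (s := Finset.univ) (f := fun k => ∑ i, weight c j k i)
  rw [sum_weight, Finset.card_univ, Fintype.card_fin] at this
  nlinarith

theorem sum_weight_row_sq_le_mul {n : ℕ} (c : Comm n) (j : Fin n) :
    ∑ k, (∑ i, weight c j k i) ^ 2 ≤ n * ∑ k, ∑ i, weight c j k i ^ 2 := by
  rw [Finset.mul_sum]
  refine Finset.sum_le_sum fun k _ => ?_
  have := sq_sum_le_card_mul_sum_sq (s := Finset.univ) (f := fun i => weight c j k i)
  rwa [Finset.card_univ, Fintype.card_fin] at this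

theorem sum_weight_sq_le {n : ℕ} (c : Comm n) (j : Fin n) :
    ∑ k, ∑ i, weight c j k i ^ 2 ≤ n := by
  rw [sum_weight_sq]
  have : ((receivers c j).card : ℝ) / (senders c j).card ≤ (receivers c j).card :=
    div_le_self (Nat.cast_nonneg _) (one_le_card_senders c j)
  linarith

/-- The network outcome with the identity assignment in which all packets to the averaging workers
share the fate `a` and all packets from them share the fate `b`. -/
def constOutcome (n : ℕ) (a b : Bool) : Comm n := (1, fun _ _ => a, fun _ _ => b)

theorem senders_constOutcome {n : ℕ} (a b : Bool) (j : Fin n) :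
    senders (constOutcome n a b) j = if a then {j} else Finset.univ := by
  ext i
  cases a <;> simp [mem_senders, constOutcome]

theorem receivers_constOutcome {n : ℕ} (a b : Bool) (j : Fin n) :
    receivers (constOutcome n a b) j = if b then {j} else Finset.univ := by
  ext i
  cases b <;> simp [mem_receivers, constOutcome]

theorem IsMixing.nonneg {n : ℕ} {p α₁ α₂ : ℝ} (h : IsMixing n p α₁ α₂) (hn : 2 ≤ n) (hp : 0 ≤ p)
    (hp1 : p < 1) : 0 ≤ α₂ := by
  have hn' : (2 : ℝ) ≤ n := by exact_mod_cast hn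
  have h2 := h.trace_right ⟨0, by omega⟩
  have : (n : ℝ) ≤ n * (α₂ * (n - 1) + 1) := by
    rw [← h2]
    calc (n : ℝ) = ∑ c : Comm n, commProb p c * n := by
          rw [← Finset.sum_mul, sum_commProb, one_mul]
      _ ≤ _ := Finset.sum_le_sum fun c _ =>
          mul_le_mul_of_nonneg_left (le_sum_weight_row_sq _ _) (commProb_nonneg hp hp1 c)
  have h3 : 0 ≤ n * (α₂ * (n - 1)) := by linarith
  have h4 : 0 ≤ α₂ * (n - 1) := nonneg_of_mul_nonneg_right h3 (by linarith)
  exact nonneg_of_mul_nonneg_left h4 (by linarith)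

theorem IsMixing.pos {n : ℕ} {p α₁ α₂ : ℝ} (h : IsMixing n p α₁ α₂) (hn : 2 ≤ n) (hp : 0 < p)
    (hp1 : p < 1) : 0 < α₂ := by
  have hn' : (2 : ℝ) ≤ n := by exact_mod_cast hn
  have h2 := h.trace_right ⟨0, by omega⟩
  have : (n : ℝ) < n * (α₂ * (n - 1) + 1) := by
    rw [← h2]
    calc (n : ℝ) = ∑ c : Comm n, commProb p c * n := by
          rw [← Finset.sum_mul, sum_commProb, one_mul]
      _ < _ := by
          refine Finset.sum_lt_sum (fun c _ => mul_le_mul_of_nonneg_left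
            (le_sum_weight_row_sq _ _) (commProb_nonneg hp.le hp1 c))
            -- Nothing reaches the averaging worker, yet its block reaches everyone: one row sum is
            -- n and the others vanish, so the squares add up to n² > n.
            ⟨constOutcome n true false, Finset.mem_univ _, ?_⟩
          refine mul_lt_mul_of_pos_left ?_ (commProb_pos hp hp1 _)
          rw [sum_weight_row_sq, senders_constOutcome, receivers_constOutcome]
          simp
          nlinarith
  have h3 : 0 < n * (α₂ * (n - 1)) := by linarith
  have h4 : 0 < α₂ * (n - 1) := pos_of_mul_pos_right h3 (by linarith)
  exact pos_of_mul_pos_left h4 (by linarith)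

theorem IsMixing.trace_sub {n : ℕ} {p α₁ α₂ : ℝ} (h : IsMixing n p α₁ α₂) (j : Fin n) :
    ∑ c : Comm n, commProb p c * (n * ∑ k, ∑ i, weight c j k i ^ 2 -
      ∑ k, (∑ i, weight c j k i) ^ 2) = n * ((α₁ - α₂) * (n - 1)) := by
  simp_rw [mul_sub, Finset.sum_sub_distrib, h.trace_right j, mul_left_comm _ (n : ℝ),
    ← Finset.mul_sum, h.trace_left j]
  ring

theorem IsMixing.le {n : ℕ} {p α₁ α₂ : ℝ} (h : IsMixing n p α₁ α₂) (hn : 2 ≤ n) (hp : 0 ≤ p)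
    (hp1 : p < 1) : α₂ ≤ α₁ := by
  have hn' : (2 : ℝ) ≤ n := by exact_mod_cast hn
  have h3 : 0 ≤ n * ((α₁ - α₂) * (n - 1)) := by
    rw [← h.trace_sub ⟨0, by omega⟩]
    exact Finset.sum_nonneg fun c _ => mul_nonneg (commProb_nonneg hp hp1 c)
      (sub_nonneg.2 (sum_weight_row_sq_le_mul _ _))
  have h4 : 0 ≤ (α₁ - α₂) * (n - 1) := nonneg_of_mul_nonneg_right h3 (by linarith)
  exact sub_nonneg.1 (nonneg_of_mul_nonneg_left h4 (by linarith))

theorem IsMixing.lt {n : ℕ} {p α₁ α₂ : ℝ} (h : IsMixing n p α₁ α₂) (hn : 2 ≤ n) (hp : 0 < p)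
    (hp1 : p < 1) : α₂ < α₁ := by
  have hn' : (2 : ℝ) ≤ n := by exact_mod_cast hn
  have h3 : 0 < n * ((α₁ - α₂) * (n - 1)) := by
    rw [← h.trace_sub ⟨0, by omega⟩]
    refine Finset.sum_pos' (fun c _ => mul_nonneg (commProb_nonneg hp.le hp1 c)
      (sub_nonneg.2 (sum_weight_row_sq_le_mul _ _)))
      -- All packets are lost and W is the identity, for which the row-wise Cauchy–Schwarz
      -- inequality is strict.
      ⟨constOutcome n true true, Finset.mem_univ _, mul_pos (commProb_pos hp hp1 _) ?_⟩
    rw [sum_weight_row_sq, sum_weight_sq, senders_constOutcome, receivers_constOutcome]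
    simp
    nlinarith
  have h4 : 0 < (α₁ - α₂) * (n - 1) := pos_of_mul_pos_right h3 (by linarith)
  exact sub_pos.1 (pos_of_mul_pos_left h4 (by linarith))

theorem IsMixing.lt_one {n : ℕ} {p α₁ α₂ : ℝ} (h : IsMixing n p α₁ α₂) (hn : 2 ≤ n) (hp : 0 ≤ p)
    (hp1 : p < 1) : α₁ < 1 := by
  have hn' : (2 : ℝ) ≤ n := by exact_mod_cast hn
  have h1 := h.trace_left ⟨0, by omega⟩
  have : α₁ * (n - 1) + 1 < n := by
    rw [← h1]
    calc _ < ∑ c : Comm n, commProb p c * n := by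
          refine Finset.sum_lt_sum (fun c _ => mul_le_mul_of_nonneg_left
            (sum_weight_sq_le _ _) (commProb_nonneg hp hp1 c))
            -- Nothing is lost and W = A_n, with square sum 1 < n. This outcome has positive
            -- probability even if p = 0.
            ⟨constOutcome n false false, Finset.mem_univ _, ?_⟩
          refine mul_lt_mul_of_pos_left ?_ ?_
          · rw [sum_weight_sq, senders_constOutcome, receivers_constOutcome]
            simp
            rw [div_self (by positivity)]
            linarith
          · have hk : 0 < (Fintype.card (Equiv.Perm (Fin n)) : ℝ) := by
              exact_mod_cast Fintype.card_pos
            have : 0 < 1 - p := by linarith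
            simp only [commProb_eq, constOutcome, dropProb]
            simp only [Bool.false_eq_true, if_false]
            positivity
      _ = n := by rw [← Finset.sum_mul, sum_commProb, one_mul]
  nlinarith

/-- Without drops every outcome of nonzero probability has W = A_n, of square sum 1, and the trace
identity leaves α₁(n − 1) = 0. -/
theorem IsMixing.eq_zero_of_drop_zero {n : ℕ} {α₁ α₂ : ℝ} (h : IsMixing n 0 α₁ α₂)
    (hn : 2 ≤ n) : α₁ = 0 := by
  have hn' : (2 : ℝ) ≤ n := by exact_mod_cast hn
  have h1 := h.trace_left ⟨0, by omega⟩
  have hd : ∀ d : Fin n → Fin n → Bool, dropProb 0 d ≠ 0 → ∀ i j, d i j = false :=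
    fun d hd i j => by
      by_contra hij
      refine hd (Finset.prod_eq_zero (Finset.mem_univ i)
        (Finset.prod_eq_zero (Finset.mem_univ j) ?_))
      simp [hij]
  have : ∀ c : Comm n, commProb 0 c * ∑ k, ∑ i, weight c ⟨0, by omega⟩ k i ^ 2 =
      commProb 0 c := fun c => by
    by_cases hc : commProb 0 c = 0
    · rw [hc, zero_mul]
    · have hc' := hc
      rw [commProb_eq] at hc'
      have hS := hd c.2.1 fun h => hc' (by rw [h]; ring)
      have hR := hd c.2.2 fun h => hc' (by rw [h]; ring)
      have hS' : senders c ⟨0, by omega⟩ = Finset.univ := by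
        ext i; simp [mem_senders, hS]
      have hR' : receivers c ⟨0, by omega⟩ = Finset.univ := by
        ext i; simp [mem_receivers, hR]
      rw [sum_weight_sq, hS', hR']
      simp
      field_simp
  simp_rw [this, sum_commProb] at h1
  have h3 : α₁ * (n - 1) = 0 := by linarith
  exact (mul_eq_zero.1 h3).resolve_right (by linarith)

/-- α₂ vanishes only at p = 0. This handles the last fraction of the rate when its denominator is 0:
the consensus error it should dominate then vanishes too. -/
theorem IsMixing.left_eq_zero {n : ℕ} {p α₁ α₂ : ℝ} (h : IsMixing n p α₁ α₂) (hn : 2 ≤ n)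
    (hp : 0 ≤ p) (hp1 : p < 1) (h0 : α₂ = 0) : α₁ = 0 := by
  rcases hp.eq_or_lt with rfl | hp
  · exact h.eq_zero_of_drop_zero hn
  · exact absurd h0 (h.pos hn hp hp1).ne'

/-! ### Conditioning on a single packet -/

/-- The pattern of dropped packets with the fate of the packet `(i, j)` reversed. -/
def flip {n : ℕ} (i j : Fin n) (d : Fin n → Fin n → Bool) : Fin n → Fin n → Bool :=
  fun a b => if (a, b) = (i, j) then !d a b else d a b

theorem flip_flip {n : ℕ} (i j : Fin n) (d : Fin n → Fin n → Bool) :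
    flip i j (flip i j d) = d := by
  funext a b
  unfold flip
  split_ifs <;> simp

theorem flip_self {n : ℕ} (i j : Fin n) (d : Fin n → Fin n → Bool) :
    flip i j d i j = !d i j := by simp [flip]

theorem flip_ne {n : ℕ} {i j a b : Fin n} (d : Fin n → Fin n → Bool) (h : (a, b) ≠ (i, j)) :
    flip i j d a b = d a b := by
  unfold flip
  rw [if_neg h]

/-- Only the factor of the packet (i, j) changes, from 1 − p to p; the form without division needs
no condition on p. -/
theorem dropProb_flip {n : ℕ} (p : ℝ) {i j : Fin n} {d : Fin n → Fin n → Bool}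
    (h : d i j = false) : (1 - p) * dropProb p (flip i j d) = p * dropProb p d := by
  have key : ∀ e : Fin n → Fin n → Bool, dropProb p e = (if e i j then p else 1 - p) *
      ∏ x ∈ Finset.univ.erase (i, j), if e x.1 x.2 then p else 1 - p := fun e => by
    unfold dropProb
    rw [← Fintype.prod_prod_type' (fun a b => if e a b then p else 1 - p),
      ← Finset.mul_prod_erase _ _ (Finset.mem_univ (i, j))]
  rw [key, key d, flip_self, h]
  have : ∀ x ∈ Finset.univ.erase (i, j), (if flip i j d x.1 x.2 then p else 1 - p) =
      if d x.1 x.2 then p else 1 - p := fun x hx => by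
    rw [flip_ne d (Finset.ne_of_mem_erase hx)]
  rw [Finset.prod_congr rfl this]
  simp
  ring

/-- If the involution `τ` reverses the fate of one packet and `g` does not depend on it, then the
expectation of `g` on the event that the packet arrives is `1 - p` times the expectation of `g`. -/
theorem expectation_kept {n : ℕ} {p : ℝ} {τ : Comm n → Comm n} (hτ : Function.Involutive τ)
    {K : Comm n → Prop} [DecidablePred K] (hK : ∀ c, K (τ c) ↔ ¬ K c)
    (hP : ∀ c, K c → (1 - p) * commProb p (τ c) = p * commProb p c)
    {g : Comm n → ℝ} (hg : ∀ c, g (τ c) = g c) :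
    ∑ c, commProb p c * (if K c then g c else 0) = (1 - p) * ∑ c, commProb p c * g c := by
  have h1 : ∑ c, commProb p c * g c = ∑ c, commProb p c * (if K c then g c else 0) +
      ∑ c, commProb p c * (if K c then 0 else g c) := by
    rw [← Finset.sum_add_distrib]
    refine Finset.sum_congr rfl fun c _ => ?_
    split_ifs <;> simp
  have h2 : (1 - p) * ∑ c, commProb p c * (if K c then 0 else g c) =
      p * ∑ c, commProb p c * (if K c then g c else 0) := by
    rw [← Equiv.sum_comp hτ.toPerm, Finset.mul_sum, Finset.mul_sum]
    refine Finset.sum_congr rfl fun c _ => ?_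
    simp only [Function.Involutive.coe_toPerm, hK, hg]
    by_cases h : K c
    · simp only [h, not_true, if_false, if_true]
      rw [← mul_assoc, ← mul_assoc, hP c h]
    · simp [h]
  rw [h1, mul_add, h2]
  ring

theorem expectation_receive {n : ℕ} {p : ℝ} (i j : Fin n) {g : Comm n → ℝ}
    (hg : ∀ c, g (c.1, c.2.1, flip i j c.2.2) = g c) :
    ∑ c, commProb p c * (if c.2.2 i j = false then g c else 0) =
      (1 - p) * ∑ c, commProb p c * g c := by
  refine expectation_kept (τ := fun c => (c.1, c.2.1, flip i j c.2.2))
    (fun c => by simp [flip_flip]) (fun c => by simp [flip_self]) (fun c hc => ?_) hg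
  have := dropProb_flip p hc
  simp only [commProb_eq]
  linear_combination
    ((Fintype.card (Equiv.Perm (Fin n)) : ℝ)⁻¹ * dropProb p c.2.1) * this

theorem expectation_send {n : ℕ} {p : ℝ} (j : Fin n) {g : Comm n → ℝ}
    (hg : ∀ c, g (c.1, flip (c.1 j) j c.2.1, c.2.2) = g c) :
    ∑ c, commProb p c * (if c.2.1 (c.1 j) j = false then g c else 0) =
      (1 - p) * ∑ c, commProb p c * g c := by
  refine expectation_kept (τ := fun c => (c.1, flip (c.1 j) j c.2.1, c.2.2))
    (fun c => by simp [flip_flip]) (fun c => by simp [flip_self]) (fun c hc => ?_) hg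
  have := dropProb_flip p hc
  simp only [commProb_eq]
  linear_combination
    ((Fintype.card (Equiv.Perm (Fin n)) : ℝ)⁻¹ * dropProb p c.2.2) * this

theorem expectation_receive_pair {n : ℕ} (p : ℝ) {i k : Fin n} (hik : i ≠ k) (j : Fin n) :
    ∑ c : Comm n, commProb p c *
      (if c.2.2 i j = false then (if c.2.2 k j = false then 1 else 0) else 0) = (1 - p) ^ 2 := by
  rw [expectation_receive i j fun c => ?_, expectation_receive k j fun c => rfl]
  · simp_rw [mul_one, sum_commProb]
    ring
  · have : flip i j c.2.2 k j = c.2.2 k j := flip_ne _ (by simp [hik.symm])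
    simp only [this]

theorem card_mul_pred {n : ℕ} (s : Finset (Fin n)) :
    (s.card : ℝ) * (s.card - 1) =
      ∑ i, ∑ k, if i = k then 0 else if i ∈ s then (if k ∈ s then 1 else 0) else (0 : ℝ) := by
  have : ∀ i k : Fin n, (if i = k then 0 else if i ∈ s then (if k ∈ s then 1 else 0) else (0 : ℝ)) =
      (if i ∈ s then 1 else 0) * (if k ∈ s then 1 else 0) -
        if k = i then (if i ∈ s then 1 else 0) else 0 := fun i k => by
    by_cases h : i = k
    · subst h
      split_ifs <;> simp
    · rw [if_neg h, if_neg (Ne.symm h)]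
      split_ifs <;> simp
  simp_rw [this, Finset.sum_sub_distrib, ← Finset.sum_mul_sum]
  simp
  ring

/-- r(r − 1) counts ordered pairs of distinct receivers, and a given pair is present whenever both
packets arrive, which has probability (1 − p)². Equality fails because the averaging worker needs no
packet. -/
theorem expectation_card_receivers {n : ℕ} {p : ℝ} (hp : 0 ≤ p) (hp1 : p < 1) (j : Fin n) :
    (1 - p) ^ 2 * (n * (n - 1)) ≤
      ∑ c : Comm n, commProb p c * ((receivers c j).card * ((receivers c j).card - 1)) := by
  have h : ∀ i k : Fin n, (if i = k then 0 else (1 - p) ^ 2) ≤ ∑ c : Comm n, commProb p c *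
      (if i = k then 0 else if i ∈ receivers c j then
        (if k ∈ receivers c j then 1 else 0) else 0) := fun i k => by
    by_cases hik : i = k
    · simp [hik]
    · simp only [hik, if_false]
      rw [← expectation_receive_pair p hik j]
      refine Finset.sum_le_sum fun c _ =>
        mul_le_mul_of_nonneg_left ?_ (commProb_nonneg hp hp1 c)
      simp only [mem_receivers]
      by_cases h1 : c.2.2 i j = false <;> by_cases h2 : c.2.2 k j = false <;> simp [h1, h2]
      all_goals split_ifs <;> norm_num
  simp_rw [card_mul_pred, Finset.mul_sum]
  rw [Finset.sum_comm]
  calc (1 - p) ^ 2 * (n * (n - 1)) = ∑ i : Fin n, ∑ k : Fin n, (if i = k then 0 else (1 - p) ^ 2) := by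
        have : ∀ i k : Fin n, (if i = k then 0 else (1 - p) ^ 2) =
          (1 - p) ^ 2 - if i = k then (1 - p) ^ 2 else 0 := fun i k => by split_ifs <;> simp
        simp_rw [this, Finset.sum_sub_distrib]
        simp
        ring
    _ ≤ _ := Finset.sum_le_sum fun i _ => by
        rw [Finset.sum_comm]
        exact Finset.sum_le_sum fun k _ => h i k

/-- With r receivers and s ≥ 1 senders, discarding the cross term and replacing r/s by r bounds the
integrand of `IsMixing.trace_sub` by n(n − 1) − r(r − 1), whose expectation is controlled by the
number of pairs of receivers. -/
theorem IsMixing.sub_le {n : ℕ} {p α₁ α₂ : ℝ} (h : IsMixing n p α₁ α₂) (hn : 2 ≤ n) (hp : 0 ≤ p)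
    (hp1 : p < 1) : α₁ - α₂ ≤ 1 - (1 - p) ^ 2 := by
  have hn' : (2 : ℝ) ≤ n := by exact_mod_cast hn
  have hpt : ∀ (c : Comm n) j, n * ∑ k, ∑ i, weight c j k i ^ 2 -
      ∑ k, (∑ i, weight c j k i) ^ 2 ≤
        n * (n - 1) - (receivers c j).card * ((receivers c j).card - 1) := fun c j => by
    rw [sum_weight_sq, sum_weight_row_sq]
    have hs := one_le_card_senders c j
    have hr := card_receivers_le c j
    have hr1 := one_le_card_receivers c j
    have ht : 0 ≤ 2 * ((receivers c j).card : ℝ) *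
      ((senders c j \ receivers c j).card / (senders c j).card) := by positivity
    set r : ℝ := ((receivers c j).card : ℝ)
    set s : ℝ := ((senders c j).card : ℝ)
    have h1 : r / s * (n - r) ≤ r * (n - r) :=
      mul_le_mul_of_nonneg_right (div_le_self (by linarith) hs) (by linarith)
    have h2 : r ^ 2 / s = r / s * r := by ring
    rw [h2]
    nlinarith
  have j : Fin n := ⟨0, by omega⟩
  have h1 : n * ((α₁ - α₂) * (n - 1)) ≤ n * (n - 1) - (1 - p) ^ 2 * (n * (n - 1)) := by
    rw [← h.trace_sub j]
    calc _ ≤ ∑ c : Comm n, commProb p c *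
          (n * (n - 1) - (receivers c j).card * ((receivers c j).card - 1)) :=
          Finset.sum_le_sum fun c _ =>
            mul_le_mul_of_nonneg_left (hpt c j) (commProb_nonneg hp hp1 c)
      _ ≤ _ := by
          simp_rw [mul_sub (commProb p _) ((n : ℝ) * _), Finset.sum_sub_distrib, ← Finset.sum_mul,
            sum_commProb, one_mul]
          linarith [expectation_card_receivers hp hp1 j]
  have h2 : (α₁ - α₂) * (n * (n - 1)) ≤ (1 - (1 - p) ^ 2) * (n * (n - 1)) := by linarith
  exact le_of_mul_le_mul_right h2 (by nlinarith)

/-- The averaging worker counts as a sender whatever happens to the packet addressed to itself. -/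
theorem senders_flip {n : ℕ} (c : Comm n) (j : Fin n) :
    senders (c.1, flip (c.1 j) j c.2.1, c.2.2) j = senders c j := by
  ext i
  simp only [mem_senders]
  by_cases h : i = c.1 j
  · simp [h]
  · rw [flip_ne]
    simp [h]

/-- The expected inverse number of blocks that are averaged is at most `1 / (n (1 - p))`. -/
theorem expectation_inv_card_senders {n : ℕ} {p : ℝ} (hp : 0 ≤ p) (hp1 : p < 1) (j : Fin n) :
    n * ((1 - p) * ∑ c : Comm n, commProb p c * ((senders c j).card : ℝ)⁻¹) ≤ 1 := by
  have hn : (0 : ℝ) < n := by exact_mod_cast j.pos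
  -- The number of senders ignores the averaging worker's own packet, so the factor 1 − p can be
  -- traded for the event that this packet is kept. On that event the senders are exactly the set K
  -- of workers whose packets are kept.
  rw [← expectation_send j fun c => by rw [senders_flip]]
  let K : (Fin n → Fin n → Bool) → Finset (Fin n) := fun d =>
    Finset.univ.filter fun i => d i j = false
  have hK : ∀ c : Comm n, (if c.2.1 (c.1 j) j = false then ((senders c j).card : ℝ)⁻¹ else 0) =
      if c.1 j ∈ K c.2.1 then ((K c.2.1).card : ℝ)⁻¹ else 0 := fun c => by
    simp only [K, Finset.mem_filter, Finset.mem_univ, true_and]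
    split_ifs with h
    · congr 3
      ext i
      simp only [mem_senders, Finset.mem_filter, Finset.mem_univ, true_and]
      refine ⟨?_, Or.inr⟩
      rintro (rfl | h') <;> assumption
    · rfl
  simp_rw [hK]
  -- The assignment is uniform and independent of the drops, so any ρ may be applied to the
  -- averaging worker. Summing over all cyclic shifts then meets every member of K once, with weight
  -- 1/|K|.
  have hT : ∀ ρ : Equiv.Perm (Fin n), ∑ c : Comm n, commProb p c *
      (if ρ (c.1 j) ∈ K c.2.1 then ((K c.2.1).card : ℝ)⁻¹ else 0) = ∑ c : Comm n, commProb p c *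
        (if c.1 j ∈ K c.2.1 then ((K c.2.1).card : ℝ)⁻¹ else 0) := fun ρ => by
    let e : Comm n ≃ Comm n := (Equiv.mulLeft ρ).prodCongr (Equiv.refl _)
    rw [← Equiv.sum_comp e (fun c => commProb p c *
        (if c.1 j ∈ K c.2.1 then ((K c.2.1).card : ℝ)⁻¹ else 0))]
    rfl
  have : NeZero n := ⟨j.pos.ne'⟩
  calc _ = ∑ a : Fin n, ∑ c : Comm n, commProb p c *
      (if c.1 j + a ∈ K c.2.1 then ((K c.2.1).card : ℝ)⁻¹ else 0) := by
        refine Eq.symm ((Finset.sum_congr rfl fun a _ => hT (Equiv.addRight a)).trans ?_)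
        simp
    _ = ∑ c : Comm n, commProb p c *
        ∑ a : Fin n, (if c.1 j + a ∈ K c.2.1 then ((K c.2.1).card : ℝ)⁻¹ else 0) := by
        rw [Finset.sum_comm]
        simp_rw [Finset.mul_sum]
    _ ≤ ∑ c : Comm n, commProb p c * 1 := Finset.sum_le_sum fun c _ =>
        mul_le_mul_of_nonneg_left (by
          refine (Equiv.sum_comp (Equiv.addLeft (c.1 j))
            (fun a => if a ∈ K c.2.1 then ((K c.2.1).card : ℝ)⁻¹ else 0)).trans_le ?_
          rw [Finset.sum_ite_mem,
            Finset.univ_inter, Finset.sum_const, nsmul_eq_mul]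
          exact mul_inv_le_one) (commProb_nonneg hp hp1 c)
    _ = 1 := by simp_rw [mul_one, sum_commProb]

/-- The squared row sums add up to at most n²/s + 2n, and the expectation of 1/s is at most 1/(n(1 −
p)). This bounds (n − 1)α₂; the factor 2 passes to nα₂. Hence √(nα₂) does not spoil the linear
speedup. -/
theorem IsMixing.mul_right_le {n : ℕ} {p α₁ α₂ : ℝ} (h : IsMixing n p α₁ α₂) (hn : 2 ≤ n)
    (hp : 0 ≤ p) (hp1 : p < 1) : n * α₂ ≤ 2 * ((1 - p)⁻¹ + 1) := by
  have hn' : (2 : ℝ) ≤ n := by exact_mod_cast hn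
  have j : Fin n := ⟨0, by omega⟩
  have hpt : ∀ (c : Comm n), ∑ k, (∑ i, weight c j k i) ^ 2 ≤
      n ^ 2 * ((senders c j).card : ℝ)⁻¹ + 2 * n := fun c => by
    rw [sum_weight_row_sq]
    have hs := one_le_card_senders c j
    have hr := card_receivers_le c j
    have ht : ((senders c j \ receivers c j).card / (senders c j).card : ℝ) ≤ 1 := by
      rw [div_le_one (by linarith)]
      exact_mod_cast Finset.card_le_card Finset.sdiff_subset
    set r : ℝ := ((receivers c j).card : ℝ)
    have hr0 : 0 ≤ r := Nat.cast_nonneg _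
    have h1 : r ^ 2 / (senders c j).card ≤ n ^ 2 * ((senders c j).card : ℝ)⁻¹ := by
      rw [div_eq_mul_inv]
      gcongr
    have h2 := mul_le_mul_of_nonneg_left ht (by linarith : 0 ≤ 2 * r)
    linarith
  have h1 : n * (α₂ * (n - 1) + 1) ≤
      n ^ 2 * ∑ c : Comm n, commProb p c * ((senders c j).card : ℝ)⁻¹ + 2 * n := by
    rw [← h.trace_right j]
    calc _ ≤ ∑ c : Comm n, commProb p c * (n ^ 2 * ((senders c j).card : ℝ)⁻¹ + 2 * n) :=
          Finset.sum_le_sum fun c _ =>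
            mul_le_mul_of_nonneg_left (hpt c) (commProb_nonneg hp hp1 c)
      _ = _ := by
          simp_rw [mul_add, Finset.sum_add_distrib, ← Finset.sum_mul, sum_commProb, one_mul,
            Finset.mul_sum, mul_left_comm]
  have h2 := expectation_inv_card_senders hp hp1 j
  set S := ∑ c : Comm n, commProb p c * ((senders c j).card : ℝ)⁻¹
  have hq : 0 < 1 - p := by linarith
  have h3 : n * S ≤ (1 - p)⁻¹ := by
    rw [← one_div, le_div_iff₀ hq]
    linarith
  have h4 : α₂ * (n - 1) + 1 ≤ n * S + 2 := by
    refine le_of_mul_le_mul_left ?_ (by linarith : (0 : ℝ) < n)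
    linarith
  have h0 := h.nonneg hn hp hp1
  nlinarith

/-! ### The exchange of blocks -/

/-- The exchange of blocks between workers with intermediate models `v`. -/
noncomputable def mix {n m : ℕ} (v : Fin n → Model n m) (c : Comm n) : Fin n → Model n m :=
  fun i => WithLp.toLp 2 fun jk =>
    if i ∈ receivers c jk.1 then
      ((senders c jk.1).card : ℝ)⁻¹ * ∑ k ∈ senders c jk.1, v k jk
    else v i jk

/-- The sum of the squared distances of the local models from their average. -/
noncomputable def spread {n m : ℕ} (x : Fin n → Model n m) : ℝ := ∑ i, ‖x i - average x‖ ^ 2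

theorem mix_apply {n m : ℕ} (v : Fin n → Model n m) (c : Comm n) (i : Fin n)
    (jk : Fin n × Fin m) : mix v c i jk = ∑ k, v k jk * weight c jk.1 k i := by
  simp only [mix, weight, of_apply]
  split_ifs with h
  · simp only [mul_ite, mul_zero]
    rw [Finset.sum_ite_mem, Finset.univ_inter, ← Finset.sum_mul, mul_comm]
  · simp

theorem average_apply {n m : ℕ} (x : Fin n → Model n m) (jk : Fin n × Fin m) :
    average x jk = (n : ℝ)⁻¹ * ∑ i, x i jk := by
  simp [average]

theorem average_mix_apply {n m : ℕ} (v : Fin n → Model n m) (c : Comm n)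
    (jk : Fin n × Fin m) :
    average (mix v c) jk = (n : ℝ)⁻¹ * ∑ k, v k jk * ∑ i, weight c jk.1 k i := by
  simp_rw [average_apply, mix_apply, Finset.mul_sum]
  rw [Finset.sum_comm]

/-- In every coordinate the spread is the quadratic form of I − A_n. A coordinate sees the matrix of
its own block only, so no joint law of the matrices of different blocks is needed. -/
theorem spread_eq {n m : ℕ} (x : Fin n → Model n m) :
    spread x = ∑ jk, (∑ i, x i jk ^ 2 - (n : ℝ)⁻¹ * (∑ i, x i jk) ^ 2) := by
  unfold spread
  simp_rw [EuclideanSpace.real_norm_sq_eq]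
  rw [Finset.sum_comm]
  refine Finset.sum_congr rfl fun jk _ => ?_
  have hn : (n : ℝ) ≠ 0 := by
    have := jk.1.pos
    positivity
  simp_rw [PiLp.sub_apply, average_apply, sub_sq, Finset.sum_add_distrib, Finset.sum_sub_distrib,
    ← Finset.sum_mul, ← Finset.mul_sum]
  simp only [Finset.sum_const, Finset.card_univ, Fintype.card_fin, nsmul_eq_mul]
  field_simp
  ring

theorem spread_nonneg {n m : ℕ} (x : Fin n → Model n m) : 0 ≤ spread x :=
  Finset.sum_nonneg fun _ _ => by positivity

theorem spread_le {n m : ℕ} (x : Fin n → Model n m) : spread x ≤ ∑ i, ‖x i‖ ^ 2 := by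
  rw [spread_eq]
  simp_rw [EuclideanSpace.real_norm_sq_eq]
  rw [Finset.sum_comm (s := (Finset.univ : Finset (Fin n)))]
  exact Finset.sum_le_sum fun jk _ => sub_le_self _ (by positivity)

theorem quadraticForm_eq {n : ℕ} (y : Fin n → ℝ) (α : ℝ) :
    ∑ k, ∑ l, y k * y l *
      (α • (1 : Matrix (Fin n) (Fin n) ℝ) + (1 - α) • avgMatrix n) k l =
      α * ∑ k, y k ^ 2 + (1 - α) * ((n : ℝ)⁻¹ * (∑ k, y k) ^ 2) := by
  simp only [Matrix.add_apply, Matrix.smul_apply, smul_eq_mul, Matrix.one_apply, avgMatrix,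
    of_apply, mul_add, Finset.sum_add_distrib, mul_ite, mul_one, mul_zero, Finset.sum_ite_eq,
    Finset.mem_univ, if_true]
  rw [Finset.mul_sum, pow_two (∑ k, y k), Finset.sum_mul_sum, Finset.mul_sum, Finset.mul_sum]
  congr 1
  · exact Finset.sum_congr rfl fun _ _ => by ring
  · refine Finset.sum_congr rfl fun _ _ => ?_
    rw [Finset.mul_sum, Finset.mul_sum]
    exact Finset.sum_congr rfl fun _ _ => by ring

theorem sum_smul_quadraticForm {n : ℕ} (y : Fin n → ℝ) (p : ℝ)
    (Φ : Comm n → Matrix (Fin n) (Fin n) ℝ) :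
    ∑ k, ∑ l, y k * y l * (∑ c, commProb p c • Φ c) k l =
      ∑ c, commProb p c * ∑ k, ∑ l, y k * y l * Φ c k l := by
  simp only [Matrix.sum_apply, Matrix.smul_apply, smul_eq_mul, Finset.mul_sum]
  conv_rhs => rw [Finset.sum_comm]
  refine Finset.sum_congr rfl fun k _ => ?_
  conv_rhs => rw [Finset.sum_comm]
  refine Finset.sum_congr rfl fun l _ => Finset.sum_congr rfl fun c _ => by ring

theorem IsMixing.expectation_sum_sq {n : ℕ} {p α₁ α₂ : ℝ} (h : IsMixing n p α₁ α₂) (j : Fin n)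
    (y : Fin n → ℝ) :
    ∑ c : Comm n, commProb p c * ∑ i, (∑ k, y k * weight c j k i) ^ 2 =
      α₁ * ∑ k, y k ^ 2 + (1 - α₁) * ((n : ℝ)⁻¹ * (∑ k, y k) ^ 2) := by
  rw [← quadraticForm_eq, ← (h j).1, sum_smul_quadraticForm]
  refine Finset.sum_congr rfl fun c _ => congrArg _ ?_
  simp only [Matrix.mul_apply, Matrix.transpose_apply, pow_two, Finset.sum_mul_sum]
  simp only [Finset.mul_sum]
  rw [Finset.sum_comm]
  refine Finset.sum_congr rfl fun k _ => ?_
  rw [Finset.sum_comm]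
  refine Finset.sum_congr rfl fun l _ => Finset.sum_congr rfl fun i _ => by ring

theorem IsMixing.expectation_sq_sum {n : ℕ} {p α₁ α₂ : ℝ} (h : IsMixing n p α₁ α₂) (j : Fin n)
    (y : Fin n → ℝ) :
    ∑ c : Comm n, commProb p c * ((n : ℝ)⁻¹ * (∑ k, y k * ∑ i, weight c j k i) ^ 2) =
      α₂ * ∑ k, y k ^ 2 + (1 - α₂) * ((n : ℝ)⁻¹ * (∑ k, y k) ^ 2) := by
  rw [← quadraticForm_eq, ← (h j).2, sum_smul_quadraticForm]
  refine Finset.sum_congr rfl fun c _ => congrArg _ ?_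
  simp only [mul_avgMatrix_mul_apply]
  rw [pow_two, Finset.sum_mul_sum, Finset.mul_sum]
  refine Finset.sum_congr rfl fun k _ => ?_
  rw [Finset.mul_sum]
  refine Finset.sum_congr rfl fun l _ => by ring

theorem expectation_average_mix_apply {n m : ℕ} (p : ℝ) (v : Fin n → Model n m)
    (jk : Fin n × Fin m) :
    ∑ c : Comm n, commProb p c * average (mix v c) jk = average v jk := by
  simp_rw [average_mix_apply, average_apply, Finset.mul_sum]
  rw [Finset.sum_comm]
  refine Finset.sum_congr rfl fun k _ => ?_
  have := expectation_sum_weight_row p jk.1 k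
  calc _ = (n : ℝ)⁻¹ * v k jk * ∑ c : Comm n, commProb p c * ∑ i, weight c jk.1 k i := by
        simp_rw [Finset.mul_sum]
        refine Finset.sum_congr rfl fun c _ => Finset.sum_congr rfl fun i _ => by ring
    _ = _ := by rw [this, mul_one]

theorem expectation_inner_average_mix {n m : ℕ} (p : ℝ) (v : Fin n → Model n m)
    (a : Model n m) :
    ∑ c : Comm n, commProb p c * inner ℝ a (average (mix v c)) = inner ℝ a (average v) := by
  simp only [PiLp.inner_apply, Finset.mul_sum]
  rw [Finset.sum_comm]
  refine Finset.sum_congr rfl fun jk _ => ?_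
  rw [← expectation_average_mix_apply p v jk]
  simp only [RCLike.inner_apply, conj_trivial, Finset.sum_mul]
  refine Finset.sum_congr rfl fun c _ => by ring

/-- The identity for E[W A_n Wᵀ] gives the second moment of the new average, and the preserved mean
gives the linear term; the excess is the variance caused by the network. -/
theorem IsMixing.expectation_average_mix {n m : ℕ} {p α₁ α₂ : ℝ} (h : IsMixing n p α₁ α₂)
    (v : Fin n → Model n m) (u : Model n m) :
    ∑ c : Comm n, commProb p c * ‖average (mix v c) - u‖ ^ 2 =
      ‖average v - u‖ ^ 2 + α₂ / n * spread v := by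
  rw [spread_eq]
  simp_rw [EuclideanSpace.real_norm_sq_eq, Finset.mul_sum]
  rw [Finset.sum_comm, ← Finset.sum_add_distrib]
  refine Finset.sum_congr rfl fun jk _ => ?_
  have hn : (n : ℝ) ≠ 0 := by
    have := jk.1.pos
    positivity
  have h2 := h.expectation_sq_sum jk.1 (fun k => v k jk)
  have h1 := expectation_average_mix_apply p v jk
  have h3 : ∀ c : Comm n, commProb p c * (average (mix v c) - u) jk ^ 2 =
      (n : ℝ)⁻¹ * (commProb p c *
        ((n : ℝ)⁻¹ * (∑ k, v k jk * ∑ i, weight c jk.1 k i) ^ 2)) -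
      2 * u jk * (commProb p c * average (mix v c) jk) + u jk ^ 2 * commProb p c := fun c => by
    rw [PiLp.sub_apply, average_mix_apply]
    ring
  simp_rw [h3, Finset.sum_add_distrib, Finset.sum_sub_distrib, ← Finset.mul_sum, h2, h1,
    sum_commProb, PiLp.sub_apply, average_apply]
  field_simp
  ring

/-- Subtracting the two mixing identities gives E[W(I − A_n)Wᵀ] = (α₁ − α₂)(I − A_n). -/
theorem IsMixing.expectation_spread_mix {n m : ℕ} {p α₁ α₂ : ℝ} (h : IsMixing n p α₁ α₂)
    (v : Fin n → Model n m) :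
    ∑ c : Comm n, commProb p c * spread (mix v c) = (α₁ - α₂) * spread v := by
  simp_rw [spread_eq, Finset.mul_sum]
  rw [Finset.sum_comm]
  refine Finset.sum_congr rfl fun jk _ => ?_
  have h1 := h.expectation_sum_sq jk.1 (fun k => v k jk)
  have h2 := h.expectation_sq_sum jk.1 (fun k => v k jk)
  have h3 : ∀ c : Comm n, ∑ i, mix v c i jk = ∑ k, v k jk * ∑ i, weight c jk.1 k i := fun c => by
    simp_rw [mix_apply, Finset.mul_sum]
    rw [Finset.sum_comm]
  simp_rw [h3, mix_apply, mul_sub, Finset.sum_sub_distrib, h1, h2]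
  ring

/-- A crude bound valid for every outcome, which serves for integrability only. -/
theorem norm_mix_sq_le {n m : ℕ} (v : Fin n → Model n m) (c : Comm n) (i : Fin n) :
    ‖mix v c i‖ ^ 2 ≤ ∑ k, ‖v k‖ ^ 2 := by
  simp_rw [EuclideanSpace.real_norm_sq_eq]
  rw [Finset.sum_comm]
  refine Finset.sum_le_sum fun jk _ => ?_
  simp only [mix]
  split_ifs with h
  · set S := senders c jk.1
    have hs : (1 : ℝ) ≤ S.card := one_le_card_senders c jk.1
    have h1 := sq_sum_le_card_mul_sum_sq (s := S) (f := fun k => v k jk)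
    have h2 : ∑ k ∈ S, v k jk ^ 2 ≤ ∑ k, v k jk ^ 2 :=
      Finset.sum_le_sum_of_subset_of_nonneg (Finset.subset_univ _) fun _ _ _ => sq_nonneg _
    have h3 : 0 ≤ ∑ k ∈ S, v k jk ^ 2 := Finset.sum_nonneg fun _ _ => sq_nonneg _
    rw [mul_pow]
    calc ((S.card : ℝ)⁻¹) ^ 2 * (∑ k ∈ S, v k jk) ^ 2 ≤
          ((S.card : ℝ)⁻¹) ^ 2 * (S.card * ∑ k ∈ S, v k jk ^ 2) := by gcongr
      _ = (S.card : ℝ)⁻¹ * ∑ k ∈ S, v k jk ^ 2 := by field_simp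
      _ ≤ 1 * ∑ k ∈ S, v k jk ^ 2 := by
          gcongr
          exact inv_le_one_of_one_le₀ hs
      _ ≤ _ := by rwa [one_mul]
  · exact Finset.single_le_sum (f := fun k => v k jk ^ 2) (fun _ _ => sq_nonneg _)
      (Finset.mem_univ i)

/-! ### Smooth functions -/

theorem hasDerivAt_line {E : Type*} [NormedAddCommGroup E] [InnerProductSpace ℝ E]
    [CompleteSpace E] {f : E → ℝ} (hf : Differentiable ℝ f) (x v : E) (s : ℝ) :
    HasDerivAt (fun s : ℝ => f (x + s • v)) (inner ℝ (gradient f (x + s • v)) v) s := by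
  rw [inner_gradient_left]
  have h1 : HasDerivAt (fun s : ℝ => x + s • v) v s := by
    simpa using ((hasDerivAt_id s).smul_const v).const_add x
  exact (hf (x + s • v)).hasFDerivAt.comp_hasDerivAt s h1

/-- The quadratic upper bound of a function with a Lipschitz gradient. -/
theorem le_of_lipschitz_gradient {E : Type*} [NormedAddCommGroup E] [InnerProductSpace ℝ E]
    [CompleteSpace E] {f : E → ℝ} (hf : Differentiable ℝ f) {L : ℝ}
    (hL : ∀ x y, ‖gradient f x - gradient f y‖ ≤ L * ‖x - y‖) (x y : E) :
    f y ≤ f x + inner ℝ (gradient f x) (y - x) + L / 2 * ‖y - x‖ ^ 2 := by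
  set v := y - x with hv
  -- Up to the constant f x, this is f on the segment minus its quadratic upper bound; the Lipschitz
  -- condition makes its derivative nonpositive on [0, 1].
  let φ : ℝ → ℝ := fun s => f (x + s • v) - s * inner ℝ (gradient f x) v - L / 2 * ‖v‖ ^ 2 * s ^ 2
  have hφ : ∀ s, HasDerivAt φ (inner ℝ (gradient f (x + s • v)) v - inner ℝ (gradient f x) v -
      L * ‖v‖ ^ 2 * s) s := fun s => by
    have h1 := hasDerivAt_line hf x v s
    have h2 := (hasDerivAt_id s).mul_const (inner ℝ (gradient f x) v)
    have h3 := ((hasDerivAt_id s).pow 2).const_mul (L / 2 * ‖v‖ ^ 2)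
    refine ((h1.sub h2).sub h3).congr_deriv ?_
    simp
    ring
  have hle : AntitoneOn φ (Set.Icc 0 1) := by
    refine antitoneOn_of_deriv_nonpos (convex_Icc 0 1)
      (fun s _ => (hφ s).continuousAt.continuousWithinAt)
      (fun s _ => (hφ s).differentiableAt.differentiableWithinAt) fun s hs => ?_
    rw [interior_Icc] at hs
    rw [(hφ s).deriv, ← inner_sub_left]
    have h1 := real_inner_le_norm (gradient f (x + s • v) - gradient f x) v
    have h2 := hL (x + s • v) x
    rw [add_sub_cancel_left, norm_smul, Real.norm_of_nonneg hs.1.le] at h2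
    have h3 := mul_le_mul_of_nonneg_right h2 (norm_nonneg v)
    nlinarith
  have := hle (Set.left_mem_Icc.2 zero_le_one) (Set.right_mem_Icc.2 zero_le_one) zero_le_one
  simp only [φ, one_smul, zero_smul, add_zero, hv, add_sub_cancel] at this
  rw [← hv] at this
  linarith

/-! ### Differentiation under the expectation -/

/-- The square of the increment of a function is at most the length of the interval times the
integral of the square of its derivative. -/
theorem enorm_sub_sq_le {φ φ' : ℝ → ℝ} (hφ : ∀ s, HasDerivAt φ (φ' s) s) (hm : Measurable φ')
    {h : ℝ} (hh : 0 < h) :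
    ‖φ h - φ 0‖ₑ ^ 2 ≤ ENNReal.ofReal h * ∫⁻ s in Set.Ioc 0 h, ‖φ' s‖ₑ ^ 2 := by
  set μ := volume.restrict (Set.Ioc (0 : ℝ) h) with hμ
  have hμu : μ Set.univ = ENNReal.ofReal h := by simp [hμ]
  have : IsFiniteMeasure μ := ⟨by rw [hμu]; exact ENNReal.ofReal_lt_top⟩
  -- An infinite right side is trivial; otherwise φ' is in L², hence integrable, and the fundamental
  -- theorem of calculus applies.
  by_cases hfin : ∫⁻ s, ‖φ' s‖ₑ ^ 2 ∂μ = ⊤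
  · rw [hfin, ENNReal.mul_top (by simpa using hh)]
    exact le_top
  have hsq : eLpNorm φ' 2 μ ^ 2 = ∫⁻ s, ‖φ' s‖ₑ ^ 2 ∂μ := by
    have := eLpNorm_nnreal_pow_eq_lintegral (f := φ') (μ := μ) (p := 2) (by norm_num)
    simpa using this
  have hmem : MemLp φ' 2 μ := by
    refine ⟨hm.aestronglyMeasurable, lt_top_iff_ne_top.2 fun h => hfin ?_⟩
    rw [← hsq, h]
    simp
  have hint : IntervalIntegrable φ' volume 0 h := by
    rw [intervalIntegrable_iff_integrableOn_Ioc_of_le hh.le]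
    exact hmem.integrable (by norm_num)
  have hftc := intervalIntegral.integral_eq_sub_of_hasDerivAt (fun x _ => hφ x) hint
  rw [← hftc, intervalIntegral.integral_of_le hh.le]
  have h1 : ‖∫ s, φ' s ∂μ‖ₑ ≤ eLpNorm φ' 1 μ := by
    rw [eLpNorm_one_eq_lintegral_enorm]
    exact enorm_integral_le_lintegral_enorm _
  have h2 := eLpNorm_le_eLpNorm_mul_rpow_measure_univ (p := 1) (q := 2) (by norm_num)
    (hm.aestronglyMeasurable (μ := μ))
  calc ‖∫ s, φ' s ∂μ‖ₑ ^ 2 ≤ (eLpNorm φ' 2 μ *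
        μ Set.univ ^ (1 / (1 : ENNReal).toReal - 1 / (2 : ENNReal).toReal)) ^ 2 := by
        gcongr
        exact h1.trans h2
    _ = _ := by
        rw [mul_pow, hsq, hμu, mul_comm]
        congr 1
        rw [← ENNReal.rpow_natCast, ← ENNReal.rpow_mul]
        norm_num

/-- A pointwise convergent sequence that is bounded in `L²` converges in mean. -/
theorem tendsto_integral_of_bounded_sq {Ξ : Type*} [MeasurableSpace Ξ] {μ : Measure Ξ}
    [IsProbabilityMeasure μ] {f : ℕ → Ξ → ℝ} {g : Ξ → ℝ} (hf : ∀ k, MemLp (f k) 2 μ)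
    (hg : MemLp g 2 μ) (hlim : ∀ ξ, Filter.Tendsto (fun k => f k ξ) Filter.atTop (nhds (g ξ)))
    {B : ℝ} (hB : ∀ k, ∫ ξ, f k ξ ^ 2 ∂μ ≤ B) :
    Filter.Tendsto (fun k => ∫ ξ, f k ξ ∂μ) Filter.atTop (nhds (∫ ξ, g ξ ∂μ)) := by
  have hD : ∀ k, MemLp (fun ξ => f k ξ - g ξ) 2 μ := fun k => (hf k).sub hg
  have hB0 : 0 ≤ B := (integral_nonneg fun ξ => sq_nonneg _).trans (hB 0)
  set C : ℝ := 2 * B + 2 * ∫ ξ, g ξ ^ 2 ∂μ with hC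
  have hC0 : 0 ≤ C := by
    have : 0 ≤ ∫ ξ, g ξ ^ 2 ∂μ := integral_nonneg fun ξ => sq_nonneg _
    linarith
  have hDC : ∀ k, ∫ ξ, (f k ξ - g ξ) ^ 2 ∂μ ≤ C := fun k => by
    calc _ ≤ ∫ ξ, (2 * f k ξ ^ 2 + 2 * g ξ ^ 2) ∂μ :=
          integral_mono (hD k).integrable_sq
            (((hf k).integrable_sq.const_mul 2).add (hg.integrable_sq.const_mul 2))
            fun ξ => by
              show (f k ξ - g ξ) ^ 2 ≤ 2 * f k ξ ^ 2 + 2 * g ξ ^ 2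
              nlinarith [sq_nonneg (f k ξ + g ξ)]
      _ = 2 * ∫ ξ, f k ξ ^ 2 ∂μ + 2 * ∫ ξ, g ξ ^ 2 ∂μ := by
          rw [integral_add ((hf k).integrable_sq.const_mul 2) (hg.integrable_sq.const_mul 2),
            integral_const_mul, integral_const_mul]
      _ ≤ C := by linarith [hB k]
  rw [Metric.tendsto_atTop]
  intro ε hε
  -- With d the difference, |d| ≤ min(|d|, K) + d²/K. Dominated convergence handles the truncated
  -- part, and this K keeps the tail C/K below ε/2, also if C = 0.
  set K : ℝ := 2 * (C + 1) / ε with hK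
  have hKpos : 0 < K := by positivity
  have hmin : Filter.Tendsto (fun k => ∫ ξ, min |f k ξ - g ξ| K ∂μ) Filter.atTop (nhds 0) := by
    have := tendsto_integral_of_dominated_convergence (μ := μ)
      (F := fun k ξ => min |f k ξ - g ξ| K) (f := fun _ => 0) (fun _ => K)
      (fun k => by
        have := (hD k).1
        exact (continuous_abs.comp_aestronglyMeasurable this).inf aestronglyMeasurable_const)
      (integrable_const K) (fun k => Filter.Eventually.of_forall fun ξ => by
        rw [Real.norm_of_nonneg (le_min (abs_nonneg _) hKpos.le)]
        exact min_le_right _ _)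
      (Filter.Eventually.of_forall fun ξ => by
        have h1 : Filter.Tendsto (fun k => |f k ξ - g ξ|) Filter.atTop (nhds 0) := by
          have := ((hlim ξ).sub_const (g ξ)).abs
          simpa using this
        have := h1.min (tendsto_const_nhds (x := K))
        rwa [min_eq_left hKpos.le] at this)
    simpa using this
  obtain ⟨N, hN⟩ := (Metric.tendsto_atTop.1 hmin) (ε / 2) (half_pos hε)
  refine ⟨N, fun k hk => ?_⟩
  have hf1 := (hf k).integrable (by norm_num : (1 : ENNReal) ≤ 2)
  have hg1 := hg.integrable (by norm_num : (1 : ENNReal) ≤ 2)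
  rw [Real.dist_eq, ← integral_sub hf1 hg1]
  have hk' := hN k hk
  rw [Real.dist_0_eq_abs] at hk'
  have hmi : Integrable (fun ξ => min |f k ξ - g ξ| K) μ := (hf1.sub hg1).abs.inf (integrable_const K)
  calc |∫ ξ, (f k ξ - g ξ) ∂μ| ≤ ∫ ξ, |f k ξ - g ξ| ∂μ := abs_integral_le_integral_abs
    _ ≤ ∫ ξ, (min |f k ξ - g ξ| K + (f k ξ - g ξ) ^ 2 / K) ∂μ := by
        refine integral_mono (hf1.sub hg1).abs (hmi.add ((hD k).integrable_sq.div_const K))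
          fun ξ => ?_
        show |f k ξ - g ξ| ≤ min |f k ξ - g ξ| K + (f k ξ - g ξ) ^ 2 / K
        rcases le_total |f k ξ - g ξ| K with h | h
        · rw [min_eq_left h]
          have : 0 ≤ (f k ξ - g ξ) ^ 2 / K := by positivity
          linarith
        · rw [min_eq_right h, ← sq_abs]
          have : |f k ξ - g ξ| ≤ |f k ξ - g ξ| ^ 2 / K := by
            rw [le_div_iff₀ hKpos]
            nlinarith [abs_nonneg (f k ξ - g ξ)]
          linarith
    _ = ∫ ξ, min |f k ξ - g ξ| K ∂μ + (∫ ξ, (f k ξ - g ξ) ^ 2 ∂μ) / K := by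
        rw [integral_add hmi ((hD k).integrable_sq.div_const K), integral_div]
    _ < ε / 2 + ε / 2 := by
        refine add_lt_add ((le_abs_self _).trans_lt hk') ?_
        rw [div_lt_iff₀ hKpos, hK]
        calc _ ≤ C := hDC k
          _ < C + 1 := by linarith
          _ = _ := by field_simp
    _ = ε := by ring

/-- Differentiation under the integral sign, if the derivative is locally bounded in `L²`. -/
theorem integral_hasDerivAt_eq {Ξ : Type*} [MeasurableSpace Ξ] {μ : Measure Ξ}
    [IsProbabilityMeasure μ] {φ φ' : ℝ → Ξ → ℝ} (hφ : ∀ s ξ, HasDerivAt (fun s => φ s ξ) (φ' s ξ) s)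
    (hm : Measurable (Function.uncurry φ')) (hi : ∀ s, Integrable (φ s) μ) {M : NNReal}
    (hM : ∀ s ∈ Set.Icc (0 : ℝ) 1, ∫⁻ ξ, ‖φ' s ξ‖ₑ ^ 2 ∂μ ≤ M) {d : ℝ}
    (hd : HasDerivAt (fun s => ∫ ξ, φ s ξ ∂μ) d 0) : ∫ ξ, φ' 0 ξ ∂μ = d := by
  -- Increments in (0, 1], so that the bound `hM` holds on the whole interval [0, h k].
  let h : ℕ → ℝ := fun k => 1 / ((k : ℝ) + 1)
  have hpos : ∀ k, 0 < h k := fun k => by positivity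
  have hle : ∀ k, h k ≤ 1 := fun k => by
    simp only [h]
    rw [div_le_one (by positivity)]
    linarith [(Nat.cast_nonneg k : (0 : ℝ) ≤ k)]
  have hlim0 : Filter.Tendsto h Filter.atTop (nhdsWithin 0 {0}ᶜ) := by
    rw [tendsto_nhdsWithin_iff]
    exact ⟨tendsto_one_div_add_atTop_nhds_zero_nat,
      Filter.Eventually.of_forall fun k => (hpos k).ne'⟩
  let Q : ℕ → Ξ → ℝ := fun k ξ => (h k)⁻¹ • (φ (h k) ξ - φ 0 ξ)
  have hQi : ∀ k, Integrable (Q k) μ := fun k => ((hi (h k)).sub (hi 0)).smul (h k)⁻¹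
  have hlint : ∀ {u : Ξ → ℝ}, AEStronglyMeasurable u μ → ∫⁻ ξ, ‖u ξ‖ₑ ^ 2 ∂μ ≤ M →
      MemLp u 2 μ ∧ ∫ ξ, u ξ ^ 2 ∂μ ≤ M := fun {u} hu hle => by
    have hsq : eLpNorm u 2 μ ^ 2 = ∫⁻ s, ‖u s‖ₑ ^ 2 ∂μ := by
      have := eLpNorm_nnreal_pow_eq_lintegral (f := u) (μ := μ) (p := 2) (by norm_num)
      simpa using this
    have hmem : MemLp u 2 μ := by
      refine ⟨hu, lt_top_iff_ne_top.2 fun h => ?_⟩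
      rw [← hsq, h] at hle
      simp at hle
    refine ⟨hmem, ?_⟩
    have : ENNReal.ofReal (∫ ξ, u ξ ^ 2 ∂μ) ≤ M := by
      rw [ofReal_integral_eq_lintegral_ofReal hmem.integrable_sq
        (Filter.Eventually.of_forall fun ξ => sq_nonneg _)]
      refine le_trans (le_of_eq (lintegral_congr fun ξ => ?_)) hle
      rw [← ofReal_norm, ← ENNReal.ofReal_pow (norm_nonneg _), Real.norm_eq_abs, sq_abs]
    rw [← ENNReal.ofReal_coe_nnreal] at this
    exact (ENNReal.ofReal_le_ofReal_iff M.2).1 this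
  -- By Cauchy–Schwarz the squared quotient is at most the mean of the squared derivative over (0, h
  -- k]; Tonelli then brings in `hM`. The L² bound replaces domination.
  have hQ : ∀ k, ∫⁻ ξ, ‖Q k ξ‖ₑ ^ 2 ∂μ ≤ M := fun k => by
    have hk := hpos k
    set δ := h k with hδ
    have hδ0 : ENNReal.ofReal δ ≠ 0 := by simpa using hk
    calc ∫⁻ ξ, ‖Q k ξ‖ₑ ^ 2 ∂μ
        ≤ ∫⁻ ξ, ((ENNReal.ofReal δ)⁻¹ * ∫⁻ s in Set.Ioc 0 δ, ‖φ' s ξ‖ₑ ^ 2) ∂μ := by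
          refine lintegral_mono fun ξ => ?_
          have h1 := enorm_sub_sq_le (fun s => hφ s ξ) (hm.comp measurable_prodMk_right) hk
          simp only [Q]
          rw [smul_eq_mul, enorm_mul, mul_pow, ← hδ, enorm_inv hk.ne', Real.enorm_of_nonneg hk.le]
          calc _ ≤ (ENNReal.ofReal δ)⁻¹ ^ 2 *
                (ENNReal.ofReal δ * ∫⁻ s in Set.Ioc 0 δ, ‖φ' s ξ‖ₑ ^ 2) := by gcongr
            _ = _ := by
                rw [pow_two, mul_assoc, ← mul_assoc _ (ENNReal.ofReal δ),
                  ENNReal.inv_mul_cancel hδ0 ENNReal.ofReal_ne_top, one_mul]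
      _ = (ENNReal.ofReal δ)⁻¹ * ∫⁻ s in Set.Ioc 0 δ, ∫⁻ ξ, ‖φ' s ξ‖ₑ ^ 2 ∂μ := by
          have hms : Measurable fun z : Ξ × ℝ => ‖φ' z.2 z.1‖ₑ ^ 2 :=
            ((hm.comp measurable_swap).enorm.pow_const 2)
          rw [lintegral_const_mul _ hms.lintegral_prod_right', lintegral_lintegral_swap]
          exact hms.aemeasurable
      _ ≤ (ENNReal.ofReal δ)⁻¹ * ∫⁻ s in Set.Ioc 0 δ, (M : ENNReal) := by
          refine mul_le_mul_right ?_ _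
          refine setLIntegral_mono measurable_const fun s hs => hM s ⟨hs.1.le, hs.2.trans (hle k)⟩
      _ = M := by
          rw [setLIntegral_const, Real.volume_Ioc, sub_zero, mul_comm (M : ENNReal), ← mul_assoc,
            ENNReal.inv_mul_cancel hδ0 ENNReal.ofReal_ne_top, one_mul]
  have h1 := tendsto_integral_of_bounded_sq (μ := μ) (f := Q) (g := φ' 0)
    (fun k => (hlint (hQi k).1 (hQ k)).1)
    (hlint (hm.comp measurable_prodMk_left).aestronglyMeasurable
      (hM 0 (Set.left_mem_Icc.2 zero_le_one))).1
    (fun ξ => by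
      have := (hasDerivAt_iff_tendsto_slope_zero.1 (hφ 0 ξ)).comp hlim0
      simpa [Q, Function.comp_def] using this)
    (fun k => (hlint (hQi k).1 (hQ k)).2)
  have h2 := (hasDerivAt_iff_tendsto_slope_zero.1 hd).comp hlim0
  refine tendsto_nhds_unique h1 (h2.congr fun k => ?_)
  simp only [Function.comp_def, zero_add, Q]
  rw [integral_smul, integral_sub (hi _) (hi _)]

/-! ### Stochastic gradients -/

section Problem

variable {n m : ℕ} {Ξ : Fin n → Type*} [∀ i, MeasurableSpace (Ξ i)] {D : ∀ i, Measure (Ξ i)}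
  {F : ∀ i, Model n m → Ξ i → ℝ} {L σ ζ : ℝ}

/-- The deviation of a stochastic gradient from the gradient of the local loss. -/
noncomputable def noise (D : ∀ i, Measure (Ξ i)) (F : ∀ i, Model n m → Ξ i → ℝ) (i : Fin n)
    (x : Model n m) (ξ : Ξ i) : Model n m :=
  stochGrad F i x ξ - gradient (localLoss D F i) x

/-- The coordinates of the gradient are pointwise limits of difference quotients of the jointly
measurable loss. -/
theorem measurable_stochGrad (hA : Assumptions D F L σ ζ) (i : Fin n) :
    Measurable fun z : Model n m × Ξ i => stochGrad F i z.1 z.2 := by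
  have h : ∀ jk, Measurable fun z : Model n m × Ξ i => stochGrad F i z.1 z.2 jk := fun jk => by
    let e : Model n m := EuclideanSpace.single jk 1
    have hlim0 : Filter.Tendsto (fun k : ℕ => 1 / ((k : ℝ) + 1)) Filter.atTop
        (nhdsWithin 0 {0}ᶜ) := by
      rw [tendsto_nhdsWithin_iff]
      exact ⟨tendsto_one_div_add_atTop_nhds_zero_nat,
        Filter.Eventually.of_forall fun k => by
          have : (0 : ℝ) < 1 / ((k : ℝ) + 1) := by positivity
          exact this.ne'⟩
    refine measurable_of_tendsto_metrizable (f := fun (k : ℕ) (z : Model n m × Ξ i) =>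
      (1 / ((k : ℝ) + 1))⁻¹ • (F i (z.1 + (1 / ((k : ℝ) + 1)) • e) z.2 - F i z.1 z.2))
      (fun k => ?_) ?_
    · have h1 : Measurable fun z : Model n m × Ξ i =>
          F i (z.1 + (1 / ((k : ℝ) + 1)) • e) z.2 :=
        (hA.measurable_loss i).comp (f := fun z : Model n m × Ξ i =>
          (z.1 + (1 / ((k : ℝ) + 1)) • e, z.2)) (by fun_prop)
      have h2 : Measurable fun z : Model n m × Ξ i => F i z.1 z.2 := hA.measurable_loss i
      exact (h1.sub h2).const_mul _
    · rw [tendsto_pi_nhds]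
      intro z
      have h1 := hasDerivAt_line (hA.differentiable_loss i z.2) z.1 e 0
      have h2 := (hasDerivAt_iff_tendsto_slope_zero.1 h1).comp hlim0
      simpa [Function.comp_def, e, stochGrad, EuclideanSpace.inner_single_right,
        -inner_gradient_left] using h2
  have : (fun z : Model n m × Ξ i => stochGrad F i z.1 z.2) =
      WithLp.toLp 2 ∘ fun z jk => stochGrad F i z.1 z.2 jk := rfl
  rw [this]
  exact (WithLp.measurable_toLp 2 _).comp (measurable_pi_lambda _ h)

theorem continuous_gradient_localLoss (hA : Assumptions D F L σ ζ) (i : Fin n) :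
    Continuous (gradient (localLoss D F i)) := by
  have : LipschitzWith L.toNNReal (gradient (localLoss D F i)) :=
    LipschitzWith.of_dist_le_mul fun x y => by
      rw [dist_eq_norm, dist_eq_norm]
      refine (hA.lipschitz_gradient i x y).trans ?_
      gcongr
      exact Real.le_coe_toNNReal L
  exact this.continuous

theorem measurable_noise (hA : Assumptions D F L σ ζ) (i : Fin n) :
    Measurable fun z : Model n m × Ξ i => noise D F i z.1 z.2 :=
  (measurable_stochGrad hA i).sub
    ((continuous_gradient_localLoss hA i).measurable.comp measurable_fst)

theorem integral_noise_sq_le (hA : Assumptions D F L σ ζ) (i : Fin n) (x : Model n m) :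
    ∫ ξ, ‖noise D F i x ξ‖ ^ 2 ∂(D i) ≤ σ ^ 2 := hA.variance_le i x

theorem integrable_noise_sq (hA : Assumptions D F L σ ζ) (i : Fin n) (x : Model n m) :
    Integrable (fun ξ => ‖noise D F i x ξ‖ ^ 2) (D i) := hA.integrable_variance i x

theorem memLp_noise (hA : Assumptions D F L σ ζ) (i : Fin n) (x : Model n m) :
    MemLp (noise D F i x) 2 (D i) := by
  refine (memLp_two_iff_integrable_sq_norm (f := noise D F i x)
    ((measurable_noise hA i).comp measurable_prodMk_left).aestronglyMeasurable).2 ?_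
  exact hA.integrable_variance i x

variable [∀ i, IsProbabilityMeasure (D i)]

/-- The stochastic gradients are unbiased. -/
theorem integral_inner_noise (hA : Assumptions D F L σ ζ) (i : Fin n) (x v : Model n m) :
    ∫ ξ, inner ℝ (noise D F i x ξ) v ∂(D i) = 0 := by
  have hnoise : ∀ y, Integrable (noise D F i y) (D i) := fun y =>
    (memLp_noise hA i y).integrable (by norm_num)
  -- Bounds the local gradient between x and x + v, so that the stochastic gradients there have
  -- uniformly bounded second moments, as `integral_hasDerivAt_eq` requires.
  set R : ℝ := ‖gradient (localLoss D F i) x‖ + |L| * ‖v‖ with hR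
  have hgrad : ∀ s ∈ Set.Icc (0 : ℝ) 1, ‖gradient (localLoss D F i) (x + s • v)‖ ≤ R :=
    fun s hs => by
      have h1 := hA.lipschitz_gradient i (x + s • v) x
      rw [add_sub_cancel_left, norm_smul, Real.norm_of_nonneg hs.1] at h1
      have h2 : L * (s * ‖v‖) ≤ |L| * (1 * ‖v‖) := by
        have := hs.1
        have := hs.2
        gcongr
        exact le_abs_self L
      have h3 := norm_le_norm_add_norm_sub' (gradient (localLoss D F i) (x + s • v))
        (gradient (localLoss D F i) x)
      linarith
  have key := integral_hasDerivAt_eq (μ := D i) (φ := fun s ξ => F i (x + s • v) ξ)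
    (φ' := fun s ξ => inner ℝ (stochGrad F i (x + s • v) ξ) v)
    (fun s ξ => hasDerivAt_line (hA.differentiable_loss i ξ) x v s)
    (by
      have : Measurable fun z : ℝ × Ξ i => stochGrad F i (x + z.1 • v) z.2 :=
        (measurable_stochGrad hA i).comp (f := fun z : ℝ × Ξ i => (x + z.1 • v, z.2))
          (by fun_prop)
      exact this.inner_const)
    (fun s => hA.integrable_loss i _)
    (M := (‖v‖ ^ 2 * (2 * σ ^ 2 + 2 * R ^ 2)).toNNReal) (fun s hs => by
      have hi : Integrable (fun ξ => ‖v‖ ^ 2 * (2 * ‖noise D F i (x + s • v) ξ‖ ^ 2 + 2 * R ^ 2))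
          (D i) := (((integrable_noise_sq hA i _).const_mul 2).add
            (integrable_const _)).const_mul _
      calc ∫⁻ ξ, ‖inner ℝ (stochGrad F i (x + s • v) ξ) v‖ₑ ^ 2 ∂(D i)
          ≤ ∫⁻ ξ, ENNReal.ofReal
              (‖v‖ ^ 2 * (2 * ‖noise D F i (x + s • v) ξ‖ ^ 2 + 2 * R ^ 2)) ∂(D i) := by
            refine lintegral_mono fun ξ => ?_
            rw [← ofReal_norm, ← ENNReal.ofReal_pow (norm_nonneg _)]
            refine ENNReal.ofReal_le_ofReal ?_
            have h1 : ‖stochGrad F i (x + s • v) ξ‖ ≤ ‖noise D F i (x + s • v) ξ‖ + R := by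
              have := norm_add_le (noise D F i (x + s • v) ξ)
                (gradient (localLoss D F i) (x + s • v))
              rw [noise, sub_add_cancel] at this
              exact this.trans (by gcongr; exacts [le_rfl, hgrad s hs])
            have h2 := norm_inner_le_norm (𝕜 := ℝ) (stochGrad F i (x + s • v) ξ) v
            calc _ ≤ (‖stochGrad F i (x + s • v) ξ‖ * ‖v‖) ^ 2 := by gcongr
              _ = ‖v‖ ^ 2 * ‖stochGrad F i (x + s • v) ξ‖ ^ 2 := by ring
              _ ≤ ‖v‖ ^ 2 * (‖noise D F i (x + s • v) ξ‖ + R) ^ 2 := by gcongr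
              _ ≤ _ := by
                gcongr
                nlinarith [sq_nonneg (‖noise D F i (x + s • v) ξ‖ - R)]
        _ = ENNReal.ofReal (∫ ξ, ‖v‖ ^ 2 * (2 * ‖noise D F i (x + s • v) ξ‖ ^ 2 + 2 * R ^ 2)
              ∂(D i)) := by
            rw [ofReal_integral_eq_lintegral_ofReal hi
              (Filter.Eventually.of_forall fun ξ => by positivity)]
        _ ≤ _ := by
            rw [← ENNReal.ofReal_coe_nnreal]
            refine ENNReal.ofReal_le_ofReal (le_trans ?_ (Real.le_coe_toNNReal _))
            rw [integral_const_mul, integral_add ((integrable_noise_sq hA i _).const_mul 2)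
              (integrable_const _), integral_const_mul, integral_const]
            simp only [probReal_univ, smul_eq_mul, one_mul]
            gcongr
            exact integral_noise_sq_le hA i _)
    (by
      have := hasDerivAt_line (hA.differentiable_localLoss i) x v 0
      exact this)
  simp only [zero_smul, add_zero] at key
  simp_rw [noise, inner_sub_left]
  have hint : Integrable (fun ξ => inner ℝ (stochGrad F i x ξ) v) (D i) := by
    have h1 := ((hnoise x).add (integrable_const (gradient (localLoss D F i) x))).inner_const
      (𝕜 := ℝ) v
    refine h1.congr (Filter.Eventually.of_forall fun ξ => ?_)
    simp [noise]
  rw [integral_sub hint (integrable_const _), key]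
  simp

/-! ### Independent samples of all workers -/

theorem memLp_noise_eval (hA : Assumptions D F L σ ζ) (i : Fin n) (x : Model n m) :
    MemLp (fun ξ : ∀ i, Ξ i => noise D F i x (ξ i)) 2 (Measure.pi D) :=
  (memLp_noise hA i x).comp_measurePreserving (measurePreserving_eval D i)

theorem integrable_noise_eval_sq (hA : Assumptions D F L σ ζ) (i : Fin n) (x : Model n m) :
    Integrable (fun ξ : ∀ i, Ξ i => ‖noise D F i x (ξ i)‖ ^ 2) (Measure.pi D) :=
  (memLp_noise_eval hA i x).integrable_norm_pow (by norm_num)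

theorem integral_noise_eval_sq_le (hA : Assumptions D F L σ ζ) (i : Fin n) (x : Model n m) :
    ∫ ξ : ∀ i, Ξ i, ‖noise D F i x (ξ i)‖ ^ 2 ∂(Measure.pi D) ≤ σ ^ 2 := by
  have h := (measurePreserving_eval D i).map_eq
  have h2 := integral_map (μ := Measure.pi D) (φ := Function.eval i)
    (measurable_pi_apply i).aemeasurable
    (f := fun ξ => ‖noise D F i x ξ‖ ^ 2) (by
      have := ((measurable_noise hA i).comp (measurable_prodMk_left (x := x))).norm.pow_const 2
      exact this.aestronglyMeasurable)
  rw [h] at h2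
  exact h2.symm.trans_le (integral_noise_sq_le hA i x)

theorem integral_inner_noise_eval (hA : Assumptions D F L σ ζ) (i : Fin n) (x v : Model n m) :
    ∫ ξ : ∀ i, Ξ i, inner ℝ (noise D F i x (ξ i)) v ∂(Measure.pi D) = 0 := by
  have h := (measurePreserving_eval D i).map_eq
  have h2 := integral_map (μ := Measure.pi D) (φ := Function.eval i)
    (measurable_pi_apply i).aemeasurable
    (f := fun ξ => inner ℝ (noise D F i x ξ) v) (by
      have := ((measurable_noise hA i).comp (measurable_prodMk_left (x := x))).inner_const
        (𝕜 := ℝ) (c := v)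
      exact this.aestronglyMeasurable)
  rw [h] at h2
  exact h2.symm.trans (integral_inner_noise hA i x v)

theorem integral_noise_eval_apply (hA : Assumptions D F L σ ζ) (i : Fin n) (x : Model n m)
    (jk : Fin n × Fin m) :
    ∫ ξ : ∀ i, Ξ i, noise D F i x (ξ i) jk ∂(Measure.pi D) = 0 := by
  have := integral_inner_noise_eval hA i x (EuclideanSpace.single jk 1)
  simpa [EuclideanSpace.inner_single_right] using this

/-- In each coordinate the expectation of the product factors by independence, and the factors have
mean zero. -/
theorem integral_inner_noise_noise (hA : Assumptions D F L σ ζ) {i k : Fin n} (hik : i ≠ k)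
    (x y : Model n m) :
    ∫ ξ : ∀ i, Ξ i, inner ℝ (noise D F i x (ξ i)) (noise D F k y (ξ k)) ∂(Measure.pi D) = 0 := by
  have hm : ∀ (i : Fin n) x jk, Measurable fun ξ => noise D F i x ξ jk := fun i x jk => by
    have := (measurable_noise hA i).comp (measurable_prodMk_left (x := x))
    exact (measurable_pi_apply jk).comp ((WithLp.measurable_ofLp 2 _).comp this)
  have hcoord : ∀ (i : Fin n) (x : Model n m) (jk : Fin n × Fin m),
      MemLp (fun ξ : ∀ i, Ξ i => noise D F i x (ξ i) jk) 2 (Measure.pi D) := fun i x jk =>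
    (memLp_noise_eval hA i x).mono
      (((hm i x jk).comp (measurable_pi_apply i)).aestronglyMeasurable)
      (Filter.Eventually.of_forall fun ξ => PiLp.norm_apply_le _ jk)
  simp only [PiLp.inner_apply, RCLike.inner_apply, conj_trivial]
  rw [integral_finsetSum]
  swap
  · exact fun jk _ => (hcoord k y jk).integrable_mul (hcoord i x jk)
  refine Finset.sum_eq_zero fun jk _ => ?_
  -- Independence concerns a family over all workers; only its members i and k are used.
  let X : ∀ l, Ξ l → ℝ := fun l ξ => noise D F l (if l = i then x else y) ξ jk
  have hind := (iIndepFun_pi (μ := D) (X := X) fun l => (hm l _ jk).aemeasurable).indepFun hik.symm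
  have h1 := hind.integral_fun_mul_eq_mul_integral
    ((hm k _ jk).comp (measurable_pi_apply k)).aestronglyMeasurable
    ((hm i _ jk).comp (measurable_pi_apply i)).aestronglyMeasurable
  simp only [X, if_true, hik.symm, if_false] at h1
  rw [h1, integral_noise_eval_apply hA, zero_mul]

end Problem

/-! ### Averages and spreads -/

theorem average_sub_smul {n m : ℕ} (w u : Fin n → Model n m) (γ : ℝ) :
    average (fun i => w i - γ • u i) = average w - γ • average u := by
  simp only [average, Finset.sum_sub_distrib, smul_sub, ← Finset.smul_sum]
  rw [smul_comm]

theorem sum_sub_average {n m : ℕ} (x : Fin n → Model n m) : ∑ i, (x i - average x) = 0 := by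
  rcases Nat.eq_zero_or_pos n with rfl | hn
  · simp
  · have : (n : ℝ) ≠ 0 := by positivity
    rw [Finset.sum_sub_distrib, Finset.sum_const, Finset.card_univ, Fintype.card_fin,
      ← Nat.cast_smul_eq_nsmul ℝ, average, smul_smul, mul_inv_cancel₀ this, one_smul, sub_self]

theorem spread_sub_smul {n m : ℕ} (w u : Fin n → Model n m) (γ : ℝ) :
    spread (fun i => w i - γ • u i) =
      spread w - 2 * γ * ∑ i, inner ℝ (u i) (w i - average w) + γ ^ 2 * spread u := by
  have h : ∀ i, ‖w i - γ • u i - average (fun i => w i - γ • u i)‖ ^ 2 =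
      ‖w i - average w‖ ^ 2 - 2 * γ * inner ℝ (u i) (w i - average w) +
        2 * γ * inner ℝ (average u) (w i - average w) + γ ^ 2 * ‖u i - average u‖ ^ 2 :=
    fun i => by
      have : w i - γ • u i - average (fun i => w i - γ • u i) =
          (w i - average w) - γ • (u i - average u) := by
        rw [average_sub_smul, smul_sub]
        abel
      rw [this, norm_sub_sq_real, norm_smul, mul_pow, Real.norm_eq_abs, sq_abs, inner_smul_right,
        inner_sub_right, real_inner_comm (u i), real_inner_comm (average u)]
      ring
  unfold spread
  simp_rw [h, Finset.sum_add_distrib, Finset.sum_sub_distrib, ← Finset.mul_sum, ← inner_sum,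
    sum_sub_average, inner_zero_right]
  ring

theorem spread_sub_const {n m : ℕ} (x : Fin n → Model n m) (a : Model n m) :
    spread (fun i => x i - a) = spread x := by
  rcases Nat.eq_zero_or_pos n with rfl | hn
  · simp [spread]
  have hn' : (n : ℝ) ≠ 0 := by positivity
  have : average (fun i => x i - a) = average x - a := by
    simp only [average, Finset.sum_sub_distrib, smul_sub, Finset.sum_const, Finset.card_univ,
      Fintype.card_fin]
    rw [← Nat.cast_smul_eq_nsmul ℝ, smul_smul, inv_mul_cancel₀ hn', one_smul]
  simp [spread, this]

theorem norm_average_sq_le {n m : ℕ} (x : Fin n → Model n m) :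
    ‖average x‖ ^ 2 ≤ (n : ℝ)⁻¹ * ∑ i, ‖x i‖ ^ 2 := by
  rcases Nat.eq_zero_or_pos n with rfl | hn
  · simp [average]
  have hn' : (0 : ℝ) < n := by positivity
  have h1 : ‖∑ i, x i‖ ≤ ∑ i, ‖x i‖ := norm_sum_le _ _
  have h2 := sq_sum_le_card_mul_sum_sq (s := Finset.univ) (f := fun i => ‖x i‖)
  rw [Finset.card_univ, Fintype.card_fin] at h2
  rw [average, norm_smul, mul_pow, Real.norm_of_nonneg (by positivity)]
  calc ((n : ℝ)⁻¹) ^ 2 * ‖∑ i, x i‖ ^ 2 ≤ ((n : ℝ)⁻¹) ^ 2 * (∑ i, ‖x i‖) ^ 2 := by gcongr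
    _ ≤ ((n : ℝ)⁻¹) ^ 2 * (n * ∑ i, ‖x i‖ ^ 2) := by gcongr
    _ = _ := by field_simp

/-- The triangle inequality of the ℓ² direct sum. It makes the square root of the spread behave like
a seminorm. -/
theorem sqrt_sum_sq_add_le {ι E : Type*} [Fintype ι] [NormedAddCommGroup E]
    (u w : ι → E) :
    √(∑ i, ‖u i + w i‖ ^ 2) ≤ √(∑ i, ‖u i‖ ^ 2) + √(∑ i, ‖w i‖ ^ 2) := by
  have := norm_add_le (WithLp.toLp 2 u : PiLp 2 fun _ : ι => E) (WithLp.toLp 2 w)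
  simpa [PiLp.norm_eq_of_L2] using this

/-- The local stochastic gradient steps. -/
noncomputable def localStep {n m : ℕ} {Ξ : Fin n → Type*} (F : ∀ i, Model n m → Ξ i → ℝ) (γ : ℝ) (x : Fin n → Model n m)
    (ξ : ∀ i, Ξ i) : Fin n → Model n m :=
  fun i => x i - γ • stochGrad F i (x i) (ξ i)

theorem step_eq_mix {n m : ℕ} {Ξ : Fin n → Type*} (F : ∀ i, Model n m → Ξ i → ℝ) (γ : ℝ) (x : Fin n → Model n m) (o : (∀ i, Ξ i) × Comm n) :
    step F γ x o = mix (localStep F γ x o.1) o.2 := rfl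

section Problem

variable {n m : ℕ} {Ξ : Fin n → Type*} [∀ i, MeasurableSpace (Ξ i)] {D : ∀ i, Measure (Ξ i)}
  {F : ∀ i, Model n m → Ξ i → ℝ} {L σ ζ : ℝ}

/-- The gradients of the local losses at the local models. -/
noncomputable def localGrads (D : ∀ i, Measure (Ξ i)) (F : ∀ i, Model n m → Ξ i → ℝ)
    (x : Fin n → Model n m) : Fin n → Model n m :=
  fun i => gradient (localLoss D F i) (x i)

/-- The local gradient steps with the exact gradients. -/
noncomputable def exactStep (D : ∀ i, Measure (Ξ i)) (F : ∀ i, Model n m → Ξ i → ℝ) (γ : ℝ)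
    (x : Fin n → Model n m) : Fin n → Model n m :=
  fun i => x i - γ • localGrads D F x i

theorem localStep_eq (D : ∀ i, Measure (Ξ i)) (γ : ℝ) (x : Fin n → Model n m) (ξ : ∀ i, Ξ i) :
    localStep F γ x ξ =
      fun i => exactStep D F γ x i - γ • noise D F i (x i) (ξ i) := by
  funext i
  simp only [localStep, exactStep, localGrads, noise, smul_sub]
  abel

theorem average_localStep_sub (γ : ℝ) (x : Fin n → Model n m) (ξ : ∀ i, Ξ i) :
    average (localStep F γ x ξ) - average x =
      -(γ • (average (localGrads D F x) + average fun i => noise D F i (x i) (ξ i))) := by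
  rw [localStep_eq D, average_sub_smul]
  unfold exactStep
  rw [average_sub_smul, smul_add]
  abel

/-! ### The global gradient, and the spread after an exact gradient step -/

theorem hasGradientAt_globalLoss (hA : Assumptions D F L σ ζ) (x : Model n m) :
    HasGradientAt (globalLoss D F) (average fun i => gradient (localLoss D F i) x) x := by
  rw [hasGradientAt_iff_hasFDerivAt]
  have h : ∀ i, HasFDerivAt (localLoss D F i)
      (InnerProductSpace.toDual ℝ (Model n m) (gradient (localLoss D F i) x)) x := fun i =>
    hasGradientAt_iff_hasFDerivAt.1 (hA.differentiable_localLoss i x).hasGradientAt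
  have h2 := (HasFDerivAt.fun_sum fun i (_ : i ∈ Finset.univ) => h i).const_mul ((n : ℝ)⁻¹)
  rw [average, map_smul, map_sum]
  exact h2

theorem gradient_globalLoss (hA : Assumptions D F L σ ζ) (x : Model n m) :
    gradient (globalLoss D F) x = average fun i => gradient (localLoss D F i) x :=
  (hasGradientAt_globalLoss hA x).gradient

theorem differentiable_globalLoss (hA : Assumptions D F L σ ζ) :
    Differentiable ℝ (globalLoss D F) := fun x =>
  (hasGradientAt_globalLoss hA x).differentiableAt

theorem sum_norm_localGrads_sub_sq_le (hA : Assumptions D F L σ ζ)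
    (x : Fin n → Model n m) (a : Model n m) :
    ∑ i, ‖localGrads D F x i - gradient (localLoss D F i) a‖ ^ 2 ≤
      L ^ 2 * ∑ i, ‖x i - a‖ ^ 2 := by
  rw [Finset.mul_sum]
  refine Finset.sum_le_sum fun i _ => ?_
  rw [← mul_pow]
  exact pow_le_pow_left₀ (norm_nonneg _) (hA.lipschitz_gradient i (x i) a) 2

theorem norm_average_localGrads_sub_sq_le (hA : Assumptions D F L σ ζ)
    (x : Fin n → Model n m) (a : Model n m) :
    ‖gradient (globalLoss D F) a - average (localGrads D F x)‖ ^ 2 ≤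
      L ^ 2 / n * ∑ i, ‖x i - a‖ ^ 2 := by
  have : average (localGrads D F x) - gradient (globalLoss D F) a =
      average fun i => localGrads D F x i - gradient (localLoss D F i) a := by
    have := average_sub_smul (localGrads D F x) (fun i => gradient (localLoss D F i) a) 1
    simp only [one_smul] at this
    rw [this, gradient_globalLoss hA]
  rw [norm_sub_rev, this]
  refine (norm_average_sq_le _).trans ?_
  have := sum_norm_localGrads_sub_sq_le hA x a
  calc _ ≤ (n : ℝ)⁻¹ * (L ^ 2 * ∑ i, ‖x i - a‖ ^ 2) := by gcongr
    _ = _ := by ring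

theorem lipschitz_globalLoss (hA : Assumptions D F L σ ζ) (hn : 0 < n) (x y : Model n m) :
    ‖gradient (globalLoss D F) x - gradient (globalLoss D F) y‖ ≤ L * ‖x - y‖ := by
  have hn' : (n : ℝ) ≠ 0 := by positivity
  have h0 : 0 ≤ L * ‖x - y‖ :=
    (norm_nonneg _).trans (hA.lipschitz_gradient ⟨0, hn⟩ x y)
  have h := norm_average_localGrads_sub_sq_le hA (fun _ => x) y
  have h2 : average (localGrads D F fun _ => x) = gradient (globalLoss D F) x :=
    (gradient_globalLoss hA x).symm
  rw [h2, norm_sub_rev, Finset.sum_const, Finset.card_univ, Fintype.card_fin, nsmul_eq_mul] at h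
  refine abs_le_of_sq_le_sq' ?_ h0 |>.2
  calc _ ≤ _ := h
    _ = _ := by field_simp

/-- The spread ignores a common shift and is at most the sum of squares. Measured from the global
gradient at the average, each local gradient splits into a Lipschitz part and a dissimilarity part.
-/
theorem sqrt_spread_localGrads_le (hA : Assumptions D F L σ ζ) (hL : 0 ≤ L) (hζ : 0 ≤ ζ)
    (hn : 0 < n) (x : Fin n → Model n m) :
    √(spread (localGrads D F x)) ≤ L * √(spread x) + √n * ζ := by
  have hn' : (0 : ℝ) < n := by positivity
  set a := average x
  set c := gradient (globalLoss D F) a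
  have h1 : spread (localGrads D F x) ≤ ∑ i, ‖(localGrads D F x i -
      gradient (localLoss D F i) a) + (gradient (localLoss D F i) a - c)‖ ^ 2 := by
    rw [← spread_sub_const (localGrads D F x) c]
    refine (spread_le _).trans (le_of_eq ?_)
    simp
  refine (Real.sqrt_le_sqrt h1).trans ((sqrt_sum_sq_add_le _ _).trans (add_le_add ?_ ?_))
  · refine (Real.sqrt_le_sqrt (sum_norm_localGrads_sub_sq_le hA x a)).trans ?_
    rw [Real.sqrt_mul (sq_nonneg L), Real.sqrt_sq hL]
    exact le_rfl
  · have h2 := hA.dissimilarity_le a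
    rw [inv_mul_le_iff₀ hn'] at h2
    refine (Real.sqrt_le_sqrt h2).trans ?_
    rw [Real.sqrt_mul hn'.le, Real.sqrt_sq hζ]

theorem sqrt_spread_exactStep_le (hA : Assumptions D F L σ ζ) (hL : 0 ≤ L) (hζ : 0 ≤ ζ)
    (hn : 0 < n) {γ : ℝ} (hγ : 0 ≤ γ) (x : Fin n → Model n m) :
    √(spread (exactStep D F γ x)) ≤ (1 + γ * L) * √(spread x) + γ * (√n * ζ) := by
  have h1 : spread (exactStep D F γ x) = ∑ i, ‖(x i - average x) +
      (-γ) • (localGrads D F x i - average (localGrads D F x))‖ ^ 2 := by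
    unfold exactStep spread
    rw [average_sub_smul]
    refine Finset.sum_congr rfl fun i _ => ?_
    congr 2
    module
  rw [h1]
  refine (sqrt_sum_sq_add_le _ _).trans ?_
  have h2 : √(∑ i, ‖(-γ) • (localGrads D F x i - average (localGrads D F x))‖ ^ 2) =
      γ * √(spread (localGrads D F x)) := by
    simp_rw [norm_smul, mul_pow, ← Finset.mul_sum, norm_neg, Real.norm_of_nonneg hγ]
    rw [Real.sqrt_mul (sq_nonneg _), Real.sqrt_sq hγ]
    rfl
  rw [h2]
  have h3 := mul_le_mul_of_nonneg_left (sqrt_spread_localGrads_le hA hL hζ hn x) hγ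
  change √(spread x) + _ ≤ _
  linarith

variable [∀ i, IsProbabilityMeasure (D i)]

/-! ### Moments of one local stochastic step -/

theorem memLp_localStep (hA : Assumptions D F L σ ζ) (γ : ℝ) (x : Fin n → Model n m) (i : Fin n) :
    MemLp (fun ξ => localStep F γ x ξ i) 2 (Measure.pi D) := by
  simp_rw [localStep_eq D]
  exact (memLp_const _).sub ((memLp_noise_eval hA i (x i)).const_smul γ)

theorem memLp_average_localStep (hA : Assumptions D F L σ ζ) (γ : ℝ) (x : Fin n → Model n m) :
    MemLp (fun ξ => average (localStep F γ x ξ)) 2 (Measure.pi D) := by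
  unfold average
  exact (memLp_finsetSum _ fun i _ => memLp_localStep hA γ x i).const_smul ((n : ℝ)⁻¹)

theorem integrable_spread_localStep (hA : Assumptions D F L σ ζ) (γ : ℝ)
    (x : Fin n → Model n m) :
    Integrable (fun ξ => spread (localStep F γ x ξ)) (Measure.pi D) := by
  unfold spread
  exact integrable_finsetSum _ fun i _ =>
    ((memLp_localStep hA γ x i).sub (memLp_average_localStep hA γ x)).integrable_norm_pow
      (by norm_num)

theorem integrable_inner_noise_eval (hA : Assumptions D F L σ ζ) (i : Fin n) (x v : Model n m) :
    Integrable (fun ξ : ∀ i, Ξ i => inner ℝ (noise D F i x (ξ i)) v) (Measure.pi D) :=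
  ((memLp_noise_eval hA i x).integrable (by norm_num)).inner_const v

/-- The term linear in the noise has mean zero, and the spread of the noise is at most the sum of
its squares. -/
theorem integral_spread_localStep_le (hA : Assumptions D F L σ ζ) (γ : ℝ)
    (x : Fin n → Model n m) :
    ∫ ξ, spread (localStep F γ x ξ) ∂(Measure.pi D) ≤
      spread (exactStep D F γ x) + γ ^ 2 * (n * σ ^ 2) := by
  set w := exactStep D F γ x
  have hi : Integrable (fun ξ : ∀ i, Ξ i =>
      ∑ i, inner ℝ (noise D F i (x i) (ξ i)) (w i - average w)) (Measure.pi D) :=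
    integrable_finsetSum _ fun i _ => integrable_inner_noise_eval hA i _ _
  have hs : Integrable (fun ξ : ∀ i, Ξ i => ∑ i, ‖noise D F i (x i) (ξ i)‖ ^ 2)
      (Measure.pi D) := integrable_finsetSum _ fun i _ => integrable_noise_eval_sq hA i _
  calc _ ≤ ∫ ξ : ∀ i, Ξ i, (spread w - 2 * γ *
          ∑ i, inner ℝ (noise D F i (x i) (ξ i)) (w i - average w) +
            γ ^ 2 * ∑ i, ‖noise D F i (x i) (ξ i)‖ ^ 2) ∂(Measure.pi D) := by
        refine integral_mono (integrable_spread_localStep hA γ x)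
          (((integrable_const _).sub (hi.const_mul _)).add (hs.const_mul _)) fun ξ => ?_
        simp only [localStep_eq D]
        rw [spread_sub_smul]
        have := spread_le fun i => noise D F i (x i) (ξ i)
        gcongr
    _ = spread w + γ ^ 2 * ∑ i, ∫ ξ : ∀ i, Ξ i, ‖noise D F i (x i) (ξ i)‖ ^ 2
          ∂(Measure.pi D) := by
        have hi' : Integrable (fun ξ : ∀ i, Ξ i => spread w - 2 * γ *
            ∑ i, inner ℝ (noise D F i (x i) (ξ i)) (w i - average w)) (Measure.pi D) :=
          (integrable_const _).sub (hi.const_mul _)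
        rw [integral_add hi' (hs.const_mul _),
          integral_sub (integrable_const _) (hi.const_mul _), integral_const_mul,
          integral_const_mul, integral_finsetSum _ fun i _ => integrable_inner_noise_eval hA i _ _,
          integral_finsetSum _ fun i _ => integrable_noise_eval_sq hA i _]
        simp [integral_inner_noise_eval hA]
    _ ≤ spread w + γ ^ 2 * ∑ i : Fin n, σ ^ 2 := by
        gcongr with i
        exact integral_noise_eval_sq_le hA i _
    _ = _ := by simp

theorem integral_inner_average_localStep (hA : Assumptions D F L σ ζ) (γ : ℝ)
    (x : Fin n → Model n m) (a : Model n m) :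
    ∫ ξ, inner ℝ a (average (localStep F γ x ξ)) ∂(Measure.pi D) =
      inner ℝ a (average x) - γ * inner ℝ a (average (localGrads D F x)) := by
  have h : ∀ ξ : ∀ i, Ξ i, inner ℝ a (average (localStep F γ x ξ)) =
      (inner ℝ a (average x) - γ * inner ℝ a (average (localGrads D F x))) -
        γ * ((n : ℝ)⁻¹ * ∑ i, inner ℝ (noise D F i (x i) (ξ i)) a) := fun ξ => by
    rw [← sub_add_cancel (average (localStep F γ x ξ)) (average x),
      average_localStep_sub (D := D), inner_add_right, inner_neg_right, inner_smul_right,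
      inner_add_right]
    conv_lhs => rw [average.eq_1 fun i => noise D F i (x i) (ξ i)]
    rw [inner_smul_right, inner_sum]
    simp_rw [real_inner_comm a]
    ring
  simp_rw [h]
  rw [integral_sub (integrable_const _) (((integrable_finsetSum _ fun i _ =>
    integrable_inner_noise_eval hA i _ _).const_mul _).const_mul _), integral_const_mul,
    integral_const_mul, integral_finsetSum _ fun i _ => integrable_inner_noise_eval hA i _ _]
  simp [integral_inner_noise_eval hA]

/-- Independence kills the inner products of different workers, leaving σ²/n instead of σ²; this is
the source of the linear speedup. -/
theorem integral_norm_average_noise_sq_le (hA : Assumptions D F L σ ζ) (x : Fin n → Model n m) :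
    ∫ ξ : ∀ i, Ξ i, ‖average fun i => noise D F i (x i) (ξ i)‖ ^ 2 ∂(Measure.pi D) ≤
      σ ^ 2 / n := by
  rcases Nat.eq_zero_or_pos n with rfl | hn
  · simp [average]
  have hn' : (n : ℝ) ≠ 0 := by positivity
  have h : ∀ ξ : ∀ i, Ξ i, ‖average fun i => noise D F i (x i) (ξ i)‖ ^ 2 =
      ((n : ℝ)⁻¹) ^ 2 * ∑ i, ∑ k, inner ℝ (noise D F i (x i) (ξ i)) (noise D F k (x k) (ξ k)) :=
    fun ξ => by
      rw [average, norm_smul, mul_pow, norm_inv, ← real_inner_self_eq_norm_sq, sum_inner]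
      simp_rw [inner_sum]
      simp
  have hi : ∀ i k, Integrable (fun ξ : ∀ i, Ξ i =>
      inner ℝ (noise D F i (x i) (ξ i)) (noise D F k (x k) (ξ k))) (Measure.pi D) :=
    fun i k => ((memLp_noise_eval hA i (x i)).norm.integrable_mul
      (memLp_noise_eval hA k (x k)).norm).mono'
        ((memLp_noise_eval hA i (x i)).1.inner (memLp_noise_eval hA k (x k)).1)
        (Filter.Eventually.of_forall fun ξ => norm_inner_le_norm _ _)
  simp_rw [h]
  rw [integral_const_mul, integral_finsetSum _ fun i _ => integrable_finsetSum _ fun k _ => hi i k]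
  simp_rw [integral_finsetSum _ fun k _ => hi _ k]
  have hd : ∀ i, ∑ k, ∫ ξ : ∀ i, Ξ i,
      inner ℝ (noise D F i (x i) (ξ i)) (noise D F k (x k) (ξ k)) ∂(Measure.pi D) ≤ σ ^ 2 :=
    fun i => by
      rw [Finset.sum_eq_single i (fun k _ hk => integral_inner_noise_noise hA hk.symm _ _)
        (by simp)]
      simp_rw [real_inner_self_eq_norm_sq]
      exact integral_noise_eval_sq_le hA i _
  calc _ ≤ ((n : ℝ)⁻¹) ^ 2 * ∑ i : Fin n, σ ^ 2 := by
        gcongr with i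
        exact hd i
    _ = _ := by
        simp
        field_simp

theorem integral_norm_average_localStep_sub_sq_le (hA : Assumptions D F L σ ζ) (γ : ℝ)
    (x : Fin n → Model n m) :
    ∫ ξ, ‖average (localStep F γ x ξ) - average x‖ ^ 2 ∂(Measure.pi D) ≤
      γ ^ 2 * (‖average (localGrads D F x)‖ ^ 2 + σ ^ 2 / n) := by
  set g := average (localGrads D F x)
  have hN : MemLp (fun ξ : ∀ i, Ξ i => average fun i => noise D F i (x i) (ξ i)) 2
      (Measure.pi D) := by
    unfold average
    exact (memLp_finsetSum _ fun i _ => memLp_noise_eval hA i (x i)).const_smul ((n : ℝ)⁻¹)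
  have h : ∀ ξ : ∀ i, Ξ i, ‖average (localStep F γ x ξ) - average x‖ ^ 2 =
      γ ^ 2 * (‖g‖ ^ 2 + 2 * ((n : ℝ)⁻¹ * ∑ i, inner ℝ (noise D F i (x i) (ξ i)) g) +
        ‖average fun i => noise D F i (x i) (ξ i)‖ ^ 2) := fun ξ => by
    rw [average_localStep_sub (D := D), norm_neg, norm_smul, mul_pow, norm_add_sq_real,
      Real.norm_eq_abs, sq_abs]
    congr 4
    conv_lhs => rw [average.eq_1 fun i => noise D F i (x i) (ξ i)]
    rw [inner_smul_right, inner_sum]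
    simp_rw [real_inner_comm _ (average _)]
    rfl
  have hi := ((integrable_finsetSum Finset.univ fun i _ =>
    integrable_inner_noise_eval hA i (x i) g).const_mul ((n : ℝ)⁻¹)).const_mul 2
  have hi' : Integrable (fun ξ : ∀ i, Ξ i => ‖g‖ ^ 2 +
      2 * ((n : ℝ)⁻¹ * ∑ i, inner ℝ (noise D F i (x i) (ξ i)) g)) (Measure.pi D) :=
    (integrable_const _).add hi
  simp_rw [h]
  rw [integral_const_mul, integral_add hi'
    (hN.integrable_norm_pow (by norm_num)), integral_add (integrable_const _) hi,
    integral_const_mul, integral_const_mul,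
    integral_finsetSum _ fun i _ => integrable_inner_noise_eval hA i _ _]
  simp only [integral_const, integral_inner_noise_eval hA]
  simp only [probReal_univ, smul_eq_mul, one_mul, Finset.sum_const_zero, mul_zero, add_zero]
  have := integral_norm_average_noise_sq_le hA x
  gcongr

end Problem

/-! ### The law of one iteration -/

theorem commLaw_univ (n : ℕ) {p : ℝ} (hp : 0 ≤ p) (hp1 : p < 1) :
    commLaw n p Set.univ = 1 := by
  simp only [commLaw, Measure.coe_finsetSum, Finset.sum_apply, Measure.smul_apply, measure_univ,
    smul_eq_mul, mul_one]
  rw [← ENNReal.ofReal_sum_of_nonneg fun c _ => commProb_nonneg hp hp1 c, sum_commProb,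
    ENNReal.ofReal_one]

theorem isProbabilityMeasure_commLaw (n : ℕ) {p : ℝ} (hp : 0 ≤ p) (hp1 : p < 1) :
    IsProbabilityMeasure (commLaw n p) := ⟨commLaw_univ n hp hp1⟩

theorem integral_commLaw {n : ℕ} {p : ℝ} (hp : 0 ≤ p) (hp1 : p < 1) (φ : Comm n → ℝ) :
    ∫ c, φ c ∂(commLaw n p) = ∑ c, commProb p c * φ c := by
  have hi : ∀ c : Comm n, Integrable φ (ENNReal.ofReal (commProb p c) • Measure.dirac c) :=
    fun c => (integrable_dirac (by finiteness)).smul_measure ENNReal.ofReal_ne_top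
  rw [commLaw, integral_finsetSum_measure fun c _ => hi c]
  refine Finset.sum_congr rfl fun c _ => ?_
  rw [integral_smul_measure, integral_dirac, ENNReal.toReal_ofReal (commProb_nonneg hp hp1 c),
    smul_eq_mul]

theorem measurable_average {n m : ℕ} : Measurable (average : (Fin n → Model n m) → Model n m) := by
  unfold average
  fun_prop

theorem measurable_spread {n m : ℕ} : Measurable (spread : (Fin n → Model n m) → ℝ) := by
  unfold spread
  have := measurable_average (n := n) (m := m)
  fun_prop

theorem measurable_mix {n m : ℕ} (c : Comm n) :
    Measurable fun v : Fin n → Model n m => mix v c := by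
  refine measurable_pi_lambda _ fun i => ?_
  have h : (fun v : Fin n → Model n m => mix v c i) =
      WithLp.toLp 2 ∘ fun v jk => ∑ k, v k jk * weight c jk.1 k i := by
    funext v
    refine PiLp.ext fun jk => ?_
    exact mix_apply v c i jk
  rw [h]
  exact (WithLp.measurable_toLp 2 _).comp (by fun_prop)

section Problem

variable {n m : ℕ} {Ξ : Fin n → Type*} [∀ i, MeasurableSpace (Ξ i)] {D : ∀ i, Measure (Ξ i)}
  {F : ∀ i, Model n m → Ξ i → ℝ} {L σ ζ : ℝ}

theorem measurable_step (hA : Assumptions D F L σ ζ) (γ : ℝ) :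
    Measurable fun z : (Fin n → Model n m) × ((∀ i, Ξ i) × Comm n) => step F γ z.1 z.2 := by
  have h1 : Measurable fun z : (Fin n → Model n m) × (∀ i, Ξ i) => localStep F γ z.1 z.2 := by
    refine measurable_pi_lambda _ fun i => ?_
    have h2 : Measurable fun z : (Fin n → Model n m) × (∀ i, Ξ i) =>
        stochGrad F i (z.1 i) (z.2 i) :=
      (measurable_stochGrad hA i).comp (f := fun z : (Fin n → Model n m) × (∀ i, Ξ i) =>
        (z.1 i, z.2 i)) (by fun_prop)
    unfold localStep
    exact ((measurable_pi_apply i).comp measurable_fst).sub (h2.const_smul γ)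
  -- There are only finitely many network outcomes, so each may be fixed in turn.
  have h3 : Measurable fun z : ((Fin n → Model n m) × (∀ i, Ξ i)) × Comm n =>
      mix (localStep F γ z.1.1 z.1.2) z.2 :=
    measurable_from_prod_countable_left fun c => (measurable_mix c).comp h1
  exact h3.comp (f := fun z : (Fin n → Model n m) × ((∀ i, Ξ i) × Comm n) =>
    ((z.1, z.2.1), z.2.2)) (by fun_prop)

/-- The loss lies between the constant fstar and its quadratic upper bound at 0, both integrable
along a square integrable model. -/
theorem integrable_globalLoss (hA : Assumptions D F L σ ζ) (hn : 0 < n) {fstar : ℝ}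
    (hf : ∀ x, fstar ≤ globalLoss D F x) {Ω : Type*} [MeasurableSpace Ω] {P : Measure Ω}
    [IsFiniteMeasure P] {y : Ω → Model n m} (hy : MemLp y 2 P) :
    Integrable (fun ω => globalLoss D F (y ω)) P := by
  set c := gradient (globalLoss D F) 0
  have hb : Integrable (fun ω => |fstar| + (|globalLoss D F 0| + ‖c‖ * ‖y ω‖ +
      |L / 2| * ‖y ω‖ ^ 2)) P :=
    (integrable_const _).add (((integrable_const _).add
      ((hy.integrable (by norm_num)).norm.const_mul _)).add
        ((hy.integrable_norm_pow (by norm_num)).const_mul _))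
  refine hb.mono' ((differentiable_globalLoss hA).continuous.comp_aestronglyMeasurable hy.1)
    (Filter.Eventually.of_forall fun ω => ?_)
  have h1 := le_of_lipschitz_gradient (differentiable_globalLoss hA)
    (lipschitz_globalLoss hA hn) 0 (y ω)
  rw [sub_zero] at h1
  have h2 := real_inner_le_norm c (y ω)
  have h3 : L / 2 * ‖y ω‖ ^ 2 ≤ |L / 2| * ‖y ω‖ ^ 2 := by
    gcongr
    exact le_abs_self _
  have h4 : 0 ≤ |L / 2| * ‖y ω‖ ^ 2 := by positivity
  have h5 : 0 ≤ ‖c‖ * ‖y ω‖ := by positivity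
  rw [Real.norm_eq_abs, abs_le]
  constructor
  · linarith [hf (y ω), neg_abs_le fstar, abs_nonneg (globalLoss D F 0)]
  · linarith [le_abs_self (globalLoss D F 0), abs_nonneg fstar]

variable [∀ i, IsProbabilityMeasure (D i)]

/-- The law of the data samples and the network outcome of one iteration. -/
noncomputable def outcomeLaw (D : ∀ i, Measure (Ξ i)) (p : ℝ) : Measure ((∀ i, Ξ i) × Comm n) :=
  (Measure.pi D).prod (commLaw n p)

theorem isProbabilityMeasure_outcomeLaw (D : ∀ i, Measure (Ξ i)) [∀ i, IsProbabilityMeasure (D i)]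
    {p : ℝ} (hp : 0 ≤ p) (hp1 : p < 1) : IsProbabilityMeasure (outcomeLaw D p) := by
  have := isProbabilityMeasure_commLaw n hp hp1
  unfold outcomeLaw
  infer_instance

theorem integral_outcomeLaw {p : ℝ} (hp : 0 ≤ p) (hp1 : p < 1)
    {φ : (∀ i, Ξ i) × Comm n → ℝ} (hφ : Integrable φ (outcomeLaw D p)) :
    ∫ o, φ o ∂(outcomeLaw D p) = ∫ ξ, ∑ c, commProb p c * φ (ξ, c) ∂(Measure.pi D) := by
  have := isProbabilityMeasure_commLaw n hp hp1
  unfold outcomeLaw at hφ ⊢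
  rw [integral_prod _ hφ]
  simp_rw [integral_commLaw hp hp1]

theorem memLp_step (hA : Assumptions D F L σ ζ) {p : ℝ} (hp : 0 ≤ p) (hp1 : p < 1) (γ : ℝ)
    (x : Fin n → Model n m) (i : Fin n) :
    MemLp (fun o => step F γ x o i) 2 (outcomeLaw D p) := by
  have := isProbabilityMeasure_commLaw n hp hp1
  have hm : AEStronglyMeasurable (fun o => step F γ x o i) (outcomeLaw D p) :=
    ((measurable_pi_apply i).comp ((measurable_step hA γ).comp
      measurable_prodMk_left)).aestronglyMeasurable
  rw [memLp_two_iff_integrable_sq_norm hm]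
  have hb : Integrable (fun o : (∀ i, Ξ i) × Comm n => ∑ k, ‖localStep F γ x o.1 k‖ ^ 2)
      (outcomeLaw D p) := by
    unfold outcomeLaw
    exact (integrable_finsetSum Finset.univ fun k _ =>
      (memLp_localStep hA γ x k).integrable_norm_pow (by norm_num)).comp_fst (commLaw n p)
  refine hb.mono' (hm.norm.pow 2) (Filter.Eventually.of_forall fun o => ?_)
  rw [Real.norm_of_nonneg (by positivity)]
  exact norm_mix_sq_le _ _ _

theorem memLp_average {Ω : Type*} [MeasurableSpace Ω] {P : Measure Ω}
    {y : Ω → Fin n → Model n m} (hy : ∀ i, MemLp (fun ω => y ω i) 2 P) :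
    MemLp (fun ω => average (y ω)) 2 P := by
  unfold average
  exact (memLp_finsetSum _ fun i _ => hy i).const_smul ((n : ℝ)⁻¹)

theorem integrable_spread {Ω : Type*} [MeasurableSpace Ω] {P : Measure Ω}
    {y : Ω → Fin n → Model n m} (hy : ∀ i, MemLp (fun ω => y ω i) 2 P) :
    Integrable (fun ω => spread (y ω)) P := by
  unfold spread
  exact integrable_finsetSum _ fun i _ =>
    ((hy i).sub (memLp_average hy)).integrable_norm_pow (by norm_num)

theorem integral_spread_step (hA : Assumptions D F L σ ζ) {p α₁ α₂ : ℝ} (hp : 0 ≤ p) (hp1 : p < 1)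
    (hM : IsMixing n p α₁ α₂) (γ : ℝ) (x : Fin n → Model n m) :
    ∫ o, spread (step F γ x o) ∂(outcomeLaw D p) =
      (α₁ - α₂) * ∫ ξ, spread (localStep F γ x ξ) ∂(Measure.pi D) := by
  rw [integral_outcomeLaw hp hp1 (integrable_spread fun i => memLp_step hA hp hp1 γ x i)]
  simp_rw [step_eq_mix, hM.expectation_spread_mix]
  rw [integral_const_mul]

/-- The expected decrease of the loss in one iteration. -/
theorem integral_globalLoss_step_le (hA : Assumptions D F L σ ζ) (hn : 0 < n) (hL : 0 ≤ L)
    {fstar : ℝ} (hf : ∀ x, fstar ≤ globalLoss D F x) {p α₁ α₂ : ℝ} (hp : 0 ≤ p) (hp1 : p < 1)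
    (hM : IsMixing n p α₁ α₂) {γ : ℝ} (hγ : 0 ≤ γ) (hγL : γ * L ≤ 1)
    (x : Fin n → Model n m) :
    ∫ o, globalLoss D F (average (step F γ x o)) ∂(outcomeLaw D p) ≤
      globalLoss D F (average x) - γ / 2 * ‖gradient (globalLoss D F) (average x)‖ ^ 2 +
        γ * L ^ 2 / (2 * n) * spread x +
        L * α₂ / (2 * n) * ∫ ξ, spread (localStep F γ x ξ) ∂(Measure.pi D) +
        L * γ ^ 2 * σ ^ 2 / (2 * n) := by
  have := isProbabilityMeasure_outcomeLaw D hp hp1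
  set f := globalLoss D F
  set a := average x
  set d := gradient f a
  set g := average (localGrads D F x)
  have hav := memLp_average fun i => memLp_step hA hp hp1 γ x i
  have hav' := memLp_average_localStep hA γ x
  have hq : Integrable (fun o => f a + inner ℝ d (average (step F γ x o)) - inner ℝ d a +
      L / 2 * ‖average (step F γ x o) - a‖ ^ 2) (outcomeLaw D p) :=
    (((integrable_const _).add ((hav.integrable (by norm_num)).const_inner d)).sub
      (integrable_const _)).add (((hav.sub (memLp_const a)).integrable_norm_pow
        (by norm_num)).const_mul _)
  have h1 : ∫ o, f (average (step F γ x o)) ∂(outcomeLaw D p) ≤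
      ∫ o, (f a + inner ℝ d (average (step F γ x o)) - inner ℝ d a +
        L / 2 * ‖average (step F γ x o) - a‖ ^ 2) ∂(outcomeLaw D p) := by
    refine integral_mono (integrable_globalLoss hA hn hf hav) hq fun o => ?_
    have := le_of_lipschitz_gradient (differentiable_globalLoss hA)
      (lipschitz_globalLoss hA hn) a (average (step F γ x o))
    rw [inner_sub_right] at this
    show f _ ≤ _
    linarith
  have h2 : ∀ ξ, ∑ c : Comm n, commProb p c * (f a + inner ℝ d (average (step F γ x (ξ, c))) -
      inner ℝ d a + L / 2 * ‖average (step F γ x (ξ, c)) - a‖ ^ 2) =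
        (f a - inner ℝ d a) + inner ℝ d (average (localStep F γ x ξ)) +
          (L / 2 * ‖average (localStep F γ x ξ) - a‖ ^ 2 +
            L / 2 * (α₂ / n) * spread (localStep F γ x ξ)) := fun ξ => by
    have e1 := expectation_inner_average_mix p (localStep F γ x ξ) d
    have e2 := hM.expectation_average_mix (localStep F γ x ξ) a
    simp_rw [step_eq_mix]
    have : ∀ c : Comm n, commProb p c * (f a + inner ℝ d (average (mix (localStep F γ x ξ) c)) -
        inner ℝ d a + L / 2 * ‖average (mix (localStep F γ x ξ) c) - a‖ ^ 2) =
          commProb p c * (f a - inner ℝ d a) +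
          commProb p c * inner ℝ d (average (mix (localStep F γ x ξ) c)) +
          L / 2 * (commProb p c * ‖average (mix (localStep F γ x ξ) c) - a‖ ^ 2) := fun c => by
      ring
    simp_rw [this, Finset.sum_add_distrib, ← Finset.mul_sum, ← Finset.sum_mul, e1, e2,
      sum_commProb]
    ring
  have i1 : Integrable (fun ξ => (f a - inner ℝ d a) + inner ℝ d (average (localStep F γ x ξ)))
      (Measure.pi D) :=
    (integrable_const _).add ((hav'.integrable (by norm_num)).const_inner d)
  have i2 : Integrable (fun ξ => L / 2 * ‖average (localStep F γ x ξ) - a‖ ^ 2)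
      (Measure.pi D) :=
    ((hav'.sub (memLp_const a)).integrable_norm_pow (by norm_num)).const_mul _
  have i3 := (integrable_spread_localStep hA γ x).const_mul (L / 2 * (α₂ / n))
  have i23 : Integrable (fun ξ => L / 2 * ‖average (localStep F γ x ξ) - a‖ ^ 2 +
      L / 2 * (α₂ / n) * spread (localStep F γ x ξ)) (Measure.pi D) := i2.add i3
  rw [integral_outcomeLaw hp hp1 hq] at h1
  simp_rw [h2] at h1
  rw [integral_add i1 i23, integral_add (integrable_const _)
    ((hav'.integrable (by norm_num)).const_inner d), integral_add i2 i3, integral_const_mul,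
    integral_const_mul, integral_inner_average_localStep hA] at h1
  simp only [integral_const, probReal_univ, smul_eq_mul, one_mul] at h1
  have h3 := integral_norm_average_localStep_sub_sq_le hA γ x
  have h4 : ‖d - g‖ ^ 2 ≤ L ^ 2 / n * spread x := norm_average_localGrads_sub_sq_le hA x a
  have h5 := norm_sub_sq_real d g
  have h6 : L / 2 * ∫ ξ, ‖average (localStep F γ x ξ) - a‖ ^ 2 ∂(Measure.pi D) ≤
      L / 2 * (γ ^ 2 * (‖g‖ ^ 2 + σ ^ 2 / n)) := by gcongr
  have h7 : γ / 2 * ‖d - g‖ ^ 2 ≤ γ / 2 * (L ^ 2 / n * spread x) := by gcongr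
  -- Since −⟨d, g⟩ = (‖d − g‖² − ‖d‖² − ‖g‖²)/2, the term ‖g‖² gets the coefficient −γ/2 + Lγ²/2,
  -- nonpositive by `hγL`.
  have h8 : 0 ≤ γ / 2 * (1 - γ * L) * ‖g‖ ^ 2 :=
    mul_nonneg (mul_nonneg (by linarith) (by linarith)) (sq_nonneg _)
  refine h1.trans ?_
  have e3 : γ * L ^ 2 / (2 * n) * spread x = γ / 2 * (L ^ 2 / n * spread x) := by ring
  have e4 : L * γ ^ 2 * σ ^ 2 / (2 * n) = L / 2 * (γ ^ 2 * (σ ^ 2 / n)) := by ring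
  have e5 : L * α₂ / (2 * n) = L / 2 * (α₂ / n) := by ring
  rw [e3, e4, e5]
  rw [h5] at h7
  nlinarith

end Problem

/-! ### The iterates -/

section Iterates

variable {n m : ℕ} {Ξ : Fin n → Type*} [∀ i, MeasurableSpace (Ξ i)] {D : ∀ i, Measure (Ξ i)}
  {F : ∀ i, Model n m → Ξ i → ℝ} {L σ ζ : ℝ} {Ω : Type*}
  {o : ℕ → Ω → (∀ i, Ξ i) × Comm n} {p : ℝ}

theorem measurable_step_comp (hA : Assumptions D F L σ ζ) (γ : ℝ)
    {_ : MeasurableSpace Ω} {x : Ω → Fin n → Model n m} {y : Ω → (∀ i, Ξ i) × Comm n}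
    (hx : Measurable x) (hy : Measurable y) : Measurable fun ω => step F γ (x ω) (y ω) :=
  (measurable_step hA γ).comp (f := fun ω => (x ω, y ω)) (hx.prodMk hy)

/-- The models at time t use only earlier outcomes; measurability in the σ-algebra of these yields
independence from `o t`. -/
theorem measurable_iterates_of_lt (hA : Assumptions D F L σ ζ) (γ : ℝ) (t : ℕ) :
    Measurable[⨆ s ∈ {s | s < t}, MeasurableSpace.comap (o s) inferInstance]
      fun ω => iterates F γ (fun s => o s ω) t := by
  induction t with
  | zero => exact measurable_const
  | succ t ih =>
    have h1 : Measurable[⨆ s ∈ {s | s < t + 1}, MeasurableSpace.comap (o s) inferInstance]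
        fun ω => iterates F γ (fun s => o s ω) t :=
      ih.mono (biSup_mono fun s (hs : s < t) => Nat.lt_succ_of_lt hs) le_rfl
    have hle : MeasurableSpace.comap (o t) inferInstance ≤
        ⨆ s ∈ {s | s < t + 1}, MeasurableSpace.comap (o s) inferInstance :=
      le_iSup₂_of_le (f := fun s (_ : s ∈ {s | s < t + 1}) =>
        MeasurableSpace.comap (o s) inferInstance) t (Nat.lt_succ_self t) le_rfl
    have h2 : Measurable[⨆ s ∈ {s | s < t + 1}, MeasurableSpace.comap (o s) inferInstance]
        (o t) := measurable_iff_comap_le.2 hle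
    simp only [iterates]
    exact measurable_step_comp hA γ h1 h2

variable [MeasurableSpace Ω] {P : Measure Ω}

theorem measurable_iterates (hA : Assumptions D F L σ ζ) (ho : ∀ t, Measurable (o t)) (γ : ℝ)
    (t : ℕ) : Measurable fun ω => iterates F γ (fun s => o s ω) t :=
  (measurable_iterates_of_lt hA γ t).mono (iSup₂_le fun s _ => (ho s).comap_le) le_rfl

theorem indepFun_iterates (hA : Assumptions D F L σ ζ) (ho : ∀ t, Measurable (o t))
    (hi : iIndepFun o P) (γ : ℝ) (t : ℕ) :
    IndepFun (fun ω => iterates F γ (fun s => o s ω) t) (o t) P := by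
  have h := indep_iSup_of_disjoint (m := fun s => MeasurableSpace.comap (o s) inferInstance)
    (fun s => (ho s).comap_le) hi (S := {s | s < t}) (T := {t}) (by simp)
  rw [IndepFun_iff_Indep]
  refine indep_of_indep_of_le_right (indep_of_indep_of_le_left h ?_) ?_
  · exact (measurable_iterates_of_lt hA γ t).comap_le
  · simp

variable [IsProbabilityMeasure P]

theorem map_iterates_prod (hA : Assumptions D F L σ ζ) (hR : IsRandomness D p P o) (γ : ℝ)
    (t : ℕ) : P.map (fun ω => (iterates F γ (fun s => o s ω) t, o t ω)) =
      (P.map fun ω => iterates F γ (fun s => o s ω) t).prod (outcomeLaw D p) := by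
  have h := (indepFun_iff_map_prod_eq_prod_map_map
    (measurable_iterates hA hR.measurable γ t).aemeasurable (hR.measurable t).aemeasurable).1
      (indepFun_iterates hA hR.measurable hR.indep γ t)
  rw [h, hR.law t]
  rfl

theorem memLp_localGrads (hA : Assumptions D F L σ ζ) {y : Ω → Fin n → Model n m} {i : Fin n}
    (hy : MemLp (fun ω => y ω i) 2 P) : MemLp (fun ω => localGrads D F (y ω) i) 2 P := by
  have hb : MemLp (fun ω => L * ‖y ω i‖ + ‖gradient (localLoss D F i) 0‖) 2 P :=
    (hy.norm.const_mul L).add (memLp_const _)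
  refine hb.mono ((continuous_gradient_localLoss hA i).comp_aestronglyMeasurable hy.1)
    (Filter.Eventually.of_forall fun ω => ?_)
  have h1 := hA.lipschitz_gradient i (y ω i) 0
  rw [sub_zero] at h1
  have h2 := norm_le_norm_add_norm_sub' (gradient (localLoss D F i) (y ω i))
    (gradient (localLoss D F i) 0)
  rw [Real.norm_eq_abs]
  refine le_trans ?_ (le_abs_self _)
  change ‖gradient (localLoss D F i) (y ω i)‖ ≤ _
  linarith

variable [∀ i, IsProbabilityMeasure (D i)]

/-- The expectation after one more iteration, if the expectation given the current models is
bounded. -/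
theorem integral_iterates_succ_le (hA : Assumptions D F L σ ζ) (hR : IsRandomness D p P o)
    (hp : 0 ≤ p) (hp1 : p < 1) (γ : ℝ) (t : ℕ) {Φ Ψ : (Fin n → Model n m) → ℝ}
    (hΦ : Measurable Φ) (hΨ : Measurable Ψ)
    (hΦi : Integrable (fun ω => Φ (iterates F γ (fun s => o s ω) (t + 1))) P)
    (hΨi : Integrable (fun ω => Ψ (iterates F γ (fun s => o s ω) t)) P)
    (hle : ∀ x, ∫ y, Φ (step F γ x y) ∂(outcomeLaw D p) ≤ Ψ x) :
    ∫ ω, Φ (iterates F γ (fun s => o s ω) (t + 1)) ∂P ≤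
      ∫ ω, Ψ (iterates F γ (fun s => o s ω) t) ∂P := by
  have := isProbabilityMeasure_outcomeLaw D hp hp1
  have hX := measurable_iterates hA hR.measurable γ t
  have hXo : Measurable fun ω => (iterates F γ (fun s => o s ω) t, o t ω) :=
    hX.prodMk (hR.measurable t)
  have hS : Measurable fun z : (Fin n → Model n m) × ((∀ i, Ξ i) × Comm n) =>
      Φ (step F γ z.1 z.2) := hΦ.comp (measurable_step hA γ)
  have e1 := integral_map (μ := P) hXo.aemeasurable hS.aestronglyMeasurable
  have i1 := (integrable_map_measure (μ := P) hS.aestronglyMeasurable hXo.aemeasurable).2 hΦi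
  rw [map_iterates_prod hA hR] at e1 i1
  have e2 := integral_map (μ := P) hX.aemeasurable hΨ.aestronglyMeasurable
  have i2 := (integrable_map_measure (μ := P) hΨ.aestronglyMeasurable hX.aemeasurable).2 hΨi
  have : IsProbabilityMeasure (P.map fun ω => iterates F γ (fun s => o s ω) t) :=
    Measure.isProbabilityMeasure_map hX.aemeasurable
  refine e1.symm.trans_le ?_
  rw [← e2, integral_prod _ i1]
  exact integral_mono i1.integral_prod_left i2 hle

/-- Given the models, the second moment of the noise is at most σ² whatever they are, so it may be
integrated over any law of the models. -/
theorem memLp_noise_prod (hA : Assumptions D F L σ ζ) (hp : 0 ≤ p) (hp1 : p < 1)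
    {μ : Measure (Fin n → Model n m)} [IsProbabilityMeasure μ] (k : Fin n) :
    MemLp (fun z : (Fin n → Model n m) × ((∀ i, Ξ i) × Comm n) =>
      noise D F k (z.1 k) (z.2.1 k)) 2 (μ.prod (outcomeLaw D p)) := by
  have := isProbabilityMeasure_outcomeLaw D hp hp1
  have := isProbabilityMeasure_commLaw n hp hp1
  have hm : Measurable fun z : (Fin n → Model n m) × ((∀ i, Ξ i) × Comm n) =>
      noise D F k (z.1 k) (z.2.1 k) :=
    (measurable_noise hA k).comp (f := fun z : (Fin n → Model n m) × ((∀ i, Ξ i) × Comm n) =>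
      (z.1 k, z.2.1 k)) (by fun_prop)
  have hsm := (hm.norm.pow_const 2).aestronglyMeasurable (μ := μ.prod (outcomeLaw D p))
  rw [memLp_two_iff_integrable_sq_norm hm.aestronglyMeasurable, integrable_prod_iff hsm]
  have hi : ∀ x : Fin n → Model n m, Integrable (fun y : (∀ i, Ξ i) × Comm n =>
      ‖noise D F k (x k) (y.1 k)‖ ^ 2) (outcomeLaw D p) := fun x =>
    (integrable_noise_eval_sq hA k (x k)).comp_fst (commLaw n p)
  refine ⟨Filter.Eventually.of_forall hi, (integrable_const (σ ^ 2)).mono'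
    hsm.norm.integral_prod_right' (Filter.Eventually.of_forall fun x => ?_)⟩
  have hle : ∫ y : (∀ i, Ξ i) × Comm n, ‖noise D F k (x k) (y.1 k)‖ ^ 2 ∂(outcomeLaw D p) ≤
      σ ^ 2 := by
    rw [integral_outcomeLaw hp hp1 (hi x)]
    simp_rw [← Finset.sum_mul, sum_commProb, one_mul]
    exact integral_noise_eval_sq_le hA k (x k)
  rw [Real.norm_of_nonneg (integral_nonneg fun y => norm_nonneg _)]
  simpa using hle

/-- The local models are square integrable. -/
theorem memLp_iterates (hA : Assumptions D F L σ ζ) (hR : IsRandomness D p P o) (hp : 0 ≤ p)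
    (hp1 : p < 1) (γ : ℝ) (t : ℕ) (i : Fin n) :
    MemLp (fun ω => iterates F γ (fun s => o s ω) t i) 2 P := by
  induction t generalizing i with
  | zero => exact memLp_const 0
  | succ t ih =>
    have := isProbabilityMeasure_outcomeLaw D hp hp1
    have hX := measurable_iterates hA hR.measurable γ t
    have hXo : Measurable fun ω => (iterates F γ (fun s => o s ω) t, o t ω) :=
      hX.prodMk (hR.measurable t)
    have : IsProbabilityMeasure (P.map fun ω => iterates F γ (fun s => o s ω) t) :=
      Measure.isProbabilityMeasure_map hX.aemeasurable
    have hnoise : ∀ k, MemLp (fun ω =>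
        noise D F k (iterates F γ (fun s => o s ω) t k) ((o t ω).1 k)) 2 P := fun k => by
      have h := memLp_noise_prod hA hp hp1 k
        (μ := P.map fun ω => iterates F γ (fun s => o s ω) t)
      rw [← map_iterates_prod hA hR] at h
      exact h.comp_of_map hXo.aemeasurable
    have hv : ∀ k, MemLp (fun ω =>
        localStep F γ (iterates F γ (fun s => o s ω) t) (o t ω).1 k) 2 P := fun k => by
      simp_rw [localStep_eq D]
      exact ((ih k).sub ((memLp_localGrads hA (ih k)).const_smul γ)).sub
        ((hnoise k).const_smul γ)
    have hm : AEStronglyMeasurable (fun ω => iterates F γ (fun s => o s ω) (t + 1) i) P :=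
      ((measurable_pi_apply i).comp
        (measurable_iterates hA hR.measurable γ (t + 1))).aestronglyMeasurable
    rw [memLp_two_iff_integrable_sq_norm hm]
    refine (integrable_finsetSum Finset.univ fun k _ =>
      (hv k).integrable_norm_pow (by norm_num)).mono' (hm.norm.pow 2)
        (Filter.Eventually.of_forall fun ω => ?_)
    rw [Real.norm_of_nonneg (by positivity)]
    exact norm_mix_sq_le _ _ _

/-- Jensen's inequality for the square root, read off from the nonnegativity of a variance. -/
theorem integral_sqrt_le {S : Ω → ℝ} (hS : ∀ ω, 0 ≤ S ω) (hi : Integrable S P) {c : ℝ}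
    (hc : 0 ≤ c) (h : ∫ ω, S ω ∂P ≤ c ^ 2) :
    Integrable (fun ω => √(S ω)) P ∧ ∫ ω, √(S ω) ∂P ≤ c := by
  have hm : MemLp (fun ω => √(S ω)) 2 P := by
    rw [memLp_two_iff_integrable_sq (Real.continuous_sqrt.comp_aestronglyMeasurable hi.1)]
    simpa only [Real.sq_sqrt (hS _)] using hi
  refine ⟨hm.integrable (by norm_num), ?_⟩
  have h1 := variance_nonneg (fun ω => √(S ω)) P
  rw [variance_eq_sub hm] at h1
  simp only [Pi.pow_apply, Real.sq_sqrt (hS _)] at h1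
  exact abs_le_of_sq_le_sq' (by linarith) hc |>.2

/-- Carries the affine bound on the root of the spread from fixed models to expectations with the
same coefficients. -/
theorem integral_sq_affine_sqrt_le {S : Ω → ℝ} (hS : ∀ ω, 0 ≤ S ω) (hi : Integrable S P)
    {a b c : ℝ} (ha : 0 ≤ a) (hb : 0 ≤ b) (hc : 0 ≤ c) (h : ∫ ω, S ω ∂P ≤ c ^ 2) :
    Integrable (fun ω => (a * √(S ω) + b) ^ 2) P ∧
      ∫ ω, (a * √(S ω) + b) ^ 2 ∂P ≤ (a * c + b) ^ 2 := by
  obtain ⟨h1, h2⟩ := integral_sqrt_le hS hi hc h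
  have e : ∀ ω, (a * √(S ω) + b) ^ 2 = a ^ 2 * S ω + (2 * a * b * √(S ω) + b ^ 2) := fun ω => by
    rw [add_sq, mul_pow, Real.sq_sqrt (hS ω)]
    ring
  simp_rw [e]
  have i2 : Integrable (fun ω => 2 * a * b * √(S ω) + b ^ 2) P :=
    (h1.const_mul _).add (integrable_const _)
  refine ⟨(hi.const_mul _).add i2, ?_⟩
  rw [integral_add (hi.const_mul _) i2, integral_add (h1.const_mul _) (integrable_const _),
    integral_const_mul, integral_const_mul]
  simp only [integral_const, probReal_univ, smul_eq_mul, one_mul]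
  have h3 : a ^ 2 * ∫ ω, S ω ∂P ≤ a ^ 2 * c ^ 2 := by gcongr
  have h4 : 2 * a * b * ∫ ω, √(S ω) ∂P ≤ 2 * a * b * c := by gcongr
  linarith

/-- The mean square of the distance of the intermediate local models from their average. -/
theorem integral_spread_localStep_le_sq (hA : Assumptions D F L σ ζ) (hL : 0 ≤ L) (hσ : 0 ≤ σ)
    (hζ : 0 ≤ ζ) (hn : 0 < n) {γ : ℝ} (hγ : 0 ≤ γ) (x : Fin n → Model n m) :
    ∫ ξ, spread (localStep F γ x ξ) ∂(Measure.pi D) ≤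
      ((1 + γ * L) * √(spread x) + γ * √n * (σ + ζ)) ^ 2 := by
  have h1 := integral_spread_localStep_le hA γ x
  have h2 := sqrt_spread_exactStep_le hA hL hζ hn hγ x
  have h3 := pow_le_pow_left₀ (Real.sqrt_nonneg _) h2 2
  rw [Real.sq_sqrt (spread_nonneg _)] at h3
  have hn2 : √(n : ℝ) ^ 2 = n := Real.sq_sqrt (Nat.cast_nonneg n)
  have h4 : 0 ≤ (1 + γ * L) * √(spread x) + γ * (√n * ζ) := by positivity
  have h5 : 0 ≤ γ * √n * σ := by positivity
  have h6 : γ ^ 2 * (n * σ ^ 2) = (γ * √n * σ) ^ 2 := by rw [mul_pow, mul_pow, hn2]; ring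
  have h7 : ((1 + γ * L) * √(spread x) + γ * √n * (σ + ζ)) =
    ((1 + γ * L) * √(spread x) + γ * (√n * ζ)) + γ * √n * σ := by ring
  rw [h7]
  rw [h6] at h1
  -- Exact step and noise contribute A² + B², at most (A + B)² for A, B ≥ 0.
  nlinarith [mul_nonneg h4 h5]

/-- Induction from the common start at 0. If the root mean spread is at most √β h, the local step
raises it to at most h by `hfix`, and the exchange brings it back to √β h. -/
theorem integral_spread_iterates_le (hA : Assumptions D F L σ ζ) (hR : IsRandomness D p P o)
    (hn : 0 < n) (hL : 0 ≤ L) (hσ : 0 ≤ σ) (hζ : 0 ≤ ζ) (hp : 0 ≤ p) (hp1 : p < 1) {α₁ α₂ : ℝ}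
    (hM : IsMixing n p α₁ α₂) (hβ : 0 ≤ α₁ - α₂) {γ h : ℝ} (hγ : 0 ≤ γ) (hh : 0 ≤ h)
    (hfix : (1 + γ * L) * (√(α₁ - α₂) * h) + γ * √n * (σ + ζ) ≤ h) (t : ℕ) :
    ∫ ω, spread (iterates F γ (fun s => o s ω) t) ∂P ≤ (α₁ - α₂) * h ^ 2 := by
  induction t with
  | zero =>
    have : spread (0 : Fin n → Model n m) = 0 := by simp [spread, average]
    simp only [iterates, this, integral_zero]
    positivity
  | succ t ih =>
    have hs := integrable_spread fun i => memLp_iterates hA hR hp hp1 γ t i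
    have hs1 := integrable_spread fun i => memLp_iterates hA hR hp hp1 γ (t + 1) i
    have hc : (α₁ - α₂) * h ^ 2 = (√(α₁ - α₂) * h) ^ 2 := by
      rw [mul_pow, Real.sq_sqrt hβ]
    rw [hc] at ih
    obtain ⟨i1, h1⟩ := integral_sq_affine_sqrt_le (a := 1 + γ * L) (b := γ * √n * (σ + ζ))
      (fun ω => spread_nonneg _) hs (by positivity) (by positivity) (by positivity) ih
    have hm : Measurable fun x : Fin n → Model n m =>
        (α₁ - α₂) * ((1 + γ * L) * √(spread x) + γ * √n * (σ + ζ)) ^ 2 := by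
      have := measurable_spread (n := n) (m := m)
      fun_prop
    refine (integral_iterates_succ_le hA hR hp hp1 γ t measurable_spread hm hs1
      (i1.const_mul _) fun x => ?_).trans ?_
    · rw [integral_spread_step hA hp hp1 hM]
      exact mul_le_mul_of_nonneg_left
        (integral_spread_localStep_le_sq hA hL hσ hζ hn hγ x) hβ
    · rw [integral_const_mul]
      refine mul_le_mul_of_nonneg_left (h1.trans ?_) hβ
      exact pow_le_pow_left₀ (by positivity) hfix 2

theorem integrable_gradient_sq (hA : Assumptions D F L σ ζ) (hR : IsRandomness D p P o)
    (hp : 0 ≤ p) (hp1 : p < 1) (γ : ℝ) (t : ℕ) :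
    Integrable (fun ω =>
      ‖gradient (globalLoss D F) (average (iterates F γ (fun s => o s ω) t))‖ ^ 2) P := by
  simp_rw [gradient_globalLoss hA]
  exact (memLp_average fun i => memLp_localGrads hA (y := fun ω _ =>
    average (iterates F γ (fun s => o s ω) t))
      (memLp_average fun i => memLp_iterates hA hR hp hp1 γ t i)).integrable_norm_pow
        (by norm_num)

/-- The mean of the squared gradient norms along the averages of the local models. -/
theorem mean_integral_gradient_sq_le (hA : Assumptions D F L σ ζ) (hR : IsRandomness D p P o)
    (hn : 0 < n) (hL : 0 ≤ L) (hσ : 0 ≤ σ) (hζ : 0 ≤ ζ) {fstar : ℝ}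
    (hf : ∀ x, fstar ≤ globalLoss D F x) (hp : 0 ≤ p) (hp1 : p < 1) {α₁ α₂ : ℝ}
    (hM : IsMixing n p α₁ α₂) (hα : 0 ≤ α₂) (hβ : 0 ≤ α₁ - α₂) {γ h : ℝ} (hγ : 0 < γ)
    (hγL : γ * L ≤ 1) (hh : 0 ≤ h)
    (hfix : (1 + γ * L) * (√(α₁ - α₂) * h) + γ * √n * (σ + ζ) ≤ h) {T : ℕ} (hT : 0 < T) :
    (T : ℝ)⁻¹ * ∑ t ∈ Finset.range T, ∫ ω,
      ‖gradient (globalLoss D F) (average (iterates F γ (fun s => o s ω) t))‖ ^ 2 ∂P ≤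
      2 * (globalLoss D F 0 - fstar) / (γ * T) + L ^ 2 * (α₁ - α₂) / n * h ^ 2 +
        L * α₂ / (n * γ) * h ^ 2 + L * γ * σ ^ 2 / n := by
  let G : ℕ → ℝ := fun t => ∫ ω,
    ‖gradient (globalLoss D F) (average (iterates F γ (fun s => o s ω) t))‖ ^ 2 ∂P
  let E : ℕ → ℝ := fun t => ∫ ω, globalLoss D F (average (iterates F γ (fun s => o s ω) t)) ∂P
  have hn' : (0 : ℝ) < n := by positivity
  -- The error of one iteration: gradients taken away from the average, the random exchange, and the
  -- sampling noise.
  set K : ℝ := γ * L ^ 2 / (2 * n) * ((α₁ - α₂) * h ^ 2) + L * α₂ / (2 * n) * h ^ 2 +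
    L * γ ^ 2 * σ ^ 2 / (2 * n) with hK
  have hav := fun t => memLp_average fun i => memLp_iterates hA hR hp hp1 γ t i
  have hl := fun t => integrable_globalLoss hA hn hf (hav t)
  have hstep : ∀ t, E (t + 1) ≤ E t - γ / 2 * G t + K := fun t => by
    have hs := integrable_spread fun i => memLp_iterates hA hR hp hp1 γ t i
    have hd := integral_spread_iterates_le hA hR hn hL hσ hζ hp hp1 hM hβ hγ.le hh hfix t
    have hc : (α₁ - α₂) * h ^ 2 = (√(α₁ - α₂) * h) ^ 2 := by
      rw [mul_pow, Real.sq_sqrt hβ]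
    obtain ⟨i1, h1⟩ := integral_sq_affine_sqrt_le (a := 1 + γ * L) (b := γ * √n * (σ + ζ))
      (fun ω => spread_nonneg _) hs (by positivity) (by positivity) (by positivity) (hc ▸ hd)
    have hgr := integrable_gradient_sq hA hR hp hp1 γ t (P := P)
    let Ψ : (Fin n → Model n m) → ℝ := fun x =>
      globalLoss D F (average x) - γ / 2 * ‖gradient (globalLoss D F) (average x)‖ ^ 2 +
        γ * L ^ 2 / (2 * n) * spread x +
        L * α₂ / (2 * n) * ((1 + γ * L) * √(spread x) + γ * √n * (σ + ζ)) ^ 2 +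
        L * γ ^ 2 * σ ^ 2 / (2 * n)
    have hfm : Measurable (globalLoss D F) := (differentiable_globalLoss hA).continuous.measurable
    have hgm : Measurable (gradient (globalLoss D F)) := by
      have : gradient (globalLoss D F) =
          fun x => average fun i => gradient (localLoss D F i) x :=
        funext fun x => gradient_globalLoss hA x
      rw [this]
      exact measurable_average.comp (measurable_pi_lambda _ fun i =>
        (continuous_gradient_localLoss hA i).measurable)
    have hΨ : Measurable Ψ := by
      have h1 := measurable_spread (n := n) (m := m)
      have h2 := measurable_average (n := n) (m := m)
      have h3 := hfm.comp h2
      have h4 := hgm.comp h2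
      simp only [Function.comp_def] at h3 h4
      fun_prop
    have j1 : Integrable (fun ω => globalLoss D F (average (iterates F γ (fun s => o s ω) t)) -
        γ / 2 * ‖gradient (globalLoss D F) (average (iterates F γ (fun s => o s ω) t))‖ ^ 2) P :=
      (hl t).sub (hgr.const_mul _)
    have j2 : Integrable (fun ω => globalLoss D F (average (iterates F γ (fun s => o s ω) t)) -
        γ / 2 * ‖gradient (globalLoss D F) (average (iterates F γ (fun s => o s ω) t))‖ ^ 2 +
        γ * L ^ 2 / (2 * n) * spread (iterates F γ (fun s => o s ω) t)) P :=
      j1.add (hs.const_mul _)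
    have j3 : Integrable (fun ω => globalLoss D F (average (iterates F γ (fun s => o s ω) t)) -
        γ / 2 * ‖gradient (globalLoss D F) (average (iterates F γ (fun s => o s ω) t))‖ ^ 2 +
        γ * L ^ 2 / (2 * n) * spread (iterates F γ (fun s => o s ω) t) +
        L * α₂ / (2 * n) * ((1 + γ * L) * √(spread (iterates F γ (fun s => o s ω) t)) +
          γ * √n * (σ + ζ)) ^ 2) P := j2.add (i1.const_mul _)
    have hΨi : Integrable (fun ω => Ψ (iterates F γ (fun s => o s ω) t)) P :=
      j3.add (integrable_const _)
    refine (integral_iterates_succ_le hA hR hp hp1 γ t (Φ := fun x => globalLoss D F (average x))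
      (hfm.comp measurable_average) hΨ (hl (t + 1)) hΨi fun x => ?_).trans ?_
    · refine (integral_globalLoss_step_le hA hn hL hf hp hp1 hM hγ.le hγL x).trans ?_
      have := integral_spread_localStep_le_sq hA hL hσ hζ hn hγ.le x
      simp only [Ψ]
      gcongr
    · simp only [Ψ]
      rw [integral_add j3 (integrable_const _), integral_add j2 (i1.const_mul _),
        integral_add j1 (hs.const_mul _), integral_sub (hl t) (hgr.const_mul _),
        integral_const_mul, integral_const_mul, integral_const_mul]
      simp only [integral_const, probReal_univ, smul_eq_mul, one_mul]
      have h2 : ((1 + γ * L) * (√(α₁ - α₂) * h) + γ * √n * (σ + ζ)) ^ 2 ≤ h ^ 2 :=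
        pow_le_pow_left₀ (by positivity) hfix 2
      have h3 : γ * L ^ 2 / (2 * n) * ∫ ω, spread (iterates F γ (fun s => o s ω) t) ∂P ≤
        γ * L ^ 2 / (2 * n) * ((α₁ - α₂) * h ^ 2) := by gcongr
      have h4 : L * α₂ / (2 * n) * ∫ ω, ((1 + γ * L) *
          √(spread (iterates F γ (fun s => o s ω) t)) + γ * √n * (σ + ζ)) ^ 2 ∂P ≤
        L * α₂ / (2 * n) * h ^ 2 := by
          gcongr
          exact h1.trans h2
      simp only [E, G, hK]
      linarith
  have hsum : ∀ t : ℕ, E t + γ / 2 * ∑ s ∈ Finset.range t, G s ≤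
      globalLoss D F 0 + t * K := fun t => by
    induction t with
    | zero => simp [E, iterates, average]
    | succ t ih =>
      rw [Finset.sum_range_succ, mul_add]
      push_cast
      linarith [hstep t]
  have hE : fstar ≤ E T := by
    have := integral_mono (integrable_const fstar) (hl T) fun ω => hf _
    simpa [E] using this
  have hT' : (0 : ℝ) < T := by positivity
  have h1 : γ / 2 * ∑ s ∈ Finset.range T, G s ≤ globalLoss D F 0 - fstar + T * K := by
    linarith [hsum T]
  have h2 : ∑ s ∈ Finset.range T, G s ≤ 2 / γ * (globalLoss D F 0 - fstar + T * K) := by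
    have := mul_le_mul_of_nonneg_left h1 (by positivity : 0 ≤ 2 / γ)
    refine le_trans (le_of_eq ?_) this
    field_simp
  calc (T : ℝ)⁻¹ * ∑ s ∈ Finset.range T, G s
      ≤ (T : ℝ)⁻¹ * (2 / γ * (globalLoss D F 0 - fstar + T * K)) := by gcongr
    _ = _ := by
      rw [hK]
      field_simp
      ring

end Iterates

/-! ### The rate for the chosen step size -/

/-- In this and the next lemmas ν, τ, a, u, w stand for √n, √T, √α₂, 1 − √β, σ + ζ. Here 1/γ is a
sum of three parts, one for each summand of the step size denominator. -/
theorem initial_term_le {Δ L σ w ν τ a u γ : ℝ} (hΔ : 0 ≤ Δ) (hL : 0 < L) (hσ : 0 ≤ σ)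
    (hσw : σ ≤ w) (hν : 0 < ν) (hτ : 0 < τ) (ha : 0 ≤ a) (hu : 0 < u)
    (hγ : γ = u / (6 * L + 3 * w * (a * τ) + σ * τ / ν)) :
    2 * Δ / (γ * τ ^ 2) ≤ 12 * L * Δ * (1 / (u * τ ^ 2)) +
      6 * Δ * (w / (u * (ν * τ)) + w * a / (u * τ)) := by
  have hw0 : 0 ≤ w := hσ.trans hσw
  have hden : 0 < 6 * L + 3 * w * (a * τ) + σ * τ / ν := by positivity
  have e : 2 * Δ / (γ * τ ^ 2) = 12 * L * Δ * (1 / (u * τ ^ 2)) + 6 * Δ * (w * a / (u * τ)) +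
      2 * Δ * (σ / (u * (ν * τ))) := by
    rw [hγ]
    field_simp
    ring
  have h1 : σ / (u * (ν * τ)) ≤ w / (u * (ν * τ)) := by gcongr
  have h2 := mul_le_mul_of_nonneg_left h1 hΔ
  have h3 : 0 ≤ Δ * (w / (u * (ν * τ))) := by positivity
  rw [e]
  linarith

theorem noise_term_le {L σ w ν τ u γ : ℝ} (hL : 0 < L) (hσ : 0 ≤ σ) (hσw : σ ≤ w) (hν : 0 < ν)
    (hτ : 0 < τ) (hu : 0 < u) (hu1 : u ≤ 1) (hγ : γ * (σ * τ / ν) ≤ u) :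
    L * γ * σ ^ 2 / ν ^ 2 ≤ L * (w / (u * (ν * τ))) := by
  have hw0 : 0 ≤ w := hσ.trans hσw
  calc L * γ * σ ^ 2 / ν ^ 2 = L * (γ * (σ * τ / ν) * (σ / (ν * τ))) := by field_simp
    _ ≤ L * (1 * (w / (ν * τ))) := by
      gcongr
      exact hγ.trans hu1
    _ = L * (w / (ν * τ)) := by rw [one_mul]
    _ ≤ L * (w / (u * (ν * τ))) := mul_le_mul_of_nonneg_left
        (div_le_div_of_nonneg_left hw0 (by positivity)
          (mul_le_of_le_one_left (by positivity) hu1)) hL.le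

/-- One factor γ is spent against the summand with √(α₂T); its coefficient 3 turns (6/5)² into 12/25
≤ 1. -/
theorem exchange_term_le {L w ν τ a u γ h : ℝ} (hL : 0 < L) (hw : 0 ≤ w) (hν : 0 < ν)
    (hτ : 0 < τ) (ha : 0 ≤ a) (hu : 0 < u) (hγ0 : 0 < γ) (hγ : γ * (3 * w * (a * τ)) ≤ u)
    (hh : h = 6 / 5 * (γ * ν * w) / u) :
    L * a ^ 2 / (ν ^ 2 * γ) * h ^ 2 ≤ L * (w * a / (u * τ)) := by
  have e : L * a ^ 2 / (ν ^ 2 * γ) * h ^ 2 =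
      L * (12 / 25 * (γ * (3 * w * (a * τ))) * (w * a / (u ^ 2 * τ))) := by
    rw [hh]
    field_simp
    ring
  rw [e]
  refine mul_le_mul_of_nonneg_left ?_ hL.le
  calc 12 / 25 * (γ * (3 * w * (a * τ))) * (w * a / (u ^ 2 * τ))
      ≤ 1 * u * (w * a / (u ^ 2 * τ)) := by gcongr; norm_num
    _ = w * a / (u * τ) := by field_simp

/-- Here γ² is weighed against the squares of both noise summands of the step size denominator,
which together dominate the denominator of the last fraction up to ν². The constants combine to
72/25 ≤ 3. -/
theorem consensus_term_le {L σ ζ ν τ a β u γ h : ℝ} (hσ : 0 ≤ σ) (hζ : 0 ≤ ζ) (hν : 0 < ν)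
    (hτ : 0 < τ) (hβ : 0 ≤ β) (hβ1 : β ≤ 1) (haβ : a = 0 → β = 0) (hu : 0 < u)
    (hγ : γ ^ 2 * ((3 * (σ + ζ) * (a * τ)) ^ 2 + (σ * τ / ν) ^ 2) ≤ u ^ 2)
    (hh : h = 6 / 5 * (γ * ν * (σ + ζ)) / u) :
    L ^ 2 * β / ν ^ 2 * h ^ 2 ≤ 3 * L ^ 2 * (ν ^ 2 * (σ ^ 2 + ζ ^ 2) /
      ((1 + ν ^ 2 * a ^ 2) * σ ^ 2 * τ ^ 2 + ν ^ 2 * a ^ 2 * τ ^ 2 * ζ ^ 2)) := by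
  have e : L ^ 2 * β / ν ^ 2 * h ^ 2 =
      L ^ 2 * (36 / 25) * (β * (σ + ζ) ^ 2 * (γ ^ 2 / u ^ 2)) := by
    rw [hh]
    field_simp
    ring
  rw [e]
  have hw2 : (σ + ζ) ^ 2 ≤ 2 * (σ ^ 2 + ζ ^ 2) := add_sq_le
  have hw3 : σ ^ 2 + ζ ^ 2 ≤ 9 * (σ + ζ) ^ 2 := by
    rw [add_sq]
    linarith [mul_nonneg hσ hζ, sq_nonneg σ, sq_nonneg ζ]
  have e6 : (1 + ν ^ 2 * a ^ 2) * σ ^ 2 * τ ^ 2 + ν ^ 2 * a ^ 2 * τ ^ 2 * ζ ^ 2 =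
      (σ ^ 2 + ζ ^ 2) * (ν ^ 2 * a ^ 2 * τ ^ 2) + σ ^ 2 * τ ^ 2 := by ring
  rw [e6]
  have h1 : 0 ≤ (σ ^ 2 + ζ ^ 2) * (ν ^ 2 * a ^ 2 * τ ^ 2) := by positivity
  have h2 : 0 ≤ σ ^ 2 * τ ^ 2 := by positivity
  -- A zero denominator forces σ = 0 and either ζ = 0 or a = 0; in each case β(σ + ζ)² = 0, which
  -- matches division by zero giving 0.
  rcases (add_nonneg h1 h2).eq_or_lt with h0 | hpos
  · have hz : β * (σ + ζ) ^ 2 = 0 := by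
      have hσ0 : σ = 0 := by
        have h3 : σ ^ 2 * τ ^ 2 = 0 := by linarith
        simpa [hτ.ne'] using h3
      rcases eq_or_ne a 0 with ha0 | ha0
      · rw [haβ ha0, zero_mul]
      · have h4 : (σ ^ 2 + ζ ^ 2) * (ν ^ 2 * a ^ 2 * τ ^ 2) = 0 := by linarith
        have hζ0 : ζ = 0 := by simpa [hσ0, ha0, hτ.ne', hν.ne'] using h4
        simp [hσ0, hζ0]
    rw [hz, ← h0]
    simp
  · set den := (σ ^ 2 + ζ ^ 2) * (ν ^ 2 * a ^ 2 * τ ^ 2) + σ ^ 2 * τ ^ 2 with hden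
    have h3 : γ ^ 2 * den ≤ ν ^ 2 * u ^ 2 := by
      have h4 : den ≤ ν ^ 2 * ((3 * (σ + ζ) * (a * τ)) ^ 2 + (σ * τ / ν) ^ 2) := by
        have e5 : ν ^ 2 * ((3 * (σ + ζ) * (a * τ)) ^ 2 + (σ * τ / ν) ^ 2) =
            9 * (σ + ζ) ^ 2 * (ν ^ 2 * a ^ 2 * τ ^ 2) + σ ^ 2 * τ ^ 2 := by
          field_simp
          ring
        rw [e5, hden]
        exact add_le_add_left (mul_le_mul_of_nonneg_right hw3 (by positivity)) _
      calc γ ^ 2 * den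
          ≤ γ ^ 2 * (ν ^ 2 * ((3 * (σ + ζ) * (a * τ)) ^ 2 + (σ * τ / ν) ^ 2)) := by gcongr
        _ = ν ^ 2 * (γ ^ 2 * ((3 * (σ + ζ) * (a * τ)) ^ 2 + (σ * τ / ν) ^ 2)) := by ring
        _ ≤ _ := by gcongr
    have h5 : γ ^ 2 / u ^ 2 ≤ ν ^ 2 / den := by
      rw [div_le_div_iff₀ (by positivity) hpos]
      exact h3
    calc L ^ 2 * (36 / 25) * (β * (σ + ζ) ^ 2 * (γ ^ 2 / u ^ 2))
        ≤ L ^ 2 * (36 / 25) * (1 * (2 * (σ ^ 2 + ζ ^ 2)) * (ν ^ 2 / den)) := by gcongr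
      _ = 72 / 25 * (L ^ 2 * (ν ^ 2 * (σ ^ 2 + ζ ^ 2) / den)) := by ring
      _ ≤ 3 * (L ^ 2 * (ν ^ 2 * (σ ^ 2 + ζ ^ 2) / den)) := by
          gcongr
          norm_num
      _ = _ := by ring

theorem rate_bound {Δ L σ ζ N T α β s γ h : ℝ} (hΔ : 0 ≤ Δ) (hL : 0 < L) (hσ : 0 ≤ σ)
    (hζ : 0 ≤ ζ) (hN : 0 < N) (hT : 0 < T) (hα : 0 ≤ α) (hβ : 0 ≤ β) (hβ1 : β ≤ 1) (hs : 0 ≤ s)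
    (hs1 : s < 1) (hαβ : α = 0 → β = 0)
    (hγ : γ = (1 - s) / (6 * L + 3 * (σ + ζ) * √(α * T) + σ * √T / √N))
    (hh : h = 6 / 5 * (γ * √N * (σ + ζ)) / (1 - s)) :
    2 * Δ / (γ * T) + L ^ 2 * β / N * h ^ 2 + L * α / (N * γ) * h ^ 2 + L * γ * σ ^ 2 / N ≤
      (12 * L * Δ + 6 * Δ + 2 * L + 3 * L ^ 2) *
        ((σ + ζ) * (1 + √(N * α)) / ((1 - s) * √(N * T)) + 1 / ((1 - s) * T) +
          N * (σ ^ 2 + ζ ^ 2) / ((1 + N * α) * σ ^ 2 * T + N * α * T * ζ ^ 2)) := by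
  obtain ⟨ν, hν, rfl⟩ : ∃ ν, 0 < ν ∧ ν ^ 2 = N := ⟨√N, Real.sqrt_pos.2 hN, Real.sq_sqrt hN.le⟩
  obtain ⟨τ, hτ, rfl⟩ : ∃ τ, 0 < τ ∧ τ ^ 2 = T := ⟨√T, Real.sqrt_pos.2 hT, Real.sq_sqrt hT.le⟩
  obtain ⟨a, ha, rfl⟩ : ∃ a, 0 ≤ a ∧ a ^ 2 = α := ⟨√α, Real.sqrt_nonneg _, Real.sq_sqrt hα⟩
  obtain ⟨u, hus⟩ : ∃ u, u = 1 - s := ⟨_, rfl⟩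
  have e1 : √(a ^ 2 * τ ^ 2) = a * τ := by rw [← mul_pow, Real.sqrt_sq (by positivity)]
  have e2 : √(ν ^ 2 * a ^ 2) = ν * a := by rw [← mul_pow, Real.sqrt_sq (by positivity)]
  have e3 : √(ν ^ 2 * τ ^ 2) = ν * τ := by rw [← mul_pow, Real.sqrt_sq (by positivity)]
  rw [Real.sqrt_sq hν.le, ← hus] at hγ hh
  rw [Real.sqrt_sq hτ.le, e1] at hγ
  rw [e2, e3, ← hus]
  have hu : 0 < u := by linarith
  have hu1 : u ≤ 1 := by linarith
  have hσw : σ ≤ σ + ζ := by linarith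
  have hw : 0 ≤ σ + ζ := by linarith
  have h1 : 0 ≤ 3 * (σ + ζ) * (a * τ) := by positivity
  have h2 : 0 ≤ σ * τ / ν := by positivity
  have hγ0 : 0 < γ := by rw [hγ]; positivity
  have hγeq : γ * (6 * L + 3 * (σ + ζ) * (a * τ) + σ * τ / ν) = u := by
    rw [hγ]
    exact div_mul_cancel₀ _ (by positivity)
  have k1 : γ * (3 * (σ + ζ) * (a * τ)) ≤ u := by
    rw [← hγeq]
    exact mul_le_mul_of_nonneg_left (by linarith) hγ0.le
  have k2 : γ * (σ * τ / ν) ≤ u := by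
    rw [← hγeq]
    exact mul_le_mul_of_nonneg_left (by linarith) hγ0.le
  have k3 : γ ^ 2 * ((3 * (σ + ζ) * (a * τ)) ^ 2 + (σ * τ / ν) ^ 2) ≤ u ^ 2 := by
    rw [← hγeq, mul_pow γ]
    refine mul_le_mul_of_nonneg_left ?_ (sq_nonneg γ)
    calc _ ≤ (3 * (σ + ζ) * (a * τ) + σ * τ / ν) ^ 2 := by
          rw [add_sq (3 * (σ + ζ) * (a * τ))]
          linarith [mul_nonneg h1 h2]
      _ ≤ _ := pow_le_pow_left₀ (by positivity) (by linarith) 2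
  have t1 := initial_term_le hΔ hL hσ hσw hν hτ ha hu hγ
  have t2 := consensus_term_le (L := L) hσ hζ hν hτ hβ hβ1 (fun h => hαβ (by rw [h]; simp)) hu k3 hh
  have t3 := exchange_term_le hL hw hν hτ ha hu hγ0 k1 hh
  have t4 := noise_term_le hL hσ hσw hν hτ hu hu1 k2
  have hAeq : (σ + ζ) * (1 + ν * a) / (u * (ν * τ)) =
      (σ + ζ) / (u * (ν * τ)) + (σ + ζ) * a / (u * τ) := by
    field_simp
  rw [hAeq]
  have hA1 : 0 ≤ (σ + ζ) / (u * (ν * τ)) := by positivity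
  have hA2 : 0 ≤ (σ + ζ) * a / (u * τ) := by positivity
  have hB : 0 ≤ 1 / (u * τ ^ 2) := by positivity
  have hX : 0 ≤ ν ^ 2 * (σ ^ 2 + ζ ^ 2) /
      ((1 + ν ^ 2 * a ^ 2) * σ ^ 2 * τ ^ 2 + ν ^ 2 * a ^ 2 * τ ^ 2 * ζ ^ 2) := by positivity
  refine (add_le_add (add_le_add (add_le_add t1 t2) t3) t4).trans ?_
  generalize (σ + ζ) / (u * (ν * τ)) = A₁ at *
  generalize (σ + ζ) * a / (u * τ) = A₂ at *
  generalize 1 / (u * τ ^ 2) = B at *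
  generalize ν ^ 2 * (σ ^ 2 + ζ ^ 2) /
      ((1 + ν ^ 2 * a ^ 2) * σ ^ 2 * τ ^ 2 + ν ^ 2 * a ^ 2 * τ ^ 2 * ζ ^ 2) = X at *
  -- The slack between the product of summed constants and rate terms and the sum of the four
  -- bounds.
  have key : 0 ≤ 12 * L * Δ * (A₁ + A₂ + X) + 6 * Δ * (B + X) + 3 * L ^ 2 * (A₁ + A₂ + B) +
      L * (A₁ + A₂ + 2 * B + 2 * X) := by positivity
  refine (le_add_of_nonneg_right key).trans (le_of_eq ?_)
  ring

/-! ### From the algebraic estimate to the guaranteed rates -/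

theorem GuaranteedRate.mono.{u, v} {n T : ℕ} {p γ L σ ζ f₀ fstar R R' : ℝ}
    (h : GuaranteedRate.{u, v} n T p γ L σ ζ f₀ fstar R) (hR : R ≤ R') :
    GuaranteedRate.{u, v} n T p γ L σ ζ f₀ fstar R' := by
  intro m Ξ _ D _ F Ω _ P _ o hA h0 hf hr
  obtain ⟨h1, h2⟩ := h m Ξ D F Ω P o hA h0 hf hr
  exact ⟨h1, h2.trans hR⟩

theorem IsMixing.sqrt_lt_one {n : ℕ} {p α₁ α₂ : ℝ} (h : IsMixing n p α₁ α₂) (hn : 2 ≤ n)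
    (hp : 0 ≤ p) (hp1 : p < 1) : √(α₁ - α₂) < 1 := by
  rw [Real.sqrt_lt' one_pos]
  linarith [h.lt_one hn hp hp1, h.nonneg hn hp hp1]

/-- Expanding (1 − √β)² ≥ 0 gives 1 − √β ≥ (1 − β)/2, and β ≤ 1 − (1 − p)². -/
theorem IsMixing.one_sub_sqrt_ge {n : ℕ} {p α₁ α₂ : ℝ} (h : IsMixing n p α₁ α₂) (hn : 2 ≤ n)
    (hp : 0 ≤ p) (hp1 : p < 1) : (1 - p) ^ 2 / 2 ≤ 1 - √(α₁ - α₂) := by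
  have h1 := h.sub_le hn hp hp1
  have h2 := Real.sq_sqrt (sub_nonneg.2 (h.le hn hp hp1))
  nlinarith [sq_nonneg (1 - √(α₁ - α₂))]

/-- The constant of the convergence rate. -/
noncomputable def rateConst (L f₀ fstar : ℝ) : ℝ :=
  12 * L * |f₀ - fstar| + 6 * |f₀ - fstar| + 2 * L + 3 * L ^ 2

theorem rateConst_nonneg {L : ℝ} (hL : 0 < L) (f₀ fstar : ℝ) : 0 ≤ rateConst L f₀ fstar := by
  unfold rateConst
  positivity

theorem guaranteedRate_stepSize.{u, v} {L : ℝ} (hL : 0 < L) (f₀ fstar : ℝ) {n T : ℕ}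
    {p α₁ α₂ σ ζ : ℝ} (hn : 2 ≤ n) (hT : 1 ≤ T) (hp : 0 ≤ p) (hp1 : p < 1) (hσ : 0 ≤ σ)
    (hζ : 0 ≤ ζ) (hM : IsMixing n p α₁ α₂) :
    GuaranteedRate.{u, v} n T p (stepSize n T α₁ α₂ L σ ζ) L σ ζ f₀ fstar
      (rateConst L f₀ fstar * ((σ + ζ) * (1 + √(n * α₂)) / ((1 - √(α₁ - α₂)) * √(n * T))
        + 1 / ((1 - √(α₁ - α₂)) * T)
        + n * (σ ^ 2 + ζ ^ 2) / ((1 + n * α₂) * σ ^ 2 * T + n * α₂ * T * ζ ^ 2))) := by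
  intro m Ξ _ D _ F Ω _ P _ o hA h0 hf hR
  have hn' : (0 : ℝ) < n := by positivity
  have hT' : (0 : ℝ) < T := by exact_mod_cast hT
  have hα := hM.nonneg hn hp hp1
  have hβ := sub_nonneg.2 (hM.le hn hp hp1)
  have hs := Real.sqrt_nonneg (α₁ - α₂)
  have hs1 := hM.sqrt_lt_one hn hp hp1
  have hlb : ∀ x, fstar ≤ globalLoss D F x := fun x => hf.1 ⟨x, rfl⟩
  have hΔ : 0 ≤ f₀ - fstar := by rw [← h0]; linarith [hlb 0]
  set γ := stepSize n T α₁ α₂ L σ ζ with hγ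
  set s := √(α₁ - α₂)
  have hu : 0 < 1 - s := by linarith
  have hγ0 : 0 < γ := by
    rw [hγ, stepSize]
    positivity
  have hγL : γ * (6 * L) ≤ 1 - s := by
    have hle : 6 * L ≤ 6 * L + 3 * (σ + ζ) * √(α₂ * T) + σ * √T / √n := by
      have : 0 ≤ 3 * (σ + ζ) * √(α₂ * T) + σ * √T / √n := by positivity
      linarith
    rw [hγ, stepSize, div_mul_eq_mul_div, div_le_iff₀ (by positivity)]
    exact mul_le_mul_of_nonneg_left hle hu.le
  -- Chosen so that the inhomogeneous term is 5/6 of (1 − s)h; the remaining sixth absorbs γLs,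
  -- because 6L in the step size gives γL ≤ (1 − s)/6.
  obtain ⟨h, hh⟩ : ∃ h, h = 6 / 5 * (γ * √n * (σ + ζ)) / (1 - s) := ⟨_, rfl⟩
  have hh0 : 0 ≤ h := by rw [hh]; positivity
  have hfix : (1 + γ * L) * (s * h) + γ * √n * (σ + ζ) ≤ h := by
    have e : γ * √n * (σ + ζ) = 5 / 6 * (1 - s) * h := by
      rw [hh]
      field_simp
    have h1 : γ * L * s ≤ (1 - s) / 6 := by
      nlinarith [mul_nonneg hγ0.le hL.le]
    rw [e]
    nlinarith
  refine ⟨fun t _ => integrable_gradient_sq hA hR hp hp1 γ t, ?_⟩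
  refine (mean_integral_gradient_sq_le hA hR (by omega) hL.le hσ hζ hlb hp hp1 hM hα hβ hγ0
    (by linarith) hh0 hfix hT).trans ?_
  -- The absolute value in `rateConst` is there for values f₀ < fstar that no problem attains.
  rw [h0, rateConst, abs_of_nonneg hΔ]
  exact rate_bound hΔ hL hσ hζ hn' hT' hα hβ (by linarith [hM.lt_one hn hp hp1]) hs hs1
    (fun h2 => by rw [hM.left_eq_zero hn hp hp1 h2, h2, sub_zero]) hγ hh

theorem rate_le_of_inv_le {C K A u T X : ℝ} (hC : 0 ≤ C) (hK : 1 ≤ K) (hA : 0 ≤ A)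
    (hu : 0 < u) (hT : 0 < T) (hX : 0 ≤ X) (huK : 1 / u ≤ K) :
    C * (A + 1 / (u * T) + X) ≤ C * K * (A + 1 / T + X) := by
  have h1 : 1 / (u * T) ≤ K * (1 / T) := by
    calc 1 / (u * T) = 1 / u * (1 / T) := by field_simp
      _ ≤ _ := by gcongr
  rw [mul_assoc]
  gcongr
  nlinarith

theorem linear_speedup_bound {n T q σ ζ α u : ℝ} (hn : 1 ≤ n) (hT : n ^ 3 ≤ T) (hq : 0 < q)
    (hσ : 0 < σ) (hζ : 0 ≤ ζ) (hα : 0 ≤ α) (hnα : n * α ≤ 2 * (q⁻¹ + 1)) (hu : q ^ 2 / 2 ≤ u) :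
    (σ + ζ) * (1 + √(n * α)) / (u * √(n * T)) + 1 / (u * T) +
        n * (σ ^ 2 + ζ ^ 2) / ((1 + n * α) * σ ^ 2 * T + n * α * T * ζ ^ 2) ≤
      ((σ + ζ) * (1 + √(2 * (q⁻¹ + 1))) * (2 / q ^ 2) + 2 / q ^ 2 +
        (σ ^ 2 + ζ ^ 2) / σ ^ 2) / √(n * T) := by
  have hn0 : 0 < n := by linarith
  have hT0 : 0 < T := lt_of_lt_of_le (by positivity) hT
  have hu0 : 0 < u := lt_of_lt_of_le (by positivity) hu
  have hr0 : 0 < √(n * T) := Real.sqrt_pos.2 (by positivity)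
  have huinv : 1 / u ≤ 2 / q ^ 2 := by
    rw [div_le_div_iff₀ hu0 (by positivity)]
    linarith
  -- Squared, this is n³ ≤ T, the only use of the lower bound on T beyond positivity.
  have hnT : n / T ≤ 1 / √(n * T) := by
    rw [div_le_div_iff₀ hT0 hr0, one_mul]
    refine abs_le_of_sq_le_sq' ?_ hT0.le |>.2
    rw [mul_pow, Real.sq_sqrt (by positivity)]
    nlinarith
  have h1T : 1 / T ≤ 1 / √(n * T) := le_trans (by gcongr) hnT
  rw [add_div, add_div]
  refine add_le_add (add_le_add ?_ ?_) ?_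
  · calc (σ + ζ) * (1 + √(n * α)) / (u * √(n * T))
        = (σ + ζ) * (1 + √(n * α)) * (1 / u) / √(n * T) := by field_simp
      _ ≤ _ := by gcongr
  · calc 1 / (u * T) = 1 / u * (1 / T) := by field_simp
      _ ≤ 2 / q ^ 2 * (1 / √(n * T)) := by gcongr
      _ = _ := by ring
  · calc n * (σ ^ 2 + ζ ^ 2) / ((1 + n * α) * σ ^ 2 * T + n * α * T * ζ ^ 2)
        ≤ n * (σ ^ 2 + ζ ^ 2) / (σ ^ 2 * T) := by
          gcongr
          have h1 : 0 ≤ n * α * σ ^ 2 * T := by positivity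
          have h2 : 0 ≤ n * α * T * ζ ^ 2 := by positivity
          nlinarith
      _ = (σ ^ 2 + ζ ^ 2) / σ ^ 2 * (n / T) := by field_simp
      _ ≤ (σ ^ 2 + ζ ^ 2) / σ ^ 2 * (1 / √(n * T)) := by gcongr
      _ = _ := by ring

end RPS

theorem corollary1 :
    -- the constants `α₁`, `α₂` exist
    (∀ (n : ℕ) (p : ℝ), 2 ≤ n → 0 ≤ p → p < 1 →
      ∃ α₁ α₂ : ℝ, RPS.IsMixing n p α₁ α₂ ∧ 0 ≤ α₂ ∧ α₂ ≤ α₁ ∧ α₁ < 1 ∧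
        (0 < p → 0 < α₂ ∧ α₂ < α₁)) ∧
    -- the rate, with a constant that depends only on `L`, `f(0)` and `inf f`
    (∀ L f₀ fstar : ℝ, 0 < L → ∃ C : ℝ,
      ∀ (n T : ℕ) (p α₁ α₂ σ ζ : ℝ), 2 ≤ n → 1 ≤ T → 0 ≤ p → p < 1 → 0 ≤ σ → 0 ≤ ζ →
        RPS.IsMixing n p α₁ α₂ →
        RPS.GuaranteedRate n T p (RPS.stepSize n T α₁ α₂ L σ ζ) L σ ζ f₀ fstar
          (C * ((σ + ζ) * (1 + √(n * α₂)) / ((1 - √(α₁ - α₂)) * √(n * T))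
            + 1 / ((1 - √(α₁ - α₂)) * T)
            + n * (σ ^ 2 + ζ ^ 2) / ((1 + n * α₂) * σ ^ 2 * T + n * α₂ * T * ζ ^ 2)))) ∧
    -- the middle term is `1 / T` as long as the drop rate stays away from `1`
    (∀ L f₀ fstar pmax : ℝ, 0 < L → pmax < 1 → ∃ C : ℝ,
      ∀ (n T : ℕ) (p α₁ α₂ σ ζ : ℝ), 2 ≤ n → 1 ≤ T → 0 ≤ p → p ≤ pmax → 0 ≤ σ → 0 ≤ ζ →
        RPS.IsMixing n p α₁ α₂ →
        RPS.GuaranteedRate n T p (RPS.stepSize n T α₁ α₂ L σ ζ) L σ ζ f₀ fstar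
          (C * ((σ + ζ) * (1 + √(n * α₂)) / ((1 - √(α₁ - α₂)) * √(n * T))
            + 1 / T
            + n * (σ ^ 2 + ζ ^ 2) / ((1 + n * α₂) * σ ^ 2 * T + n * α₂ * T * ζ ^ 2)))) ∧
    -- linear speedup: the rate `O(1 / √(n T))`
    (∀ L f₀ fstar p σ ζ : ℝ, 0 < L → 0 ≤ p → p < 1 → 0 < σ → 0 ≤ ζ → ∃ C : ℝ,
      ∀ (n T : ℕ) (α₁ α₂ : ℝ), 2 ≤ n → n ^ 3 ≤ T → RPS.IsMixing n p α₁ α₂ →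
        RPS.GuaranteedRate n T p (RPS.stepSize n T α₁ α₂ L σ ζ) L σ ζ f₀ fstar
          (C / √(n * T))) := by
  refine ⟨fun n p hn hp hp1 => ?_, fun L f₀ fstar hL => ?_, fun L f₀ fstar pmax hL hpmax => ?_,
    fun L f₀ fstar p σ ζ hL hp hp1 hσ hζ => ?_⟩
  · obtain ⟨α₁, α₂, hM⟩ := RPS.exists_isMixing hn p
    exact ⟨α₁, α₂, hM, hM.nonneg hn hp hp1, hM.le hn hp hp1, hM.lt_one hn hp hp1,
      fun hp0 => ⟨hM.pos hn hp0 hp1, hM.lt hn hp0 hp1⟩⟩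
  · exact ⟨RPS.rateConst L f₀ fstar, fun n T p α₁ α₂ σ ζ hn hT hp hp1 hσ hζ hM =>
      RPS.guaranteedRate_stepSize hL f₀ fstar hn hT hp hp1 hσ hζ hM⟩
  -- The first summand bounds 1/(1 − √β); the added 1 makes the factor at least 1, so that it can
  -- multiply the other two terms as well.
  · refine ⟨RPS.rateConst L f₀ fstar * (2 / (1 - pmax) ^ 2 + 1),
      fun n T p α₁ α₂ σ ζ hn hT hp hpp hσ hζ hM => ?_⟩
    have hp1 : p < 1 := hpp.trans_lt hpmax
    have hq : 0 < 1 - pmax := by linarith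
    have hT' : (0 : ℝ) < T := by exact_mod_cast hT
    have hα := hM.nonneg hn hp hp1
    have hu : (1 - pmax) ^ 2 / 2 ≤ 1 - √(α₁ - α₂) :=
      le_trans (by gcongr) (hM.one_sub_sqrt_ge hn hp hp1)
    have hu0 : 0 < 1 - √(α₁ - α₂) := lt_of_lt_of_le (by positivity) hu
    refine (RPS.guaranteedRate_stepSize hL f₀ fstar hn hT hp hp1 hσ hζ hM).mono
      (RPS.rate_le_of_inv_le (RPS.rateConst_nonneg hL _ _) ?_ (by positivity) hu0 hT'
        (by positivity) ?_)
    · have : 0 ≤ 2 / (1 - pmax) ^ 2 := by positivity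
      linarith
    · have : 1 / (1 - √(α₁ - α₂)) ≤ 2 / (1 - pmax) ^ 2 := by
        rw [div_le_div_iff₀ hu0 (by positivity)]
        linarith
      linarith
  · refine ⟨RPS.rateConst L f₀ fstar * ((σ + ζ) * (1 + √(2 * ((1 - p)⁻¹ + 1))) *
      (2 / (1 - p) ^ 2) + 2 / (1 - p) ^ 2 + (σ ^ 2 + ζ ^ 2) / σ ^ 2),
      fun n T α₁ α₂ hn hT hM => ?_⟩
    have hT1 : 1 ≤ T := le_trans (Nat.one_le_pow _ _ (by omega)) hT
    refine (RPS.guaranteedRate_stepSize hL f₀ fstar hn hT1 hp hp1 hσ.le hζ hM).mono ?_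
    rw [mul_div_assoc (RPS.rateConst L f₀ fstar)]
    refine mul_le_mul_of_nonneg_left ?_ (RPS.rateConst_nonneg hL _ _)
    exact RPS.linear_speedup_bound (by exact_mod_cast (by omega : 1 ≤ n)) (by exact_mod_cast hT)
      (by linarith) hσ hζ (hM.nonneg hn hp hp1) (hM.mul_right_le hn hp hp1)
      (hM.one_sub_sqrt_ge hn hp hp1)
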